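/- **Setting.** Let $X$ and $M$ be finite-dimensional second countable Hausdorff $C^\infty$ manifolds (for instance connected Riemannian manifolds). Let $\sigma$ be a nonatomic Radon measure on $X$ and $p(x,dm)$ an ($s$-finite) kernel from $X$ to $M$ such that the measure $\tilde\sigma(dx,dm)=p(x,dm)\,\sigma(dx)$ on $X\times M$ satisfies $\tilde\sigma(\Lambda\times M)<\infty$ for every Borel set $\Lambda\subset X$ with compact closure. Let $\Omega$ be the marked configuration space: the set of all $\omega\subset X\times M$ in which distinct points have distinct $X$-coordinates and whose projection to $X$ is locally finite, with the smallest $\sigma$-algebra that makes $\omega\mapsto\#(\omega\cap B)$ measurable for each Borel $B\subset X\times M$ whose projection to $X$ is Borel with compact closure. Let $\pi_{\tilde\sigma}$ be the marked Poisson measure with Lévy measure $\tilde\sigma$: the probability measure on $\Omega$ whose image under $\omega\mapsto\omega\cap(\Lambda\times M)$ is, for each open relatively compact $\Lambda\subset X$, $$e^{-\tilde\sigma(\Lambda\times M)}\sum_{n\ge0}\frac1{n!}\,(\tilde\sigma|_{\Lambda\times M})^{\otimes n}\circ\big[(z_1,\dots,z_n)\mapsto\{z_1,\dots,z_n\}\big]^{-1}.$$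 Let $\mathcal F=\bigoplus_{n\ge0}L^2(\tilde\sigma)^{\widehat\otimes n}\,n!$ be the (real) symmetric Fock space over $L^2(\tilde\sigma)$, with $\|(f^{(n)})\|^2=\sum_n n!\,|f^{(n)}|^2_{L^2(\tilde\sigma^{\otimes n})}$. Put $\mathfrak D_0=C_0^\infty(X\times M)$ and $\langle\varphi,\omega\rangle=\sum_{z\in\omega}\varphi(z)$, and let $I:\mathcal F\to L^2(\pi_{\tilde\sigma})$ be the unitary isomorphism with $I(\varphi^{\otimes n})=Q_n(\varphi^{\otimes n};\cdot)$ for $\varphi\in\mathfrak D_0$, where $Q_n(\,\cdot\,;\omega)$ is linear on the $n$-th symmetric algebraic tensor power of $\mathfrak D_0$, $Q_0(1;\omega)=1$ and $$Q_{n+1}(\varphi^{\otimes(n+1)};\omega)=Q_n(\varphi^{\otimes n};\omega)\Big(\langle\varphi,\omega\rangle-\int\varphi\,d\tilde\sigma\Big)-n\,Q_n(\varphi^{\otimes(n-1)}\widehat\otimes\varphi^2;\omega)-n\,Q_{n-1}(\varphi^{\otimes(n-1)};\omega)\int\varphi^2\,d\tilde\sigma .$$ For a contraction $B$ of $L^2(\tilde\sigma)$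 let $\operatorname{Exp}B$ be the operator on $\mathcal F$ that equals $B^{\otimes n}$ on the $n$-th summand (the identity for $n=0$). For a positive (i.e. nonnegative) self-adjoint operator $A$ on $L^2(\tilde\sigma)$ let $d\operatorname{Exp}A$ be the generator of the semigroup $\operatorname{Exp}(e^{-tA})$, $t\ge0$, i.e. $\operatorname{Exp}(e^{-tA})=\exp(-t\,d\operatorname{Exp}A)$, and let $H_A^{\mathrm{MP}}=I\,(d\operatorname{Exp}A)\,I^{-1}$ be its image in $L^2(\pi_{\tilde\sigma})$. Let $\mathcal{FP}$ be the set of polynomial cylinder functions $F(\omega)=g(\langle\varphi_1,\omega\rangle,\dots,\langle\varphi_N,\omega\rangle)$ with $g$ a real polynomial and $\varphi_1,\dots,\varphi_N\in\mathfrak D_0$. For $F\in\mathcal{FP}$ put $$(\nabla^{\mathrm{MP}}F)(\omega,(x,m))=F(\omega+\varepsilon_{(x,m)})-F(\omega),$$ where $\omega+\varepsilon_{(x,m)}=\omega\cup\{(x,m)\}$. For fixed $\omega$ this is defined for $\tilde\sigma$-almost all $(x,m)$, namely whenever no point of $\omega$ lies over $x$. **Theorem 6.1.** Let $A$ be a positive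 self-adjoint operator on $L^2(\tilde\sigma)$ with $\mathfrak D_0\subset\operatorname{Dom}A$. Then $\mathcal{FP}\subset L^2(\pi_{\tilde\sigma})$ and $\mathcal{FP}\subset\operatorname{Dom}H_A^{\mathrm{MP}}$; for each $F\in\mathcal{FP}$ and each $\omega\in\Omega$, $\nabla^{\mathrm{MP}}F(\omega,\cdot)$ is in $L^2(\tilde\sigma)$ and in $\operatorname{Dom}A$; and for all $F_1,F_2\in\mathcal{FP}$ the function $\omega\mapsto(\nabla^{\mathrm{MP}}F_1(\omega),A\nabla^{\mathrm{MP}}F_2(\omega))_{L^2(\tilde\sigma)}$ is $\pi_{\tilde\sigma}$-integrable and $$(H_A^{\mathrm{MP}}F_1,F_2)_{L^2(\pi_{\tilde\sigma})}=\int_\Omega(\nabla^{\mathrm{MP}}F_1(\omega),A\nabla^{\mathrm{MP}}F_2(\omega))_{L^2(\tilde\sigma)}\,\pi_{\tilde\sigma}(d\omega).$$ -/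

import Mathlib

open MeasureTheory ProbabilityTheory Filter Topology Set
open scoped NNReal ENNReal Manifold

noncomputable section

/-! ### Marked configurations -/

section Configurations

/-- The marked configuration space over `X` with marks in `M`: the subsets `ω` of `X × M` in which
distinct points have distinct `X`-coordinates and whose projection to `X` is locally finite. -/
def MarkedConfig (X M : Type*) [TopologicalSpace X] : Type _ :=
  {ω : Set (X × M) // InjOn Prod.fst ω ∧ ∀ K : Set X, IsCompact K → (Prod.fst '' ω ∩ K).Finite}

variable {X M : Type*} [TopologicalSpace X] [TopologicalSpace M]
  [MeasurableSpace X] [MeasurableSpace M]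

/-- Borel subsets of `X` with compact closure. -/
def IsBc (L : Set X) : Prop := MeasurableSet L ∧ IsCompact (closure L)

/-- Borel subsets of `X × M` whose projection to `X` is Borel with compact closure. -/
def IsBcMarked (B : Set (X × M)) : Prop := MeasurableSet B ∧ IsBc (Prod.fst '' B)

/-- The counting function `N_B(ω) = #(ω ∩ B)`. -/
def countIn (B : Set (X × M)) (ω : MarkedConfig X M) : ℕ := (ω.1 ∩ B).ncard

/-- The smallest σ-algebra making all the counting functions `N_B` measurable. -/
instance MarkedConfig.instMeasurableSpace : MeasurableSpace (MarkedConfig X M) :=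
  ⨆ (B : Set (X × M)) (_ : IsBcMarked B), MeasurableSpace.comap (countIn B) ⊤

/-- The empty configuration. -/
def MarkedConfig.empty : MarkedConfig X M := ⟨∅, by simp, by simp⟩

/-- The restriction `p_L(ω) = ω ∩ (L × M)`. -/
def MarkedConfig.restrict (L : Set X) (ω : MarkedConfig X M) : MarkedConfig X M :=
  ⟨ω.1 ∩ L ×ˢ univ, ω.2.1.mono inter_subset_left, fun K hK =>
    (ω.2.2 K hK).subset (inter_subset_inter_left _ (image_mono inter_subset_left))⟩

open Classical in
/-- The map `((x₁, m₁), …, (xₙ, mₙ)) ↦ {(x₁, m₁), …, (xₙ, mₙ)}` on tuples with pairwise distinct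
`X`-coordinates; the remaining tuples, which form a null set below, go to `∅`. -/
def MarkedConfig.ofTuple (n : ℕ) (z : Fin n → X × M) : MarkedConfig X M :=
  if h : Function.Injective (fun i => (z i).1) then
    ⟨range z, by
      rintro _ ⟨i, rfl⟩ _ ⟨j, rfl⟩ hij
      rw [h hij], fun _ _ => ((finite_range z).image _).inter_of_left _⟩
  else MarkedConfig.empty

open Classical in
/-- `ω + ε_{(x,m)}`, that is `ω ∪ {(x,m)}`, when no point of `ω` lies over `x`. For a fixed `ω` only
the points `(x,m)` with `x` in the countable projection of `ω` are left out, and there the value is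
taken to be `ω`. -/
def MarkedConfig.addPoint (ω : MarkedConfig X M) (z : X × M) : MarkedConfig X M :=
  if h : z.1 ∉ Prod.fst '' ω.1 then
    ⟨insert z ω.1, by
      have hz : z ∉ ω.1 := fun hz => h ⟨z, hz, rfl⟩
      exact (injOn_insert hz).2 ⟨ω.2.1, h⟩, fun K hK => by
      rw [image_insert_eq]
      refine ((ω.2.2 K hK).insert z.1).subset ?_
      rintro x ⟨hx | hx, hK'⟩
      · exact Or.inl hx
      · exact Or.inr ⟨hx, hK'⟩⟩
  else ω

/-- `⟨f, ω⟩ = ∑_{(x,m) ∈ ω} f(x,m)`, a finite sum when `f` has compact support. -/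
def pairing (f : X × M → ℝ) (ω : MarkedConfig X M) : ℝ := ∑ᶠ z ∈ ω.1, f z

/-- The finite-volume marked Poisson measure
`e^{-τ(L × M)} ∑ₙ (1/n!) (τ restricted to L × M)^{⊗ n} ∘ (tuple ↦ configuration)⁻¹`. -/
def poissonIn (τ : Measure (X × M)) (L : Set X) : Measure (MarkedConfig X M) :=
  ENNReal.ofReal (Real.exp (-(τ (L ×ˢ univ)).toReal)) •
    Measure.sum fun n : ℕ => ((n.factorial : ℝ≥0∞)⁻¹) •
      (Measure.pi fun _ : Fin n => τ.restrict (L ×ˢ univ)).map (MarkedConfig.ofTuple n)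

/-- `π` is the marked Poisson measure with Lévy measure `τ`: the probability measure on the marked
configuration space whose image under `ω ↦ ω ∩ (L × M)`, for each open relatively compact `L`,
is the finite-volume marked Poisson measure. -/
def IsMarkedPoisson (τ : Measure (X × M)) (π : Measure (MarkedConfig X M)) : Prop :=
  IsProbabilityMeasure π ∧ ∀ L : Set X, IsOpen L → IsCompact (closure L) →
    π.map (MarkedConfig.restrict L) = poissonIn τ L

/-- The marked Poisson gradient `(∇F)(ω, (x,m)) = F(ω + ε_{(x,m)}) - F(ω)`. -/
def gradMP (F : MarkedConfig X M → ℝ) (ω : MarkedConfig X M) (z : X × M) : ℝ :=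
  F (ω.addPoint z) - F ω

/-- Polynomial cylinder functions
`F(ω) = g(⟨φ₁, ω⟩, …, ⟨φ_N, ω⟩)`, `g` a real polynomial and `φ₁, …, φ_N ∈ D`. -/
def PolyCylinder (D : Set (X × M → ℝ)) : Set (MarkedConfig X M → ℝ) :=
  {F | ∃ (N : ℕ) (φ : Fin N → X × M → ℝ) (g : MvPolynomial (Fin N) ℝ),
    (∀ i, φ i ∈ D) ∧ ∀ ω, F ω = MvPolynomial.eval (fun i => pairing (φ i) ω) g}

/-- The polynomials `Q_n(φ₀ ⊗̂ ⋯ ⊗̂ φₙ₋₁; ω)`, by the recursion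
`Q_{n+1}(φ₀ ⊗̂ ψ₁ ⊗̂ ⋯ ⊗̂ ψₙ) = Q_n(ψ₁ ⊗̂ ⋯ ⊗̂ ψₙ) (⟨ω, φ₀⟩ - ∫ φ₀ dτ)
  - ∑ᵢ Q_n(ψ₁ ⊗̂ ⋯ ⊗̂ φ₀ψᵢ ⊗̂ ⋯ ⊗̂ ψₙ) - ∑ᵢ (∫ φ₀ψᵢ dτ) Q_{n-1}(ψ₁ ⊗̂ ⋯ (without ψᵢ) ⋯ ⊗̂ ψₙ)`,
the polarized form of
`Q_{n+1}(φ^{⊗(n+1)}) = Q_n(φ^{⊗n}) (⟨ω, φ⟩ - ∫ φ dτ) - n Q_n(φ^{⊗(n-1)} ⊗̂ φ²)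
  - n (∫ φ² dτ) Q_{n-1}(φ^{⊗(n-1)})`. -/
def charlierQ (τ : Measure (X × M)) (ω : MarkedConfig X M) :
    (n : ℕ) → (Fin n → X × M → ℝ) → ℝ
  | 0, _ => 1
  | 1, φ => pairing (φ 0) ω - ∫ z, φ 0 z ∂τ
  | n + 2, φ =>
      let ψ : Fin (n + 1) → X × M → ℝ := Fin.tail φ
      charlierQ τ ω (n + 1) ψ * (pairing (φ 0) ω - ∫ z, φ 0 z ∂τ)
        - ∑ i, charlierQ τ ω (n + 1) (Function.update ψ i (fun z => φ 0 z * ψ i z))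
        - ∑ i, (∫ z, φ 0 z * ψ i z ∂τ) * charlierQ τ ω n (fun j => ψ (i.succAbove j))

end Configurations

/-- The set `C_0^∞(X × M)` of smooth compactly supported real functions on the product of a
`d`-dimensional and a `k`-dimensional smooth manifold. -/
def TestFun (d k : ℕ) (X M : Type*) [TopologicalSpace X] [TopologicalSpace M]
    [ChartedSpace (EuclideanSpace ℝ (Fin d)) X] [ChartedSpace (EuclideanSpace ℝ (Fin k)) M] :
    Set (X × M → ℝ) :=
  {φ | ContMDiff ((𝓡 d).prod (𝓡 k)) 𝓘(ℝ) ((⊤ : ℕ∞) : WithTop ℕ∞) φ ∧ HasCompactSupport φ}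

open Classical in
/-- The class in `L²(μ)` of a square-integrable function (and `0` for any other function). -/
def toL2 {Z : Type*} [MeasurableSpace Z] (μ : Measure Z) (f : Z → ℝ) : Lp ℝ 2 μ :=
  if h : MemLp f 2 μ then h.toLp f else 0

/-! ### Semigroups and their generators -/

section Semigroups

variable {H : Type*} [NormedAddCommGroup H] [InnerProductSpace ℝ H]

/-- The graph of the operator `f ↦ lim_{t ↓ 0} (f - S_t f) / t`. -/
def genGraph (S : ℝ≥0 → H →L[ℝ] H) : Submodule ℝ (H × H) where
  carrier := {x | Tendsto (fun t : ℝ≥0 => (t : ℝ)⁻¹ • (x.1 - S t x.1)) (𝓝[>] 0) (𝓝 x.2)}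
  zero_mem' := by simp
  add_mem' {x y} hx hy := by
    refine (Tendsto.add hx hy).congr fun t => ?_
    simp only [Prod.fst_add, map_add, ← smul_add]
    congr 1
    abel
  smul_mem' c x hx := by
    refine (Tendsto.const_smul hx c).congr fun t => ?_
    simp only [Prod.smul_fst, map_smul, ← smul_sub]
    rw [smul_comm]

/-- The generator of `S`, with the sign convention `S_t = e^{-tL}`: the operator
`L f = lim_{t ↓ 0} (f - S_t f) / t` on the domain of all `f` for which the limit exists. -/
def semigroupGenerator (S : ℝ≥0 → H →L[ℝ] H) : H →ₗ.[ℝ] H := (genGraph S).toLinearPMap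

/-- Strongly continuous contraction semigroups. -/
structure IsContractionSemigroup (S : ℝ≥0 → H →L[ℝ] H) : Prop where
  zero : S 0 = ContinuousLinearMap.id ℝ H
  add : ∀ s t, S (s + t) = (S s).comp (S t)
  norm_le : ∀ t, ‖S t‖ ≤ 1
  cont : ∀ f, Continuous fun t => S t f

open Classical in
/-- `e^{-tA}`, `t ≥ 0`: the unique strongly continuous contraction semigroup whose generator
(with the above sign convention) is `A`. It exists for each positive self-adjoint `A`; if there is
none the value is `0`. -/
def expNeg (A : H →ₗ.[ℝ] H) : ℝ≥0 → H →L[ℝ] H :=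
  if h : ∃ S : ℝ≥0 → H →L[ℝ] H, IsContractionSemigroup S ∧ semigroupGenerator S = A
  then h.choose else 0

/-- The image `U L U⁻¹` of an operator `L` under an (injective) linear map `U`, with domain `U (Dom L)`. -/
def imageOperator {K : Type*} [NormedAddCommGroup K] [InnerProductSpace ℝ K]
    (U : H →ₗ[ℝ] K) (L : H →ₗ.[ℝ] H) : K →ₗ.[ℝ] K :=
  (L.graph.map (U.prodMap U)).toLinearPMap

end Semigroups

/-! ### The symmetric Fock space over `L²(τ)` and second quantization -/

section Fock

variable {Z : Type*} [MeasurableSpace Z]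

/-- The measure `n! · τ^{⊗n}`, whose `L²`-norm squared is `n! ∫ |f|² dτ^{⊗n}`. -/
def weightedPow (τ : Measure Z) (n : ℕ) : Measure (Fin n → Z) :=
  (n.factorial : ℝ≥0∞) • Measure.pi fun _ : Fin n => τ

/-- The tensor power `f^{⊗n}(z₁, …, zₙ) = f(z₁) ⋯ f(zₙ)` of `f ∈ L²(τ)`. -/
def tensorPow (τ : Measure Z) (n : ℕ) (f : Lp ℝ 2 τ) : Lp ℝ 2 (weightedPow τ n) :=
  toL2 _ fun z => ∏ i, f (z i)

/-- The `n`-th symmetric tensor power of `L²(τ)`, the closed span of all `f^{⊗n}` (equivalently, by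
polarization, the symmetric functions in `L²(τ^{⊗n})`), with norm squared `n! |f|²`. -/
def fockN (τ : Measure Z) (n : ℕ) : Submodule ℝ (Lp ℝ 2 (weightedPow τ n)) :=
  (Submodule.span ℝ (range (tensorPow τ n))).topologicalClosure

/-- The symmetric Fock space: the Hilbert sum of the symmetric tensor powers, with norm squared
`∑ₙ n! |f⁽ⁿ⁾|²`. -/
abbrev Fock (τ : Measure Z) : Type _ := lp (fun n : ℕ => fockN τ n) 2

/-- `f^{⊗n}` as an element of the Fock space. -/
def fockPow (τ : Measure Z) (n : ℕ) (f : Lp ℝ 2 τ) : Fock τ :=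
  lp.single 2 n ⟨tensorPow τ n f,
    Submodule.le_topologicalClosure _ (Submodule.subset_span (mem_range_self f))⟩

open Classical in
/-- `Exp B`, for a contraction `B` of `L²(τ)`: the unique bounded operator on the Fock space that is
`B ⊗ ⋯ ⊗ B` on each symmetric tensor power, i.e. `f^{⊗n} ↦ (Bf)^{⊗n}` (and the identity for
`n = 0`). -/
def fockExp (τ : Measure Z) (B : Lp ℝ 2 τ →L[ℝ] Lp ℝ 2 τ) : Fock τ →L[ℝ] Fock τ :=
  if h : ∃ C : Fock τ →L[ℝ] Fock τ, ∀ n f, C (fockPow τ n f) = fockPow τ n (B f)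
  then h.choose else 0

/-- The second quantization `d Exp A`, the generator of the semigroup `Exp (e^{-tA})`, `t ≥ 0`. -/
def dExp (τ : Measure Z) (A : Lp ℝ 2 τ →ₗ.[ℝ] Lp ℝ 2 τ) : Fock τ →ₗ.[ℝ] Fock τ :=
  semigroupGenerator fun t => fockExp τ (expNeg A t)

end Fock

section ChaosDecomposition

variable {X M : Type*} [TopologicalSpace X] [TopologicalSpace M]
  [MeasurableSpace X] [MeasurableSpace M]

open Classical in
/-- The chaos decomposition map from the Fock space over `L²(τ)` to `L²(π)`: the unique isometry
with `φ^{⊗n} ↦ Q_n(φ^{⊗n}; ·)` for `φ ∈ D` (for `D` a dense algebra such as `C_0^∞(X × M)`). -/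
def chaosMap (D : Set (X × M → ℝ)) (τ : Measure (X × M)) (π : Measure (MarkedConfig X M)) :
    Fock τ →ₗ[ℝ] Lp ℝ 2 π :=
  if h : ∃ U : Fock τ →ₗᵢ[ℝ] Lp ℝ 2 π, ∀ n, ∀ φ ∈ D,
      U (fockPow τ n (toL2 τ φ)) = toL2 π fun ω => charlierQ τ ω n fun _ => φ
  then h.choose.toLinearMap else 0

/-- The image in `L²(π)` of the second quantization `d Exp A`. -/
def hamiltonianMP (D : Set (X × M → ℝ)) (τ : Measure (X × M)) (π : Measure (MarkedConfig X M))
    (A : Lp ℝ 2 τ →ₗ.[ℝ] Lp ℝ 2 τ) : Lp ℝ 2 π →ₗ.[ℝ] Lp ℝ 2 π :=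
  imageOperator (chaosMap D τ π) (dExp τ A)

end ChaosDecomposition

end

noncomputable section

/-! ### Generation of contraction semigroups by positive self-adjoint operators -/

section GeneratorGraph

variable {H : Type*} [NormedAddCommGroup H] [InnerProductSpace ℝ H]

/-! Both sides of the formula are bilinear, so it is enough to compare them on a spanning family of
cylinder functions, namely the Charlier polynomials Q_n(φ^{⊗n}), φ a test function. Their span
contains the constants and is stable under multiplication by ⟨φ, ·⟩: the recursion, solved for the
product, expresses it through polynomials Q_k with mixed arguments, and polarization
(`factorial_mul_charlierQ`) turns these back into pure powers. Hence it contains all polynomial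
cylinder functions (`polyCylinder_subset_charlierSpan`).

On this family three computations suffice. The gradient lowers the degree: ∇Q_n(φ^{⊗n})(ω, z) = n
Q_{n-1}(φ^{⊗(n-1)}; ω) φ(z) (`charlierQ_const_addPoint`). The polynomials are orthogonal: ∫
Q_n(φ^{⊗n}) Q_m(ψ^{⊗m}) dπ = δ_{nm} n! (φ, ψ)^n (`integral_charlierQ_mul`). The second quantization
acts as a derivation: (dExp A φ^{⊗n}, ψ^{⊗m}) = δ_{nm} n! n (φ, ψ)^{n-1} (Aφ, ψ)
(`exists_mem_graph_dExp`). The right side of the formula then carries n m (φ, Aψ) δ_{nm} (n-1)! (φ,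
ψ)^{n-1}, and the two sides agree because n · n! = n² (n-1)! and A is symmetric.

Orthogonality comes from the Poisson series. Over a bounded region the expectation is a sum over N
of integrals over N-tuples; singling out one point of the tuple and shifting N by one, which is
Mecke's identity in elementary form, lowers both degrees (`integral_charlierQ_succ`).

Several objects are specified by a property and chosen if they exist, so existence is part of the
proof. The semigroup e^{-tA} is built by Yosida approximation; Exp B exists because powers of Gram
matrices decrease under a contraction, by the Schur product theorem; the chaos map exists because
orthogonality says that the Q_n(φ^{⊗n}) have the Gram matrix of the total family φ^{⊗n} in Fock
space. -/

theorem snd_eq_zero_of_mem_genGraph {S : ℝ≥0 → H →L[ℝ] H} (x : H × H) (hx : x ∈ genGraph S)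
    (h0 : x.1 = 0) : x.2 = 0 := by
  have hx' : Tendsto (fun t : ℝ≥0 => (t : ℝ)⁻¹ • (x.1 - S t x.1)) (𝓝[>] 0) (𝓝 x.2) := hx
  simp only [h0, map_zero, sub_zero, smul_zero] at hx'
  exact (tendsto_nhds_unique hx' tendsto_const_nhds)

theorem graph_semigroupGenerator (S : ℝ≥0 → H →L[ℝ] H) :
    (semigroupGenerator S).graph = genGraph S :=
  Submodule.toLinearPMap_graph_eq _ snd_eq_zero_of_mem_genGraph

/-- Cauchy–Schwarz and contractivity give (f, f - S_t f) ≥ 0 for every t, and the sign survives the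
limit. This shows later that a generator extending A cannot be larger than A. -/
theorem inner_nonneg_of_mem_genGraph {S : ℝ≥0 → H →L[ℝ] H} (hS : ∀ t, ‖S t‖ ≤ 1) {x : H × H}
    (hx : x ∈ genGraph S) : 0 ≤ inner ℝ x.1 x.2 := by
  have hx' : Tendsto (fun t : ℝ≥0 => (t : ℝ)⁻¹ • (x.1 - S t x.1)) (𝓝[>] 0) (𝓝 x.2) := hx
  refine ge_of_tendsto' (tendsto_const_nhds.inner hx' : Tendsto
    (fun t : ℝ≥0 => inner ℝ x.1 ((t : ℝ)⁻¹ • (x.1 - S t x.1))) _ _) fun t => ?_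
  rw [inner_smul_right, inner_sub_right]
  refine mul_nonneg (by positivity) (sub_nonneg.2 ?_)
  rw [real_inner_self_eq_norm_mul_norm]
  refine (real_inner_le_norm _ _).trans (mul_le_mul_of_nonneg_left ?_ (norm_nonneg _))
  simpa using (S t).le_of_opNorm_le (hS t) x.1

end GeneratorGraph

/-! ### Exponentials of bounded positive operators -/

section BoundedGenerator

variable {H : Type*} [NormedAddCommGroup H] [InnerProductSpace ℝ H] [CompleteSpace H]

/-- The exponential `e^{-tB}` of a bounded operator. -/
def boundedSemigroup (B : H →L[ℝ] H) (t : ℝ) : H →L[ℝ] H := NormedSpace.exp ((-t) • B)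

theorem hasDerivAt_boundedSemigroup (B : H →L[ℝ] H) (t : ℝ) :
    HasDerivAt (boundedSemigroup B) (-(boundedSemigroup B t * B)) t := by
  have h := (hasDerivAt_exp_smul_const (𝕂 := ℝ) B (-t)).scomp t (hasDerivAt_neg t)
  have e : boundedSemigroup B = (fun u : ℝ => NormedSpace.exp (u • B)) ∘ fun t : ℝ => -t := rfl
  rw [e]
  simpa [boundedSemigroup] using h

theorem boundedSemigroup_zero (B : H →L[ℝ] H) : boundedSemigroup B 0 = 1 := by
  simp [boundedSemigroup]

theorem boundedSemigroup_add (B : H →L[ℝ] H) (s t : ℝ) :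
    boundedSemigroup B (s + t) = boundedSemigroup B s * boundedSemigroup B t := by
  let _ : NormedAlgebra ℚ (H →L[ℝ] H) := NormedAlgebra.restrictScalars ℚ ℝ _
  rw [boundedSemigroup, boundedSemigroup, boundedSemigroup,
    ← NormedSpace.exp_add_of_commute (((Commute.refl B).smul_left _).smul_right _), ← add_smul]
  congr 2
  ring

theorem Commute.boundedSemigroup_left {B C : H →L[ℝ] H} (h : Commute B C) (t : ℝ) :
    Commute (boundedSemigroup B t) C := by
  let _ : NormedAlgebra ℚ (H →L[ℝ] H) := NormedAlgebra.restrictScalars ℚ ℝ _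
  exact (h.smul_left _).exp_left

theorem boundedSemigroup_of_zero (t : ℝ) : boundedSemigroup (0 : H →L[ℝ] H) t = 1 := by
  simp [boundedSemigroup]

theorem hasDerivAt_boundedSemigroup_apply (B : H →L[ℝ] H) (f : H) (t : ℝ) :
    HasDerivAt (fun s => boundedSemigroup B s f) (-(boundedSemigroup B t (B f))) t := by
  have := (hasDerivAt_boundedSemigroup B t).clm_apply (hasDerivAt_const t f)
  simpa using this

/-- The derivative of ‖e^{-tB} f‖² is -2 (e^{-tB} f, B e^{-tB} f) ≤ 0. -/
theorem norm_boundedSemigroup_le {B : H →L[ℝ] H} (hB : ∀ f, 0 ≤ inner ℝ f (B f)) {t : ℝ}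
    (ht : 0 ≤ t) (f : H) : ‖boundedSemigroup B t f‖ ≤ ‖f‖ := by
  have hd : ∀ s, HasDerivAt (fun s => ‖boundedSemigroup B s f‖ ^ 2)
      (2 * inner ℝ (boundedSemigroup B s f) (-(boundedSemigroup B s (B f)))) s := fun s =>
    (hasDerivAt_boundedSemigroup_apply B f s).norm_sq
  have hanti : Antitone (fun s => ‖boundedSemigroup B s f‖ ^ 2) := by
    refine antitone_of_deriv_nonpos (fun s => (hd s).differentiableAt) fun s => ?_
    rw [(hd s).deriv, inner_neg_right]
    have hc : boundedSemigroup B s (B f) = B (boundedSemigroup B s f) := by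
      have := ((Commute.refl B).boundedSemigroup_left s).eq
      exact DFunLike.congr_fun this f
    have := hB (boundedSemigroup B s f)
    rw [hc]
    linarith
  have := hanti ht
  simp only [boundedSemigroup_zero, one_apply_eq_self] at this
  exact (sq_le_sq₀ (norm_nonneg _) (norm_nonneg _)).1 this

/-- Duhamel's interpolation: s ↦ e^{-(t-s)B} e^{-sC} f joins e^{-tB} f to e^{-tC} f, and since B and
C commute its derivative is e^{-(t-s)B} e^{-sC} (B - C) f, of norm at most ‖Bf - Cf‖. -/
theorem norm_boundedSemigroup_sub_le {B C : H →L[ℝ] H} (hB : ∀ f, 0 ≤ inner ℝ f (B f))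
    (hC : ∀ f, 0 ≤ inner ℝ f (C f)) (h : Commute B C) {t : ℝ} (ht : 0 ≤ t) (f : H) :
    ‖boundedSemigroup C t f - boundedSemigroup B t f‖ ≤ t * ‖B f - C f‖ := by
  have hd : ∀ s, HasDerivAt (fun s => boundedSemigroup B (t - s) (boundedSemigroup C s f))
      (boundedSemigroup B (t - s) (boundedSemigroup C s (B f - C f))) s := by
    intro s
    have h1 : HasDerivAt (fun s => boundedSemigroup B (t - s)) (boundedSemigroup B (t - s) * B) s := by
      have := (hasDerivAt_boundedSemigroup B (t - s)).scomp s ((hasDerivAt_id s).const_sub t)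
      simpa [Function.comp_def] using this
    have h2 := h1.clm_apply (hasDerivAt_boundedSemigroup_apply C f s)
    have hc : boundedSemigroup C s (B f) = B (boundedSemigroup C s f) :=
      DFunLike.congr_fun (h.symm.boundedSemigroup_left s).eq f
    convert h2 using 1
    simp [hc, sub_eq_add_neg]
  have key := norm_image_sub_le_of_norm_deriv_le_segment' (a := 0) (b := t) (C := ‖B f - C f‖)
    (fun s _ => (hd s).hasDerivWithinAt) (fun s hs => ?_) t (right_mem_Icc.2 ht)
  · simpa [boundedSemigroup_zero, mul_comm] using key
  · exact (norm_boundedSemigroup_le hB (by linarith [hs.2]) _).trans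
      (norm_boundedSemigroup_le hC hs.1 _)

theorem norm_boundedSemigroup_sub_self_le {B : H →L[ℝ] H} (hB : ∀ f, 0 ≤ inner ℝ f (B f))
    {t : ℝ} (ht : 0 ≤ t) (f : H) : ‖f - boundedSemigroup B t f‖ ≤ t * ‖B f‖ := by
  have := norm_boundedSemigroup_sub_le (C := 0) hB (by simp) (Commute.zero_right B) ht f
  simpa [boundedSemigroup_of_zero] using this

/-- The derivative of s ↦ e^{-sB} f + s B f is B f - e^{-sB} B f. The estimate does not involve ‖B‖,
so it can be used uniformly along a Yosida approximation. -/
theorem norm_sub_boundedSemigroup_sub_smul_le {B : H →L[ℝ] H} (f : H) {t c : ℝ} (ht : 0 ≤ t)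
    (hc : ∀ s ∈ Icc 0 t, ‖B f - boundedSemigroup B s (B f)‖ ≤ c) :
    ‖f - boundedSemigroup B t f - t • B f‖ ≤ t * c := by
  have hd : ∀ s, HasDerivAt (fun s => boundedSemigroup B s f + s • B f)
      (-(boundedSemigroup B s (B f)) + B f) s := fun s => by
    have h := (hasDerivAt_id s).smul_const (B f)
    rw [one_smul] at h
    exact (hasDerivAt_boundedSemigroup_apply B f s).add h
  have key := norm_image_sub_le_of_norm_deriv_le_segment' (a := 0) (b := t) (C := c)
    (fun s _ => (hd s).hasDerivWithinAt) (fun s hs => ?_) t (right_mem_Icc.2 ht)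
  · rw [← norm_neg]
    simp only [boundedSemigroup_zero, one_apply_eq_self, zero_smul, add_zero,
      sub_zero, mul_comm c] at key
    have e : -(f - boundedSemigroup B t f - t • B f) = boundedSemigroup B t f + t • B f - f := by
      abel
    rwa [e]
  · rw [neg_add_eq_sub]
    exact hc s ⟨hs.1, hs.2.le⟩

end BoundedGenerator

/-! ### Yosida approximation and the semigroup of a positive self-adjoint operator -/

section Yosida

variable {H : Type*} [NormedAddCommGroup H] [InnerProductSpace ℝ H]

theorem LinearPMap.inner_nonneg_of_mem_graph {A : H →ₗ.[ℝ] H}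
    (hpos : ∀ f : A.domain, 0 ≤ inner ℝ (f : H) (A f)) {x : H × H} (hx : x ∈ A.graph) :
    0 ≤ inner ℝ x.1 x.2 := by
  obtain ⟨y, hy1, hy2⟩ := (LinearPMap.mem_graph_iff A).1 hx
  rw [← hy1, ← hy2]
  exact hpos y

variable [CompleteSpace H]

theorem IsSelfAdjoint.inner_graph {A : H →ₗ.[ℝ] H} (hA : IsSelfAdjoint A) {x y : H × H}
    (hx : x ∈ A.graph) (hy : y ∈ A.graph) : inner ℝ x.2 y.1 = inner ℝ x.1 y.2 := by
  have hf := LinearPMap.adjoint_isFormalAdjoint hA.dense_domain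
  rw [LinearPMap.isSelfAdjoint_def.1 hA] at hf
  obtain ⟨a, ha1, ha2⟩ := (LinearPMap.mem_graph_iff A).1 hx
  obtain ⟨b, hb1, hb2⟩ := (LinearPMap.mem_graph_iff A).1 hy
  rw [← ha1, ← ha2, ← hb1, ← hb2]
  exact hf a b

theorem norm_smul_le_norm_smul_add {x y : H} (h : 0 ≤ inner ℝ x y) {l : ℝ} (hl : 0 < l) :
    ‖l • x‖ ≤ ‖l • x + y‖ := by
  refine (sq_le_sq₀ (norm_nonneg _) (norm_nonneg _)).1 ?_
  rw [norm_add_sq_real, inner_smul_left]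
  have : 0 ≤ l * inner ℝ x y := mul_nonneg hl.le h
  simp only [conj_trivial]
  nlinarith [sq_nonneg ‖y‖]

/-- The resolvent `(l + A)⁻¹` of a positive self-adjoint operator. -/
theorem IsSelfAdjoint.exists_resolvent {A : H →ₗ.[ℝ] H} (hA : IsSelfAdjoint A)
    (hpos : ∀ f : A.domain, 0 ≤ inner ℝ (f : H) (A f)) {l : ℝ} (hl : 0 < l) :
    ∃ R : H →L[ℝ] H, (∀ h, (R h, h - l • R h) ∈ A.graph) ∧
      ∀ x ∈ A.graph, R (l • x.1 + x.2) = x.1 := by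
  have hclosed : IsClosed (A.graph : Set (H × H)) := hA.isClosed
  have : CompleteSpace A.graph := hclosed.completeSpace_coe
  -- The map (f, Af) ↦ l f + A f on the graph, which is complete because A is closed. Positivity
  -- bounds both coordinates of (f, Af) by the image, so T is injective with closed range.
  let T : A.graph →L[ℝ] H :=
    (l • ContinuousLinearMap.fst ℝ H H + ContinuousLinearMap.snd ℝ H H).comp A.graph.subtypeL
  have hT : ∀ x : A.graph, T x = l • x.1.1 + x.1.2 := fun x => rfl
  have hb1 : ∀ x : A.graph, ‖l • x.1.1‖ ≤ ‖T x‖ := fun x =>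
    norm_smul_le_norm_smul_add (LinearPMap.inner_nonneg_of_mem_graph hpos x.2) hl
  have hb2 : ∀ x : A.graph, ‖x.1.2‖ ≤ 2 * ‖T x‖ := fun x => by
    have : x.1.2 = T x - l • x.1.1 := by rw [hT]; abel
    rw [this]
    linarith [norm_sub_le (T x) (l • x.1.1), hb1 x]
  have hb3 : ∀ x : A.graph, ‖x.1.1‖ ≤ l⁻¹ * ‖T x‖ := fun x => by
    have := hb1 x
    rw [norm_smul, Real.norm_of_nonneg hl.le] at this
    rw [inv_mul_eq_div, le_div_iff₀ hl]
    linarith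
  have hanti : AntilipschitzWith (max l⁻¹ 2).toNNReal T :=
    AddMonoidHomClass.antilipschitz_of_bound T fun x => by
      rw [Real.coe_toNNReal _ (by positivity)]
      refine max_le ?_ ?_
      · exact (hb3 x).trans (mul_le_mul_of_nonneg_right (le_max_left _ _) (norm_nonneg _))
      · exact (hb2 x).trans (mul_le_mul_of_nonneg_right (le_max_right _ _) (norm_nonneg _))
  have hinj : (T : A.graph →ₗ[ℝ] H).ker = ⊥ := LinearMap.ker_eq_bot.2 hanti.injective
  have hrc : IsClosed ((T : A.graph →ₗ[ℝ] H).range : Set H) := by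
    exact hanti.isClosed_range T.uniformContinuous
  have hsurj : (T : A.graph →ₗ[ℝ] H).range = ⊤ := by
    rw [← hrc.submodule_topologicalClosure_eq, Submodule.topologicalClosure_eq_top_iff,
      Submodule.eq_bot_iff]
    intro g hg
    -- Orthogonality to the range of T reads (g, Af) = (-l g, f) for all f, so g lies in the domain
    -- of A* = A with A g = -l g, and positivity forces g = 0.
    have hg' : ∀ f : A.domain, inner ℝ (-(l • g)) (f : H) = inner ℝ g (A f) := fun f => by
      have h0 : inner ℝ (T ⟨((f : H), A f), A.mem_graph f⟩) g = 0 :=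
        (Submodule.mem_orthogonal _ _).1 hg _ ⟨_, rfl⟩
      rw [hT, inner_add_left, inner_smul_left, real_inner_comm g (f : H)] at h0
      rw [inner_neg_left, inner_smul_left, real_inner_comm (A f) g]
      simp only [conj_trivial] at h0 ⊢
      linarith
    have hdom := LinearPMap.mem_adjoint_domain_of_exists (T := A) g ⟨_, hg'⟩
    have hval := LinearPMap.adjoint_apply_eq hA.dense_domain ⟨g, hdom⟩ hg'
    have hmem : (g, -(l • g)) ∈ A.graph := by
      have : (g, -(l • g)) ∈ A.adjoint.graph := (LinearPMap.mem_graph_iff _).2 ⟨⟨g, hdom⟩, rfl, hval⟩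
      rwa [LinearPMap.isSelfAdjoint_def.1 hA] at this
    have h0 := LinearPMap.inner_nonneg_of_mem_graph hpos hmem
    simp only [inner_neg_right, inner_smul_right, real_inner_self_eq_norm_sq] at h0
    have : ‖g‖ ^ 2 ≤ 0 := by
      by_contra hlt
      have := mul_pos hl (not_le.1 hlt)
      linarith
    simpa using this
  let E := ContinuousLinearEquiv.ofBijective T hinj hsurj
  have hE : ∀ x, E x = T x := fun x => rfl
  refine ⟨((ContinuousLinearMap.fst ℝ H H).comp A.graph.subtypeL).comp
    (E.symm : H →L[ℝ] A.graph), fun h => ?_, fun x hx => ?_⟩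
  · have h1 : T (E.symm h) = h := by rw [← hE, E.apply_symm_apply]
    have h2 : (E.symm h).1 = ((E.symm h).1.1, h - l • (E.symm h).1.1) := by
      refine Prod.ext rfl ?_
      have h3 := hT (E.symm h)
      rw [h1] at h3
      exact (sub_eq_of_eq_add' h3).symm
    have := (E.symm h).2
    rw [h2] at this
    exact this
  · have h1 : E.symm (T ⟨x, hx⟩) = ⟨x, hx⟩ := by rw [← hE, E.symm_apply_apply]
    change (E.symm (l • x.1 + x.2)).1.1 = x.1
    have h2 : l • x.1 + x.2 = T ⟨x, hx⟩ := rfl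
    rw [h2, h1]

/-- Commuting bounded positive operators approximating a positive self-adjoint operator. -/
structure IsYosidaApprox (A : H →ₗ.[ℝ] H) (B : ℕ → H →L[ℝ] H) : Prop where
  inner_nonneg : ∀ n f, 0 ≤ inner ℝ f (B n f)
  commute : ∀ m n, Commute (B m) (B n)
  norm_le : ∀ n, ∀ x ∈ A.graph, ‖B n x.1‖ ≤ ‖x.2‖
  tendsto : ∀ x ∈ A.graph, Tendsto (fun n => B n x.1) atTop (𝓝 x.2)

theorem IsSelfAdjoint.exists_isYosidaApprox {A : H →ₗ.[ℝ] H} (hA : IsSelfAdjoint A)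
    (hpos : ∀ f : A.domain, 0 ≤ inner ℝ (f : H) (A f)) :
    ∃ B : ℕ → H →L[ℝ] H, IsYosidaApprox A B := by
  have hl : ∀ n : ℕ, (0 : ℝ) < n + 1 := fun n => by positivity
  choose R hR1 hR2 using fun n : ℕ => hA.exists_resolvent hpos (hl n)
  have hcontr : ∀ (n : ℕ) h, ‖((n : ℝ) + 1) • R n h‖ ≤ ‖h‖ := fun n h => by
    have := norm_smul_le_norm_smul_add
      (LinearPMap.inner_nonneg_of_mem_graph hpos (hR1 n h)) (hl n)
    simpa using this
  -- The resolvent identity. Comparing it with its version for m and n exchanged, and dividing by n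
  -- - m, shows that the resolvents commute.
  have hres : ∀ (m n : ℕ) h, R m h = R n h + ((n : ℝ) - m) • R m (R n h) := fun m n h => by
    have h1 := hR2 m _ (hR1 n h)
    have h2 : ((m : ℝ) + 1) • R n h + (h - ((n : ℝ) + 1) • R n h)
        = h - ((n : ℝ) - m) • R n h := by module
    simp only [h2, map_sub, map_smul] at h1
    exact sub_eq_iff_eq_add.1 h1
  have hcomm : ∀ m n, Commute (R m) (R n) := fun m n => by
    rcases eq_or_ne m n with rfl | hmn
    · exact Commute.refl _
    ext h
    have h1 := hres m n h
    have h2 := hres n m h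
    have h3 : ((n : ℝ) - m) • R m (R n h) = ((n : ℝ) - m) • R n (R m h) := by
      have : R m h - R n h = ((n : ℝ) - m) • R m (R n h) := by rw [sub_eq_iff_eq_add']; exact h1
      rw [← this, ← neg_sub, sub_eq_iff_eq_add'.2 h2, ← neg_smul]
      congr 1
      ring
    exact smul_right_injective H (sub_ne_zero.2 (by exact_mod_cast hmn.symm)) h3
  have hval : ∀ n : ℕ, ∀ x ∈ A.graph, ((n : ℝ) + 1) • (x.1 - ((n : ℝ) + 1) • R n x.1)
      = ((n : ℝ) + 1) • R n x.2 := fun n x hx => by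
    have := hR2 n x hx
    rw [map_add, map_smul] at this
    congr 1
    rw [sub_eq_iff_eq_add', this]
  have hsmall : ∀ n : ℕ, ∀ x ∈ A.graph, ‖((n : ℝ) + 1) • R n x.1 - x.1‖ ≤ ((n : ℝ) + 1)⁻¹ * ‖x.2‖ := by
    intro n x hx
    have h1 := hR2 n x hx
    rw [map_add, map_smul] at h1
    have h2 : ((n : ℝ) + 1) • R n x.1 - x.1 = -R n x.2 := by
      rw [eq_neg_iff_add_eq_zero, sub_add_eq_add_sub, h1, sub_self]
    have h3 := hcontr n x.2
    rw [norm_smul, Real.norm_of_nonneg (hl n).le] at h3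
    rw [h2, norm_neg, inv_mul_eq_div, le_div_iff₀ (hl n)]
    linarith
  have hstrong : ∀ g, Tendsto (fun n : ℕ => ((n : ℝ) + 1) • R n g) atTop (𝓝 g) := fun g => by
    rw [Metric.tendsto_atTop]
    intro ε hε
    obtain ⟨f, hf, hfg⟩ := Metric.dense_iff.1 hA.dense_domain g (ε / 3) (by positivity)
    have hlim : Tendsto (fun n : ℕ => ((n : ℝ) + 1)⁻¹ * ‖A ⟨f, hfg⟩‖) atTop (𝓝 0) := by
      have := (tendsto_one_div_add_atTop_nhds_zero_nat (𝕜 := ℝ)).mul_const ‖A ⟨f, hfg⟩‖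
      simpa using this
    obtain ⟨N, hN⟩ := (hlim.eventually (gt_mem_nhds (show 0 < ε / 3 by positivity))).exists_forall_of_atTop
    refine ⟨N, fun n hn => ?_⟩
    have h1 := hsmall n _ (A.mem_graph ⟨f, hfg⟩)
    have h2 := hcontr n (g - f)
    have h3 := hN n hn
    rw [Metric.mem_ball, dist_eq_norm] at hf
    rw [dist_eq_norm]
    have h4 : ((n : ℝ) + 1) • R n g - g = ((n : ℝ) + 1) • R n (g - f)
        + (((n : ℝ) + 1) • R n f - f) + (f - g) := by
      rw [map_sub, smul_sub]; abel
    have h5 : ‖g - f‖ = ‖f - g‖ := norm_sub_rev _ _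
    rw [h4]
    have := norm_add₃_le (a := ((n : ℝ) + 1) • R n (g - f)) (b := ((n : ℝ) + 1) • R n f - f)
      (c := f - g)
    simp only at h1
    linarith
  -- With l = n + 1 and R = (l + A)⁻¹ this is l (1 - l R) = A l R. On the domain of A it equals l R
  -- A, and l R is a contraction converging strongly to the identity.
  refine ⟨fun n => ((n : ℝ) + 1) • (1 - ((n : ℝ) + 1) • R n), ⟨fun n f => ?_, fun m n => ?_,
    fun n x hx => ?_, fun x hx => ?_⟩⟩
  · simp only [smul_apply, sub_apply,
      one_apply_eq_self]
    rw [inner_smul_right, inner_sub_right]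
    refine mul_nonneg (hl n).le (sub_nonneg.2 ?_)
    rw [real_inner_self_eq_norm_mul_norm]
    exact (real_inner_le_norm _ _).trans (mul_le_mul_of_nonneg_left (hcontr n f) (norm_nonneg _))
  · refine Commute.smul_left (Commute.smul_right ?_ _) _
    refine Commute.sub_left (Commute.one_left _) (Commute.smul_left ?_ _)
    exact (Commute.one_right _).sub_right ((hcomm m n).smul_right _)
  · have := hval n x hx
    simp only [smul_apply, sub_apply,
      one_apply_eq_self]
    rw [this]
    exact hcontr n x.2
  · refine (hstrong x.2).congr fun n => ?_
    simp only [smul_apply, sub_apply,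
      one_apply_eq_self]
    exact (hval n x hx).symm

/-- For f in the domain of A, two approximating exponentials differ at f by at most t ‖B_n f - B_m
f‖, which is small. Contractivity carries this over to all g by density. -/
theorem IsYosidaApprox.cauchySeq {A : H →ₗ.[ℝ] H} {B : ℕ → H →L[ℝ] H} (hB : IsYosidaApprox A B)
    (hd : Dense (A.domain : Set H)) {t : ℝ} (ht : 0 ≤ t) (g : H) :
    CauchySeq fun n => boundedSemigroup (B n) t g := by
  rw [Metric.cauchySeq_iff]
  intro ε hε
  obtain ⟨f, hf, hfg⟩ := Metric.dense_iff.1 hd g (ε / 3) (by positivity)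
  have hc : CauchySeq fun n => t • B n f :=
    ((hB.tendsto _ (A.mem_graph ⟨f, hfg⟩)).const_smul t).cauchySeq
  obtain ⟨N, hN⟩ := Metric.cauchySeq_iff.1 hc (ε / 3) (by positivity)
  refine ⟨N, fun m hm n hn => ?_⟩
  have h1 := hN n hn m hm
  rw [dist_eq_norm, ← smul_sub, norm_smul, Real.norm_of_nonneg ht] at h1
  have h2 := norm_boundedSemigroup_sub_le (hB.inner_nonneg n) (hB.inner_nonneg m)
    (hB.commute n m) ht f
  have h3 := norm_boundedSemigroup_le (hB.inner_nonneg m) ht (g - f)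
  have h4 := norm_boundedSemigroup_le (hB.inner_nonneg n) ht (f - g)
  rw [Metric.mem_ball, dist_eq_norm] at hf
  have h5 : ‖g - f‖ = ‖f - g‖ := norm_sub_rev _ _
  rw [dist_eq_norm]
  have h6 : boundedSemigroup (B m) t g - boundedSemigroup (B n) t g
      = boundedSemigroup (B m) t (g - f)
        + (boundedSemigroup (B m) t f - boundedSemigroup (B n) t f)
        + boundedSemigroup (B n) t (f - g) := by
    simp only [map_sub]; abel
  rw [h6]
  have := norm_add₃_le (a := boundedSemigroup (B m) t (g - f))
    (b := boundedSemigroup (B m) t f - boundedSemigroup (B n) t f)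
    (c := boundedSemigroup (B n) t (f - g))
  linarith

/-- A positive self-adjoint operator generates a contraction semigroup. -/
theorem IsSelfAdjoint.exists_isContractionSemigroup {A : H →ₗ.[ℝ] H} (hA : IsSelfAdjoint A)
    (hpos : ∀ f : A.domain, 0 ≤ inner ℝ (f : H) (A f)) :
    ∃ S : ℝ≥0 → H →L[ℝ] H, IsContractionSemigroup S ∧ semigroupGenerator S = A := by
  obtain ⟨B, hB⟩ := hA.exists_isYosidaApprox hpos
  have hd := hA.dense_domain
  choose s hs using fun (t : ℝ≥0) (g : H) =>
    cauchySeq_tendsto_of_complete (hB.cauchySeq hd t.2 g)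
  let S : ℝ≥0 → H →L[ℝ] H := fun t => continuousLinearMapOfTendsto
    (fun n => boundedSemigroup (B n) t) (tendsto_pi_nhds.2 (hs t))
  have hS : ∀ (t : ℝ≥0) g, Tendsto (fun n => boundedSemigroup (B n) t g) atTop (𝓝 (S t g)) := hs
  have hcontr : ∀ (t : ℝ≥0) g, ‖S t g‖ ≤ ‖g‖ := fun t g =>
    le_of_tendsto' (hS t g).norm fun n => norm_boundedSemigroup_le (hB.inner_nonneg n) t.2 g
  have hnorm : ∀ t, ‖S t‖ ≤ 1 := fun t =>
    ContinuousLinearMap.opNorm_le_bound _ zero_le_one fun g => by simpa using hcontr t g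
  have hzero : S 0 = ContinuousLinearMap.id ℝ H := by
    ext g
    refine tendsto_nhds_unique (hS 0 g) ?_
    simp [boundedSemigroup_zero]
  have hadd : ∀ u t, S (u + t) = (S u).comp (S t) := fun u t => by
    ext g
    refine tendsto_nhds_unique (hS (u + t) g) ?_
    have h1 : Tendsto (fun n => boundedSemigroup (B n) u (boundedSemigroup (B n) t g - S t g))
        atTop (𝓝 0) := by
      refine squeeze_zero_norm
        (fun n => norm_boundedSemigroup_le (hB.inner_nonneg n) u.2 _) ?_
      simpa using ((hS t g).sub_const (S t g)).norm
    have h2 := h1.add (hS u (S t g))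
    rw [zero_add] at h2
    refine h2.congr fun n => ?_
    rw [NNReal.coe_add, boundedSemigroup_add, map_sub]
    simp
  have hlip : ∀ x ∈ A.graph, ∀ t : ℝ≥0, ‖x.1 - S t x.1‖ ≤ (t : ℝ) * ‖x.2‖ := fun x hx t =>
    le_of_tendsto' ((hS t x.1).const_sub x.1).norm fun n =>
      (norm_boundedSemigroup_sub_self_le (hB.inner_nonneg n) t.2 x.1).trans
        (mul_le_mul_of_nonneg_left (hB.norm_le n x hx) t.2)
  have hlim0 : ∀ g, Tendsto (fun t => S t g) (𝓝 0) (𝓝 g) := fun g => by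
    rw [Metric.tendsto_nhds]
    intro ε hε
    obtain ⟨f, hf, hfg⟩ := Metric.dense_iff.1 hd g (ε / 3) (by positivity)
    have hlim : Tendsto (fun t : ℝ≥0 => (t : ℝ) * ‖A ⟨f, hfg⟩‖) (𝓝 0) (𝓝 0) := by
      have : Continuous fun t : ℝ≥0 => (t : ℝ) * ‖A ⟨f, hfg⟩‖ := by fun_prop
      simpa using this.tendsto 0
    filter_upwards [hlim.eventually (gt_mem_nhds (show 0 < ε / 3 by positivity))] with t ht
    have h1 := hlip _ (A.mem_graph ⟨f, hfg⟩) t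
    have h2 := hcontr t (g - f)
    rw [Metric.mem_ball, dist_eq_norm] at hf
    have h5 : ‖g - f‖ = ‖f - g‖ := norm_sub_rev _ _
    have h7 : ‖f - S t f‖ = ‖S t f - f‖ := norm_sub_rev _ _
    rw [dist_eq_norm]
    have h6 : S t g - g = S t (g - f) + (S t f - f) + (f - g) := by
      simp only [map_sub]; abel
    rw [h6]
    have := norm_add₃_le (a := S t (g - f)) (b := S t f - f) (c := f - g)
    simp only at h1
    linarith
  have hcont : ∀ g, Continuous fun t => S t g := fun g => by
    have hdist : ∀ u t : ℝ≥0, u ≤ t → ‖S t g - S u g‖ ≤ ‖S (t - u) g - g‖ := fun u t hut => by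
      have : S t g = S u (S (t - u) g) := by
        conv_lhs => rw [← add_tsub_cancel_of_le hut, hadd]
        rfl
      rw [this, ← map_sub]
      exact hcontr u _
    refine continuous_iff_continuousAt.2 fun u => ?_
    have hnn : Tendsto (fun t : ℝ≥0 => (t - u) + (u - t)) (𝓝 u) (𝓝 0) := by
      have : Continuous fun t : ℝ≥0 => (t - u) + (u - t) := by fun_prop
      simpa using this.tendsto u
    refine tendsto_iff_norm_sub_tendsto_zero.2 ?_
    have hz : Tendsto (fun t : ℝ≥0 => ‖S ((t - u) + (u - t)) g - g‖) (𝓝 u) (𝓝 0) := by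
      have := (((hlim0 g).comp hnn).sub_const g).norm
      simpa [Function.comp_def] using this
    refine squeeze_zero (fun t => norm_nonneg _) (fun t => ?_) hz
    rcases le_total u t with h | h
    · have := hdist u t h
      rwa [tsub_eq_zero_of_le h, add_zero]
    · have := hdist t u h
      rw [tsub_eq_zero_of_le h, zero_add, norm_sub_rev]
      exact this
  have hgen : ∀ x ∈ A.graph, x ∈ genGraph S := fun x hx => by
    change Tendsto (fun t : ℝ≥0 => (t : ℝ)⁻¹ • (x.1 - S t x.1)) (𝓝[>] 0) (𝓝 x.2)
    -- The vector A f (here `x.2`) need not lie in the domain, so its displacement under the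
    -- semigroup is estimated through a nearby h in the domain. The resulting bound is uniform along
    -- the approximation and passes to the limit.
    have hbound : ∀ h : A.domain, ∀ t : ℝ≥0, ‖x.1 - S t x.1 - (t : ℝ) • x.2‖
        ≤ (t : ℝ) * (2 * ‖x.2 - h‖ + t * ‖A h‖) := fun h t => by
      have hBx := hB.tendsto x hx
      have e1 : Tendsto (fun n => (t : ℝ) * (2 * ‖B n x.1 - h‖ + t * ‖A h‖)) atTop
          (𝓝 (t * (2 * ‖x.2 - h‖ + t * ‖A h‖))) :=
        (((hBx.sub_const _).norm.const_mul 2).add_const _).const_mul _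
      have e2 : Tendsto (fun n => ‖x.1 - boundedSemigroup (B n) t x.1 - (t : ℝ) • B n x.1‖) atTop
          (𝓝 ‖x.1 - S t x.1 - (t : ℝ) • x.2‖) :=
        (((hS t x.1).const_sub _).sub (hBx.const_smul _)).norm
      refine le_of_tendsto_of_tendsto' e2 e1 fun n =>
        norm_sub_boundedSemigroup_sub_smul_le _ t.2 fun u hu => ?_
      have h1 := norm_boundedSemigroup_le (hB.inner_nonneg n) hu.1 (B n x.1 - h)
      have h2 := norm_boundedSemigroup_sub_self_le (hB.inner_nonneg n) hu.1 (h : H)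
      have h3 := hB.norm_le n _ (A.mem_graph h)
      have h4 : B n x.1 - boundedSemigroup (B n) u (B n x.1) = (B n x.1 - h)
          - boundedSemigroup (B n) u (B n x.1 - h) + ((h : H) - boundedSemigroup (B n) u h) := by
        rw [map_sub]; abel
      rw [h4]
      have h5 := norm_add_le ((B n x.1 - h) - boundedSemigroup (B n) u (B n x.1 - h))
        ((h : H) - boundedSemigroup (B n) u h)
      have h6 := norm_sub_le (B n x.1 - h) (boundedSemigroup (B n) u (B n x.1 - h))
      have h7 : u * ‖B n h‖ ≤ t * ‖A h‖ := mul_le_mul hu.2 h3 (norm_nonneg _) t.2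
      linarith
    rw [Metric.tendsto_nhds]
    intro ε hε
    obtain ⟨f, hf, hfg⟩ := Metric.dense_iff.1 hd x.2 (ε / 4) (by positivity)
    have hlim : Tendsto (fun t : ℝ≥0 => (t : ℝ) * ‖A ⟨f, hfg⟩‖) (𝓝 0) (𝓝 0) := by
      have : Continuous fun t : ℝ≥0 => (t : ℝ) * ‖A ⟨f, hfg⟩‖ := by fun_prop
      simpa using this.tendsto 0
    filter_upwards [nhdsWithin_le_nhds (hlim.eventually
      (gt_mem_nhds (show 0 < ε / 2 by positivity))), self_mem_nhdsWithin] with t ht ht0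
    have ht0' : (0 : ℝ) < t := ht0
    have h1 := hbound ⟨f, hfg⟩ t
    rw [Metric.mem_ball, dist_eq_norm] at hf
    have h2 : ‖x.2 - f‖ = ‖f - x.2‖ := norm_sub_rev _ _
    have h3 : (t : ℝ)⁻¹ • (x.1 - S t x.1) - x.2
        = (t : ℝ)⁻¹ • (x.1 - S t x.1 - (t : ℝ) • x.2) := by
      rw [smul_sub _ (x.1 - S t x.1), smul_smul, inv_mul_cancel₀ ht0'.ne', one_smul]
    rw [dist_eq_norm, h3, norm_smul, norm_inv, Real.norm_of_nonneg ht0'.le, inv_mul_lt_iff₀ ht0']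
    refine h1.trans_lt (mul_lt_mul_of_pos_left ?_ ht0')
    simp only at h2 ⊢
    linarith
  refine ⟨S, ⟨hzero, hadd, hnorm, hcont⟩, LinearPMap.eq_of_eq_graph ?_⟩
  rw [graph_semigroupGenerator]
  refine le_antisymm (fun x hx => ?_) hgen
  -- The reverse inclusion: surjectivity of 1 + A gives a point y of the graph of A with y.1 + y.2 =
  -- x.1 + x.2. The difference x - y lies in the graph of the generator and has the form (h, -h), so
  -- positivity gives h = 0.
  obtain ⟨R, hR, -⟩ := hA.exists_resolvent hpos (l := 1) one_pos
  have hy := hR (x.1 + x.2)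
  have hdiff := Submodule.sub_mem _ hx (hgen _ hy)
  have h0 := inner_nonneg_of_mem_genGraph hnorm hdiff
  have h1 : (x - (R (x.1 + x.2), x.1 + x.2 - (1 : ℝ) • R (x.1 + x.2))).2
      = -(x.1 - R (x.1 + x.2)) := by
    simp only [Prod.snd_sub, one_smul]
    abel
  rw [h1, Prod.fst_sub, inner_neg_right, real_inner_self_eq_norm_sq] at h0
  have h2 : x.1 - R (x.1 + x.2) = 0 := by
    have : ‖x.1 - R (x.1 + x.2)‖ ^ 2 ≤ 0 := by linarith
    simpa using this
  rw [← sub_eq_zero.1 h2, one_smul, add_sub_cancel_left] at hy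
  exact hy

theorem expNeg_spec {A : H →ₗ.[ℝ] H} (hA : IsSelfAdjoint A)
    (hpos : ∀ f : A.domain, 0 ≤ inner ℝ (f : H) (A f)) :
    IsContractionSemigroup (expNeg A) ∧ semigroupGenerator (expNeg A) = A := by
  have h := hA.exists_isContractionSemigroup hpos
  rw [expNeg, dif_pos h]
  exact h.choose_spec

end Yosida

/-! ### Maps determined by Gram matrices -/

section Gram

variable {ι E F : Type*} [NormedAddCommGroup E] [InnerProductSpace ℝ E]
  [NormedAddCommGroup F] [InnerProductSpace ℝ F]

theorem norm_linearCombination_sq (v : ι → E) (c : ι →₀ ℝ) :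
    ‖Finsupp.linearCombination ℝ v c‖ ^ 2
      = ∑ i ∈ c.support, ∑ j ∈ c.support, c i * c j * inner ℝ (v i) (v j) := by
  rw [← real_inner_self_eq_norm_sq, Finsupp.linearCombination_apply, Finsupp.sum, sum_inner]
  refine Finset.sum_congr rfl fun i _ => ?_
  rw [inner_sum]
  refine Finset.sum_congr rfl fun j _ => ?_
  rw [inner_smul_left, inner_smul_right, conj_trivial, mul_assoc]

theorem denseRange_linearCombination {v : ι → E}
    (hv : (Submodule.span ℝ (range v)).topologicalClosure = ⊤) :
    DenseRange (Finsupp.linearCombination ℝ v) := by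
  have := Submodule.dense_iff_topologicalClosure_eq_top.2 hv
  rw [← Finsupp.range_linearCombination] at this
  exact this

/-- A family dominated by a total family is its image under a bounded operator. -/
theorem exists_clm_of_gram_le [CompleteSpace F] {v : ι → E} {w : ι → F}
    (hv : (Submodule.span ℝ (range v)).topologicalClosure = ⊤)
    (h : ∀ c : ι →₀ ℝ, ‖Finsupp.linearCombination ℝ w c‖ ≤ ‖Finsupp.linearCombination ℝ v c‖) :
    ∃ T : E →L[ℝ] F, ∀ i, T (v i) = w i := by
  refine ⟨(Finsupp.linearCombination ℝ w).extendOfNorm (Finsupp.linearCombination ℝ v),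
    fun i => ?_⟩
  have := LinearMap.extendOfNorm_eq (denseRange_linearCombination hv)
    ⟨1, fun c => by simpa using h c⟩ (Finsupp.single i 1)
  simpa using this

/-- A family with the same Gram matrix as a total family is its image under an isometry. -/
theorem exists_linearIsometry_of_gram_eq [CompleteSpace F] {v : ι → E} {w : ι → F}
    (hv : (Submodule.span ℝ (range v)).topologicalClosure = ⊤)
    (h : ∀ i j, inner ℝ (w i) (w j) = inner ℝ (v i) (v j)) :
    ∃ U : E →ₗᵢ[ℝ] F, ∀ i, U (v i) = w i := by
  have hn : ∀ c : ι →₀ ℝ,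
      ‖Finsupp.linearCombination ℝ w c‖ = ‖Finsupp.linearCombination ℝ v c‖ := fun c => by
    rw [← sq_eq_sq₀ (norm_nonneg _) (norm_nonneg _), norm_linearCombination_sq,
      norm_linearCombination_sq]
    simp_rw [h]
  obtain ⟨T, hT⟩ := exists_clm_of_gram_le hv fun c => (hn c).le
  have hTc : ∀ c, T (Finsupp.linearCombination ℝ v c) = Finsupp.linearCombination ℝ w c :=
    fun c => by
      simp only [Finsupp.linearCombination_apply, Finsupp.sum, map_sum, map_smul, hT]
  refine ⟨⟨(T : E →ₗ[ℝ] F), fun x => ?_⟩, hT⟩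
  refine (denseRange_linearCombination hv).induction_on
    (p := fun x => ‖(T : E →ₗ[ℝ] F) x‖ = ‖x‖) x
    (isClosed_eq (by simpa using T.continuous.norm) continuous_norm) fun c => ?_
  change ‖T _‖ = _
  rw [hTc, hn]

/-- Entrywise powers of a Gram matrix are iterated Hadamard products, so the Schur product theorem
applies. -/
theorem posSemidef_gram_pow [Finite ι] (f : ι → E) (n : ℕ) :
    (Matrix.of fun i j => inner ℝ (f i) (f j) ^ n : Matrix ι ι ℝ).PosSemidef := by
  induction n with
  | zero =>
    have e : (Matrix.of fun i j => inner ℝ (f i) (f j) ^ 0 : Matrix ι ι ℝ)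
        = Matrix.gram ℝ fun _ : ι => (1 : ℝ) := by
      ext i j
      simp [Matrix.gram_apply]
    rw [e]
    exact Matrix.posSemidef_gram ℝ _
  | succ n ih =>
    exact ih.hadamard (Matrix.posSemidef_gram ℝ f)

/-- For n = 1 this is contractivity of B. The step is a^{n+1} - b^{n+1} = (a^n - b^n) a + b^n (a -
b), read entrywise: each term is a Hadamard product of positive semidefinite matrices. This makes
B^{⊗n} bounded on linear combinations of pure powers. -/
theorem posSemidef_gram_pow_sub [Finite ι] {B : E →L[ℝ] E} (hB : ‖B‖ ≤ 1) (f : ι → E) (n : ℕ) :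
    (Matrix.of fun i j => inner ℝ (f i) (f j) ^ n - inner ℝ (B (f i)) (B (f j)) ^ n :
      Matrix ι ι ℝ).PosSemidef := by
  have h1 : (Matrix.of fun i j => inner ℝ (f i) (f j) - inner ℝ (B (f i)) (B (f j)) :
      Matrix ι ι ℝ).PosSemidef := by
    have e : (Matrix.of fun i j => inner ℝ (f i) (f j) - inner ℝ (B (f i)) (B (f j)) :
        Matrix ι ι ℝ) = (‖B‖ ^ 2 • Matrix.gram ℝ f - Matrix.gram ℝ (B ∘ f))
          + (1 - ‖B‖ ^ 2) • Matrix.gram ℝ f := by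
      ext i j
      simp [Matrix.gram_apply]
      ring
    rw [e]
    exact (Matrix.posSemidef_opNorm_smul_gram_sub_gram f B).add
      ((Matrix.posSemidef_gram ℝ f).smul (sub_nonneg.2 (pow_le_one₀ (norm_nonneg _) hB)))
  induction n with
  | zero =>
    convert Matrix.PosSemidef.zero using 1
    ext i j
    simp
  | succ n ih =>
    have e : (Matrix.of fun i j => inner ℝ (f i) (f j) ^ (n + 1) -
        inner ℝ (B (f i)) (B (f j)) ^ (n + 1) : Matrix ι ι ℝ)
        = (Matrix.of fun i j => inner ℝ (f i) (f j) ^ n - inner ℝ (B (f i)) (B (f j)) ^ n :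
            Matrix ι ι ℝ).hadamard (Matrix.gram ℝ f)
          + (Matrix.of fun i j => inner ℝ (B (f i)) (B (f j)) ^ n : Matrix ι ι ℝ).hadamard
            (Matrix.of fun i j => inner ℝ (f i) (f j) - inner ℝ (B (f i)) (B (f j))) := by
      ext i j
      simp [Matrix.gram_apply, pow_succ]
      ring
    rw [e]
    exact (ih.hadamard (Matrix.posSemidef_gram ℝ f)).add
      ((posSemidef_gram_pow (fun i => B (f i)) n).hadamard h1)

theorem sum_gram_pow_map_le {B : E →L[ℝ] E} (hB : ‖B‖ ≤ 1) (s : Finset ι) (f : ι → E) (c : ι → ℝ)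
    (n : ℕ) : ∑ i ∈ s, ∑ j ∈ s, c i * c j * inner ℝ (B (f i)) (B (f j)) ^ n
      ≤ ∑ i ∈ s, ∑ j ∈ s, c i * c j * inner ℝ (f i) (f j) ^ n := by
  have h := (posSemidef_gram_pow_sub hB (fun i : s => f i) n).dotProduct_mulVec_nonneg
    fun i : s => c i
  simp only [dotProduct, Matrix.mulVec, Matrix.of_apply, Finset.mul_sum, star_trivial] at h
  rw [← sub_nonneg, ← Finset.sum_sub_distrib]
  rw [← Finset.sum_coe_sort s]
  refine h.trans_eq (Finset.sum_congr rfl fun i _ => ?_)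
  rw [← Finset.sum_sub_distrib, ← Finset.sum_coe_sort s]
  exact Finset.sum_congr rfl fun j _ => by ring

end Gram

/-! ### Tensor products of square-integrable functions -/

section Tensor

variable {Z : Type*} [MeasurableSpace Z]

theorem toL2_of_memLp {μ : Measure Z} {f : Z → ℝ} (h : MemLp f 2 μ) : toL2 μ f = h.toLp f :=
  dif_pos h

theorem coeFn_toL2 {μ : Measure Z} {f : Z → ℝ} (h : MemLp f 2 μ) : toL2 μ f =ᵐ[μ] f := by
  rw [toL2_of_memLp h]
  exact h.coeFn_toLp

theorem toL2_congr {μ : Measure Z} {f g : Z → ℝ} (h : f =ᵐ[μ] g) : toL2 μ f = toL2 μ g := by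
  by_cases hf : MemLp f 2 μ
  · rw [toL2_of_memLp hf, toL2_of_memLp (hf.ae_eq h)]
    exact (MemLp.toLp_eq_toLp_iff _ _).2 h
  · rw [toL2, toL2, dif_neg hf, dif_neg fun hg => hf (hg.ae_eq h.symm)]

theorem inner_toL2 {μ : Measure Z} {f g : Z → ℝ} (hf : MemLp f 2 μ) (hg : MemLp g 2 μ) :
    inner ℝ (toL2 μ f) (toL2 μ g) = ∫ z, f z * g z ∂μ := by
  rw [L2.inner_def]
  refine integral_congr_ae ?_
  filter_upwards [coeFn_toL2 hf, coeFn_toL2 hg] with z h1 h2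
  rw [h1, h2]
  simp [mul_comm]

theorem toL2_coeFn {μ : Measure Z} (f : Lp ℝ 2 μ) : toL2 μ f = f := by
  rw [toL2_of_memLp (Lp.memLp f), Lp.toLp_coeFn]

theorem toL2_sum_smul {μ : Measure Z} {ι : Type*} (s : Finset ι) (c : ι → ℝ) {f : ι → Z → ℝ}
    (hf : ∀ i, MemLp (f i) 2 μ) :
    toL2 μ (fun z => ∑ i ∈ s, c i * f i z) = ∑ i ∈ s, c i • toL2 μ (f i) := by
  have hsum : MemLp (fun z => ∑ i ∈ s, c i * f i z) 2 μ :=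
    memLp_finsetSum s fun i _ => (hf i).const_mul (c i)
  refine Lp.ext ?_
  have h1 : ∀ᵐ z ∂μ, ∀ i ∈ s, (c i • toL2 μ (f i) : Lp ℝ 2 μ) z = c i * f i z := by
    rw [Filter.eventually_all_finset]
    intro i _
    filter_upwards [Lp.coeFn_smul (c i) (toL2 μ (f i)), coeFn_toL2 (hf i)] with z e1 e2
    rw [e1, Pi.smul_apply, e2, smul_eq_mul]
  filter_upwards [coeFn_toL2 hsum, Lp.coeFn_finsetSum s fun i => c i • toL2 μ (f i), h1]
    with z e1 e2 e3
  rw [e1, e2, Finset.sum_apply]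
  exact Finset.sum_congr rfl fun i hi => (e3 i hi).symm

variable (τ : Measure Z) [SigmaFinite τ]

theorem quasiMeasurePreserving_eval_weightedPow {n : ℕ} (i : Fin n) :
    Measure.QuasiMeasurePreserving (Function.eval i) (weightedPow τ n) τ :=
  (Measure.quasiMeasurePreserving_eval (fun _ => τ) i).mono_left Measure.smul_absolutelyContinuous

theorem memLp_tensor {n : ℕ} (f : Fin n → Lp ℝ 2 τ) :
    MemLp (fun z : Fin n → Z => ∏ i, f i (z i)) 2 (weightedPow τ n) := by
  refine MemLp.smul_measure ?_ (ENNReal.natCast_ne_top _)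
  have hm : AEStronglyMeasurable (fun z : Fin n → Z => ∏ i, f i (z i))
      (Measure.pi fun _ : Fin n => τ) := by
    refine (Measurable.aestronglyMeasurable ?_)
    exact Finset.measurable_prod _ fun i _ =>
      (Lp.stronglyMeasurable (f i)).measurable.comp (measurable_pi_apply i)
  rw [memLp_two_iff_integrable_sq hm]
  simp_rw [← Finset.prod_pow]
  exact Integrable.fintype_prod (f := fun i z => f i z ^ 2) fun i =>
    (memLp_two_iff_integrable_sq (Lp.aestronglyMeasurable (f i))).1 (Lp.memLp (f i))

/-- The class of `(z₁, …, zₙ) ↦ f₁(z₁) ⋯ fₙ(zₙ)`. -/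
def tensorL2 {n : ℕ} (f : Fin n → Lp ℝ 2 τ) : Lp ℝ 2 (weightedPow τ n) :=
  toL2 _ fun z => ∏ i, f i (z i)

theorem coeFn_tensorL2 {n : ℕ} (f : Fin n → Lp ℝ 2 τ) :
    tensorL2 τ f =ᵐ[weightedPow τ n] fun z => ∏ i, f i (z i) :=
  coeFn_toL2 (memLp_tensor τ f)

theorem inner_tensorL2 {n : ℕ} (f g : Fin n → Lp ℝ 2 τ) :
    inner ℝ (tensorL2 τ f) (tensorL2 τ g) = n.factorial * ∏ i, inner ℝ (f i) (g i) := by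
  rw [tensorL2, tensorL2, inner_toL2 (memLp_tensor τ f) (memLp_tensor τ g), weightedPow,
    integral_smul_measure]
  simp_rw [← Finset.prod_mul_distrib]
  rw [integral_fintype_prod_eq_prod (fun i z => f i z * g i z)]
  simp only [ENNReal.toReal_natCast, smul_eq_mul, L2.inner_def]
  congr 1
  refine Finset.prod_congr rfl fun i _ => integral_congr_ae (ae_of_all _ fun z => ?_)
  simp [mul_comm]

theorem norm_tensorL2 {n : ℕ} (f : Fin n → Lp ℝ 2 τ) :
    ‖tensorL2 τ f‖ = √n.factorial * ∏ i, ‖f i‖ := by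
  rw [← sq_eq_sq₀ (norm_nonneg _) (by positivity), ← real_inner_self_eq_norm_sq, inner_tensorL2,
    mul_pow, Real.sq_sqrt (by positivity), ← Finset.prod_pow]
  simp

/-- The tensor product as a continuous multilinear map. -/
def tensorCMM (n : ℕ) :
    ContinuousMultilinearMap ℝ (fun _ : Fin n => Lp ℝ 2 τ) (Lp ℝ 2 (weightedPow τ n)) :=
  MultilinearMap.mkContinuous
    { toFun := tensorL2 τ
      map_update_add' := by
        intro inst f i x y
        obtain rfl : inst = instDecidableEqFin n := Subsingleton.elim _ _
        refine Lp.ext ?_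
        filter_upwards [coeFn_tensorL2 τ (Function.update f i (x + y)),
          coeFn_tensorL2 τ (Function.update f i x), coeFn_tensorL2 τ (Function.update f i y),
          Lp.coeFn_add (tensorL2 τ (Function.update f i x)) (tensorL2 τ (Function.update f i y)),
          (quasiMeasurePreserving_eval_weightedPow τ i).ae (Lp.coeFn_add x y)] with z h1 h2 h3 h4 h5
        have e : ∀ u : Lp ℝ 2 τ, ∏ j, (Function.update f i u j) (z j)
            = u (z i) * ∏ j ∈ Finset.univ.erase i, f j (z j) := fun u => by
          rw [← Finset.mul_prod_erase _ _ (Finset.mem_univ i), Function.update_self]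
          congr 1
          exact Finset.prod_congr rfl fun j hj => by
            rw [Function.update_of_ne (Finset.ne_of_mem_erase hj)]
        rw [h4, Pi.add_apply, h1, h2, h3, e, e, e, ← add_mul]
        congr 1
      map_update_smul' := by
        intro inst f i c x
        obtain rfl : inst = instDecidableEqFin n := Subsingleton.elim _ _
        refine Lp.ext ?_
        filter_upwards [coeFn_tensorL2 τ (Function.update f i (c • x)),
          coeFn_tensorL2 τ (Function.update f i x),
          Lp.coeFn_smul c (tensorL2 τ (Function.update f i x)),
          (quasiMeasurePreserving_eval_weightedPow τ i).ae (Lp.coeFn_smul c x)] with z h1 h2 h4 h5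
        have e : ∀ u : Lp ℝ 2 τ, ∏ j, (Function.update f i u j) (z j)
            = u (z i) * ∏ j ∈ Finset.univ.erase i, f j (z j) := fun u => by
          rw [← Finset.mul_prod_erase _ _ (Finset.mem_univ i), Function.update_self]
          congr 1
          exact Finset.prod_congr rfl fun j hj => by
            rw [Function.update_of_ne (Finset.ne_of_mem_erase hj)]
        rw [h4, Pi.smul_apply, h1, h2, e, e, smul_eq_mul, ← mul_assoc]
        congr 1 }
    (√n.factorial) fun f => (norm_tensorL2 τ f).le

/-- The pure power is the diagonal restriction of a continuous multilinear map. Its derivative at f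
produces the sum of the tensors f ⊗ ⋯ ⊗ h ⊗ ⋯ ⊗ f. -/
theorem hasFDerivAt_tensorPow (n : ℕ) (f : Lp ℝ 2 τ) :
    HasFDerivAt (tensorPow τ n) (((tensorCMM τ n).linearDeriv fun _ => f).comp
      (ContinuousLinearMap.pi fun _ => ContinuousLinearMap.id ℝ (Lp ℝ 2 τ))) f :=
  HasFDerivAt.comp (g := tensorCMM τ n) (f := fun (h : Lp ℝ 2 τ) (_ : Fin n) => h) f
    ((tensorCMM τ n).hasFDerivAt fun _ => f)
    (ContinuousLinearMap.pi fun _ : Fin n => ContinuousLinearMap.id ℝ (Lp ℝ 2 τ)).hasFDerivAt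

theorem inner_tensorPow (n : ℕ) (f g : Lp ℝ 2 τ) :
    inner ℝ (tensorPow τ n f) (tensorPow τ n g) = n.factorial * inner ℝ f g ^ n := by
  refine (inner_tensorL2 τ (fun _ : Fin n => f) fun _ => g).trans ?_
  simp

theorem continuous_tensorPow (n : ℕ) : Continuous (tensorPow τ n) :=
  continuous_iff_continuousAt.2 fun f => (hasFDerivAt_tensorPow τ n f).continuousAt

end Tensor

/-! ### Second quantization -/

section SecondQuantization

variable {Z : Type*} [MeasurableSpace Z] (τ : Measure Z)

instance fockN.instCompleteSpace (n : ℕ) : CompleteSpace (fockN τ n) :=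
  Submodule.topologicalClosure.completeSpace _

theorem inner_fockPow_left (n : ℕ) (f : Lp ℝ 2 τ) (F : Fock τ) :
    inner ℝ (fockPow τ n f) F = inner ℝ (tensorPow τ n f) (F n : Lp ℝ 2 (weightedPow τ n)) := by
  rw [fockPow, lp.inner_single_left]
  rfl

theorem inner_fockPow_of_ne {n m : ℕ} (h : n ≠ m) (f g : Lp ℝ 2 τ) :
    inner ℝ (fockPow τ n f) (fockPow τ m g) = 0 := by
  rw [inner_fockPow_left, fockPow, lp.single_apply_ne _ _ _ h]
  simp

variable [SigmaFinite τ]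

theorem inner_fockPow (n m : ℕ) (f g : Lp ℝ 2 τ) :
    inner ℝ (fockPow τ n f) (fockPow τ m g)
      = if n = m then (n.factorial : ℝ) * inner ℝ f g ^ n else 0 := by
  split_ifs with h
  · subst h
    rw [inner_fockPow_left, fockPow, lp.single_apply_self, inner_tensorPow]
  · exact inner_fockPow_of_ne τ h f g

/-- A vector orthogonal to the family has each component orthogonal to v^{⊗n} for v in a dense set,
hence to all f^{⊗n} by continuity; these span a dense subspace of the n-th symmetric power. -/
theorem topologicalClosure_span_fockPow {ι : Type*} {v : ι → Lp ℝ 2 τ} (hv : DenseRange v) :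
    (Submodule.span ℝ (range fun q : ℕ × ι => fockPow τ q.1 (v q.2))).topologicalClosure = ⊤ := by
  rw [Submodule.topologicalClosure_eq_top_iff, Submodule.eq_bot_iff]
  intro F hF
  have h1 : ∀ n f, inner ℝ (tensorPow τ n f) (F n : Lp ℝ 2 (weightedPow τ n)) = 0 := by
    intro n f
    refine hv.induction_on (p := fun f => inner ℝ (tensorPow τ n f)
      (F n : Lp ℝ 2 (weightedPow τ n)) = 0) f
      (isClosed_eq ((continuous_tensorPow τ n).inner continuous_const) continuous_const) fun i => ?_
    rw [← inner_fockPow_left]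
    exact (Submodule.mem_orthogonal _ _).1 hF _ (Submodule.subset_span ⟨(n, i), rfl⟩)
  ext1
  funext n
  have h2 : (F n : Lp ℝ 2 (weightedPow τ n)) ∈ (Submodule.span ℝ (range (tensorPow τ n)))ᗮ := by
    rw [Submodule.mem_orthogonal]
    intro u hu
    induction hu using Submodule.span_induction with
    | mem x hx =>
      obtain ⟨f, rfl⟩ := hx
      exact h1 n f
    | zero => exact inner_zero_left _
    | add x y _ _ hx hy => rw [inner_add_left, hx, hy, add_zero]
    | smul a x _ hx => rw [inner_smul_left, hx, mul_zero]
  rw [← Submodule.orthogonal_closure] at h2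
  have h3 : inner ℝ (F n : Lp ℝ 2 (weightedPow τ n)) (F n : Lp ℝ 2 (weightedPow τ n)) = 0 :=
    (Submodule.mem_orthogonal _ _).1 h2 _ (F n).2
  exact Subtype.ext (inner_self_eq_zero.1 h3)

theorem fockExp_fockPow {B : Lp ℝ 2 τ →L[ℝ] Lp ℝ 2 τ} (hB : ‖B‖ ≤ 1) (n : ℕ) (f : Lp ℝ 2 τ) :
    fockExp τ B (fockPow τ n f) = fockPow τ n (B f) := by
  have h : ∃ C : Fock τ →L[ℝ] Fock τ, ∀ n f, C (fockPow τ n f) = fockPow τ n (B f) := by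
    obtain ⟨C, hC⟩ := exists_clm_of_gram_le
      (w := fun q : ℕ × Lp ℝ 2 τ => fockPow τ q.1 (B q.2))
      (topologicalClosure_span_fockPow τ (v := id) denseRange_id) fun c => by
        rw [← sq_le_sq₀ (norm_nonneg _) (norm_nonneg _), norm_linearCombination_sq,
          norm_linearCombination_sq]
        simp only [inner_fockPow]
        -- Different degrees are orthogonal, so the quadratic form splits into one form for each
        -- degree k, with the coefficients of other degrees replaced by 0. Then
        -- `sum_gram_pow_map_le` applies degree by degree.
        have key : ∀ g : ℕ × Lp ℝ 2 τ → Lp ℝ 2 τ,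
            ∑ p ∈ c.support, ∑ q ∈ c.support, c p * c q * (if p.1 = q.1 then
              (p.1.factorial : ℝ) * inner ℝ (g p) (g q) ^ p.1 else 0)
            = ∑ k ∈ c.support.image Prod.fst, (k.factorial : ℝ) *
              ∑ p ∈ c.support, ∑ q ∈ c.support, ((if p.1 = k then c p else 0) *
                (if q.1 = k then c q else 0)) * inner ℝ (g p) (g q) ^ k := fun g => by
          simp only [Finset.mul_sum]
          conv_rhs => rw [Finset.sum_comm]
          refine Finset.sum_congr rfl fun p hp => ?_
          conv_rhs => rw [Finset.sum_comm]
          refine Finset.sum_congr rfl fun q _ => ?_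
          rw [Finset.sum_eq_single_of_mem p.1 (Finset.mem_image_of_mem _ hp)]
          · by_cases hpq : p.1 = q.1
            · simp only [hpq, if_true]
              ring
            · simp [hpq, Ne.symm hpq]
          · intro k _ hk
            simp [hk.symm]
        rw [key fun q => B q.2, key fun q => id q.2]
        exact Finset.sum_le_sum fun k _ => mul_le_mul_of_nonneg_left
          (sum_gram_pow_map_le hB _ (fun q : ℕ × Lp ℝ 2 τ => q.2) _ k) (by positivity)
    exact ⟨C, fun n f => hC (n, f)⟩
  rw [fockExp, dif_pos h]
  exact h.choose_spec n f

/-- The semigroup sends f^{⊗n} to (e^{-tA} f)^{⊗n}, and the chain rule at t = 0 gives the sum over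
the n slots of f ⊗ ⋯ ⊗ Af ⊗ ⋯ ⊗ f. The vector G is recorded through its inner products with pure
powers, which is all that the formula needs. -/
theorem exists_mem_graph_dExp {A : Lp ℝ 2 τ →ₗ.[ℝ] Lp ℝ 2 τ} (hA : IsSelfAdjoint A)
    (hpos : ∀ f : A.domain, 0 ≤ inner ℝ (f : Lp ℝ 2 τ) (A f)) (n : ℕ) {x : Lp ℝ 2 τ × Lp ℝ 2 τ}
    (hx : x ∈ A.graph) : ∃ G : Fock τ, (fockPow τ n x.1, G) ∈ (dExp τ A).graph ∧
      ∀ m h, inner ℝ G (fockPow τ m h) = if n = m then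
        (n.factorial : ℝ) * n * inner ℝ x.1 h ^ (n - 1) * inner ℝ x.2 h else 0 := by
  obtain ⟨hS, hgen⟩ := expNeg_spec hA hpos
  have hx' : x ∈ genGraph (expNeg A) := by
    rw [← graph_semigroupGenerator, hgen]
    exact hx
  replace hx' : Tendsto (fun t : ℝ≥0 => (t : ℝ)⁻¹ • (x.1 - expNeg A t x.1)) (𝓝[>] 0)
    (𝓝 x.2) := hx'
  -- The increment is d(t) = e^{-tA} f - f, scaled by c(t) = -1/t so that c(t) d(t) tends to Af.
  have hlim := (hasFDerivAt_tensorPow τ n x.1).hasFDerivWithinAt.lim (s := univ)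
    (l := 𝓝[>] (0 : ℝ≥0)) (c := fun t => -(t : ℝ)⁻¹) (d := fun t => expNeg A t x.1 - x.1)
    (v := x.2) (by
      have := ((hS.cont x.1).tendsto 0).sub_const x.1
      rw [hS.zero] at this
      simpa using this.mono_left nhdsWithin_le_nhds) (by simp) (by
      refine hx'.congr fun t => ?_
      rw [neg_smul, ← smul_neg, neg_sub])
  have hlim' : Tendsto (fun t : ℝ≥0 => (t : ℝ)⁻¹ •
      (tensorPow τ n x.1 - tensorPow τ n (expNeg A t x.1))) (𝓝[>] 0)
      (𝓝 (∑ i, tensorL2 τ (Function.update (fun _ : Fin n => x.1) i x.2))) := by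
    have e : (((tensorCMM τ n).linearDeriv fun _ => x.1).comp
        (ContinuousLinearMap.pi fun _ => ContinuousLinearMap.id ℝ (Lp ℝ 2 τ))) x.2
        = ∑ i, tensorL2 τ (Function.update (fun _ : Fin n => x.1) i x.2) := by
      rw [ContinuousLinearMap.comp_apply, ContinuousMultilinearMap.linearDeriv_apply]
      rfl
    rw [← e]
    refine hlim.congr fun t => ?_
    rw [neg_smul, ← smul_neg, neg_sub, add_sub_cancel]
  have hmemP : ∀ f, tensorPow τ n f ∈ fockN τ n := fun f =>
    Submodule.le_topologicalClosure _ (Submodule.subset_span (mem_range_self f))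
  -- The sum is symmetric because it is a limit of difference quotients of pure powers and the
  -- symmetric power is closed.
  have hmem : ∑ i, tensorL2 τ (Function.update (fun _ : Fin n => x.1) i x.2) ∈ fockN τ n :=
    (Submodule.isClosed_topologicalClosure _).mem_of_tendsto hlim' (Eventually.of_forall fun t =>
      (fockN τ n).smul_mem _ ((fockN τ n).sub_mem (hmemP _) (hmemP _)))
  refine ⟨lp.single 2 n ⟨_, hmem⟩, ?_, fun m h => ?_⟩
  · rw [dExp, graph_semigroupGenerator]
    change Tendsto (fun t : ℝ≥0 => (t : ℝ)⁻¹ • (fockPow τ n x.1 -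
      fockExp τ (expNeg A t) (fockPow τ n x.1))) (𝓝[>] 0) (𝓝 _)
    have h1 : Tendsto (fun t : ℝ≥0 => (⟨(t : ℝ)⁻¹ •
        (tensorPow τ n x.1 - tensorPow τ n (expNeg A t x.1)), (fockN τ n).smul_mem _
          ((fockN τ n).sub_mem (hmemP _) (hmemP _))⟩ : fockN τ n)) (𝓝[>] 0) (𝓝 ⟨_, hmem⟩) :=
      tendsto_subtype_rng.2 hlim'
    refine (((lp.isometry_single (E := fun n : ℕ => fockN τ n) (p := 2) n).continuous.tendsto
      _).comp h1).congr fun t => ?_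
    rw [fockExp_fockPow τ (hS.norm_le t), fockPow, fockPow, ← lp.single_sub, ← lp.single_smul]
    rfl
  · rw [lp.inner_single_left]
    split_ifs with hnm
    · subst hnm
      rw [fockPow, lp.single_apply_self, Submodule.coe_inner]
      change inner ℝ _ (tensorL2 τ fun _ : Fin n => h) = _
      simp only [sum_inner, inner_tensorL2]
      have e : ∀ i : Fin n, ∏ j, inner ℝ (Function.update (fun _ : Fin n => x.1) i x.2 j) h
          = inner ℝ x.1 h ^ (n - 1) * inner ℝ x.2 h := fun i => by
        rw [← Finset.mul_prod_erase _ _ (Finset.mem_univ i), Function.update_self, mul_comm]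
        congr 1
        rw [Finset.prod_congr rfl fun j hj => by
          rw [Function.update_of_ne (Finset.ne_of_mem_erase hj)]]
        simp [Finset.card_erase_of_mem]
      simp only [e, Finset.sum_const, Finset.card_univ, Fintype.card_fin, nsmul_eq_mul]
      ring
    · rw [fockPow, lp.single_apply_ne _ _ _ hnm, inner_zero_right]

end SecondQuantization

/-! ### Charlier polynomials of finite configurations -/

section CharlierAlgebra

variable {Z : Type*}

/-- The sum of `f` over a finite list of points. -/
def pointSum (l : List Z) (f : Z → ℝ) : ℝ := (l.map f).sum

/-- The recursion for the polynomials `Q_n` on a finite list of points, with an arbitrary functional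
`I` in place of the integral. -/
def charlierPoly (I : (Z → ℝ) → ℝ) (l : List Z) : (n : ℕ) → (Fin n → Z → ℝ) → ℝ
  | 0, _ => 1
  | 1, φ => pointSum l (φ 0) - I (φ 0)
  | n + 2, φ =>
      charlierPoly I l (n + 1) (Fin.tail φ) * (pointSum l (φ 0) - I (φ 0))
        - ∑ i, charlierPoly I l (n + 1)
            (Function.update (Fin.tail φ) i (fun z => φ 0 z * Fin.tail φ i z))
        - ∑ i, I (fun z => φ 0 z * Fin.tail φ i z)
            * charlierPoly I l n (fun j => Fin.tail φ (i.succAbove j))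

theorem prod_update_succAbove {n : ℕ} (I : (Z → ℝ) → ℝ) (ψ : Fin (n + 1) → Z → ℝ) (i : Fin (n + 1))
    (f : Z → ℝ) : ∏ j, -I (Function.update ψ i f j) = -I f * ∏ j, -I (ψ (i.succAbove j)) := by
  rw [Fin.prod_univ_succAbove _ i, Function.update_self]
  congr 1
  exact Finset.prod_congr rfl fun j _ => by rw [Function.update_of_ne (Fin.succAbove_ne i j)]

/-- Without points the two correction sums of the recursion cancel: replacing an argument by a
product contributes the factor -I(φψ_i), which offsets I(φψ_i). -/
theorem charlierPoly_nil (I : (Z → ℝ) → ℝ) (n : ℕ) (ψ : Fin n → Z → ℝ) :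
    charlierPoly I [] n ψ = ∏ i, -I (ψ i) := by
  induction n using Nat.strong_induction_on with
  | _ n ih =>
    match n, ih with
    | 0, _ => simp [charlierPoly]
    | 1, _ => simp [charlierPoly, pointSum]
    | n + 2, ih =>
      rw [charlierPoly]
      simp only [ih (n + 1) (by omega), ih n (by omega), prod_update_succAbove]
      have h : ∏ i, -I (ψ i) = -I (ψ 0) * ∏ j, -I (Fin.tail ψ j) := Fin.prod_univ_succ _
      rw [h, sub_sub, ← Finset.sum_add_distrib, Finset.sum_eq_zero fun i _ => by ring]
      simp only [pointSum, List.map_nil, List.sum_nil]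
      ring

theorem update_comp_succAbove {n : ℕ} {α : Type*} (ψ : Fin (n + 2) → α) (j : Fin (n + 2))
    (k : Fin (n + 1)) (a : α) :
    (fun m => Function.update ψ (j.succAbove k) a (j.succAbove m))
      = Function.update (fun m => ψ (j.succAbove m)) k a :=
  Function.update_comp_eq_of_injective ψ Fin.succAbove_right_injective k a

theorem sum_sum_succAbove_comm {n : ℕ} (f : Fin (n + 1) → Fin (n + 1) → ℝ) :
    ∑ i : Fin (n + 1), ∑ j : Fin (n + 1), f i j
      = ∑ j, f j j + ∑ j : Fin (n + 1), ∑ k : Fin n, f (j.succAbove k) j := by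
  rw [Finset.sum_comm, ← Finset.sum_add_distrib]
  exact Finset.sum_congr rfl fun j _ => Fin.sum_univ_succAbove (fun i => f i j) j

/-- Ordered pairs of distinct indices are coded as "remove i, then remove k from the rest".
Exchanging the order of removal is an involution of these codes. -/
theorem sum_sum_swap_removed {n : ℕ} (g : Fin (n + 2) → Fin (n + 1) → ℝ) :
    ∑ i, ∑ k, g i k = ∑ j, ∑ m : Fin (n + 1), g (j.succAbove m) (m.predAbove j) := by
  rw [← Fintype.sum_prod_type', ← Fintype.sum_prod_type']
  refine Finset.sum_nbij' (fun q => (q.1.succAbove q.2, q.2.predAbove q.1))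
    (fun q => (q.1.succAbove q.2, q.2.predAbove q.1)) (by simp) (by simp) ?_ ?_ ?_
  all_goals
    rintro ⟨i, k⟩ -
    simp [Fin.succAbove_succAbove_predAbove, Fin.predAbove_predAbove_succAbove]

/-- The effect of one added point, which underlies both the gradient formula and the symmetry of
Q_n. The induction follows the recursion in its first argument. -/
theorem charlierPoly_cons (I : (Z → ℝ) → ℝ) (z : Z) (l : List Z) (n : ℕ)
    (ψ : Fin (n + 1) → Z → ℝ) : charlierPoly I (z :: l) (n + 1) ψ
      = charlierPoly I l (n + 1) ψ
        + ∑ i, ψ i z * charlierPoly I l n (fun j => ψ (i.succAbove j)) := by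
  have hP : ∀ f, pointSum (z :: l) f = pointSum l f + f z := fun f => by
    simp [pointSum, add_comm]
  induction n using Nat.strong_induction_on with
  | _ n ih =>
    match n, ih with
    | 0, _ =>
      simp only [charlierPoly, hP, Fin.sum_univ_succ]
      simp
      ring
    | m + 1, ih =>
      have htail : ∀ j : Fin (m + 1), (fun k => ψ (j.succ.succAbove k))
          = (Fin.cons (ψ 0) (fun k => Fin.tail ψ (j.succAbove k)) : Fin (m + 1) → Z → ℝ) :=
        fun j => by
          funext k
          cases k using Fin.cases with
          | zero => simp
          | succ k => simp [Fin.tail]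
      have h0 : (fun k => ψ ((0 : Fin (m + 2)).succAbove k)) = Fin.tail ψ := by
        funext k
        simp [Fin.tail]
      have ht : ∀ j, ψ (Fin.succ j) = Fin.tail ψ j := fun _ => rfl
      rw [Fin.sum_univ_succ, h0]
      simp only [htail, ht]
      rw [charlierPoly, charlierPoly, hP]
      generalize Fin.tail ψ = χ
      generalize ψ 0 = φ
      simp only [ih m (by omega), Finset.sum_add_distrib]
      -- The diagonal terms, where the removed argument is the product φχ_i itself, give φ(z) χ_i(z)
      -- times Q with χ_i removed. They cancel the contribution of φ(z) from the first factor; the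
      -- off-diagonal terms reassemble into the recursion for the smaller families.
      rw [sum_sum_succAbove_comm (fun i j => Function.update χ i (fun z => φ z * χ i z) j z *
        charlierPoly I l m fun k => Function.update χ i (fun z => φ z * χ i z) (j.succAbove k))]
      have hdiag : ∀ j, (fun k => Function.update χ j (fun z => φ z * χ j z) (j.succAbove k))
          = fun k => χ (j.succAbove k) := fun j => by
        funext k
        rw [Function.update_of_ne (Fin.succAbove_ne j k)]
      simp only [hdiag, Function.update_self]
      have hoff : ∀ (j : Fin (m + 1)) (k : Fin m),
          Function.update χ (j.succAbove k) (fun z => φ z * χ (j.succAbove k) z) j = χ j :=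
        fun j k => Function.update_of_ne (Fin.succAbove_ne j k).symm _ _
      simp only [hoff]
      match m, ih with
      | 0, _ =>
        simp [charlierPoly]
        ring
      | r + 1, ih =>
        have hrec : ∀ j : Fin (r + 2), charlierPoly I l (r + 2)
            (Fin.cons φ (fun k => χ (j.succAbove k)) : Fin (r + 2) → Z → ℝ)
            = (charlierPoly I l (r + 1) fun k => χ (j.succAbove k)) * (pointSum l φ - I φ)
              - (∑ k, charlierPoly I l (r + 1) (Function.update (fun k => χ (j.succAbove k)) k
                  (fun z => φ z * χ (j.succAbove k) z)))
              - ∑ k, I (fun z => φ z * χ (j.succAbove k) z)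
                  * charlierPoly I l r (fun i => χ (j.succAbove (k.succAbove i))) := fun j => by
          rw [charlierPoly]
          simp only [Fin.cons_zero, Fin.tail_cons]
        simp only [hrec, update_comp_succAbove, ih r (by omega)]
        -- The last correction sum removes two arguments. Exchanging their order turns "contracted
        -- with φ, then evaluated at z" into "evaluated at z, then contracted".
        have e0 := sum_sum_swap_removed (fun i k => I (fun z => φ z * χ i z) *
          (χ (i.succAbove k) z * charlierPoly I l r fun j => χ (i.succAbove (k.succAbove j))))
        simp only [Fin.succAbove_succAbove_predAbove,
          Fin.succAbove_succAbove_succAbove_predAbove] at e0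
        have e1 : ∀ c : ℝ, (∑ i, χ i z * charlierPoly I l (r + 1) fun j => χ (i.succAbove j)) * c
            = ∑ i, χ i z * (charlierPoly I l (r + 1) fun j => χ (i.succAbove j)) * c := fun c =>
          Finset.sum_mul _ _ _
        have e2 : ∑ i, φ z * χ i z * charlierPoly I l (r + 1) (fun j => χ (i.succAbove j))
            = ∑ i, χ i z * (charlierPoly I l (r + 1) fun j => χ (i.succAbove j)) * φ z :=
          Finset.sum_congr rfl fun i _ => by ring
        have e3 : ∑ j, ∑ m, I (fun z => φ z * χ (Fin.succAbove j m) z) *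
              (χ j z * charlierPoly I l r fun k => χ (j.succAbove (m.succAbove k)))
            = ∑ j, χ j z * ∑ m, I (fun z => φ z * χ (Fin.succAbove j m) z) *
              charlierPoly I l r fun k => χ (j.succAbove (m.succAbove k)) :=
          Finset.sum_congr rfl fun j _ => by
            rw [Finset.mul_sum]
            exact Finset.sum_congr rfl fun m _ => by ring
        have e4 : ∀ i, I (fun z => φ z * χ i z) *
              ((charlierPoly I l (r + 1) fun j => χ (i.succAbove j)) +
                ∑ k, χ (i.succAbove k) z *
                  charlierPoly I l r fun j => χ (i.succAbove (k.succAbove j)))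
            = I (fun z => φ z * χ i z) * (charlierPoly I l (r + 1) fun j => χ (i.succAbove j))
              + ∑ k, I (fun z => φ z * χ i z) * (χ (i.succAbove k) z *
                  charlierPoly I l r fun j => χ (i.succAbove (k.succAbove j))) := fun i => by
          rw [mul_add, Finset.mul_sum]
        simp only [e4, Finset.sum_add_distrib, e0, e3, e2, ← e1]
        simp only [mul_sub, Finset.sum_sub_distrib, ← Finset.mul_sum, ← mul_assoc, ← Finset.sum_mul]
        ring

/-- The value of `Q` at the functions `ψ i`, `i ∈ s`. -/
def charlierSet {ι : Type*} [DecidableEq ι] (I : (Z → ℝ) → ℝ) (ψ : ι → Z → ℝ) :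
    List Z → Finset ι → ℝ
  | [], s => ∏ i ∈ s, -I (ψ i)
  | z :: l, s => charlierSet I ψ l s + ∑ i ∈ s, ψ i z * charlierSet I ψ l (s.erase i)

/-- The recursion singles out its first argument, whereas `charlierSet` depends only on the set of
arguments; this identity therefore contains the symmetry of Q_n. -/
theorem charlierPoly_eq_charlierSet {ι : Type*} [DecidableEq ι] (I : (Z → ℝ) → ℝ) (ψ : ι → Z → ℝ)
    (l : List Z) {n : ℕ} (e : Fin n ↪ ι) :
    charlierPoly I l n (fun i => ψ (e i)) = charlierSet I ψ l (Finset.univ.map e) := by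
  induction l generalizing n with
  | nil => rw [charlierPoly_nil, charlierSet, Finset.prod_map]
  | cons z l ih =>
    cases n with
    | zero =>
      have h := ih e
      rw [charlierSet, ← h]
      simp [charlierPoly]
    | succ n =>
      rw [charlierPoly_cons, charlierSet, ih e, Finset.sum_map]
      congr 1
      refine Finset.sum_congr rfl fun i _ => ?_
      congr 1
      have h := ih (i.succAboveEmb.trans e)
      rw [show (Finset.univ.map e).erase (e i) = Finset.univ.map (i.succAboveEmb.trans e) from ?_]
      · exact h
      · ext x
        simp only [Finset.mem_erase, Finset.mem_map, Finset.mem_univ, true_and,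
          Function.Embedding.trans_apply, Fin.coe_succAboveEmb]
        constructor
        · rintro ⟨hx, j, rfl⟩
          obtain ⟨k, hk⟩ := Fin.exists_succAbove_eq fun h : j = i => hx (congrArg e h)
          exact ⟨k, congrArg e hk⟩
        · rintro ⟨k, rfl⟩
          exact ⟨fun h => Fin.succAbove_ne i k (e.injective h), _, rfl⟩

/-! ### Polarization by alternating sums over subsets -/

section Polarization

variable {ι : Type*} [DecidableEq ι]

/-- The alternating sum of `a` over the subsets of `s`. -/
def altSum (a : Finset ι → ℝ) (s : Finset ι) : ℝ :=
  ∑ S ∈ s.powerset, (-1 : ℝ) ^ (s.card + S.card) * a S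

/-- After exchanging the sums, the factor y_i meets only the subsets containing i, that is all
subsets minus those of `s.erase i`. The minus becomes a plus because the sign is normalized by the
cardinality, which has dropped by one. -/
theorem altSum_sum_mul (a : Finset ι → ℝ) (y : ι → ℝ) (s : Finset ι) :
    altSum (fun S => (∑ i ∈ S, y i) * a S) s
      = ∑ i ∈ s, y i * (altSum a s + altSum a (s.erase i)) := by
  have h1 : ∀ i ∈ s, altSum a s + altSum a (s.erase i)
      = ∑ S ∈ s.powerset with i ∈ S, (-1 : ℝ) ^ (s.card + S.card) * a S := fun i hi => by
    have e : s.powerset.filter (fun S => i ∉ S) = (s.erase i).powerset := by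
      ext S
      simp only [Finset.mem_filter, Finset.mem_powerset, Finset.subset_erase]
    rw [altSum, altSum, ← Finset.sum_filter_add_sum_filter_not s.powerset (fun S => i ∈ S), e,
      add_assoc, ← Finset.sum_add_distrib, ← Finset.card_erase_add_one hi]
    rw [Finset.sum_eq_zero (s := (s.erase i).powerset), add_zero]
    intro S _
    ring
  rw [Finset.sum_congr rfl fun i hi => by rw [h1 i hi]]
  simp only [altSum, Finset.mul_sum, Finset.sum_mul, Finset.sum_filter]
  rw [Finset.sum_comm]
  refine Finset.sum_congr rfl fun S hS => ?_
  simp only [mul_ite, mul_zero]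
  rw [← Finset.sum_filter, Finset.filter_mem_eq_inter,
    Finset.inter_eq_right.2 (Finset.mem_powerset.1 hS)]
  exact Finset.sum_congr rfl fun i _ => by ring

theorem altSum_one (s : Finset ι) : altSum (fun _ => 1) s = if s = ∅ then 1 else 0 := by
  have h := Finset.sum_powerset_neg_one_pow_card (x := s)
  have h' : ∑ S ∈ s.powerset, (-1 : ℝ) ^ S.card = if s = ∅ then 1 else 0 := by
    exact_mod_cast h
  simp only [altSum, mul_one, pow_add]
  rw [← Finset.mul_sum, h']
  split_ifs with hs
  · simp [hs]
  · simp

/-- The hypothesis says that `a k` behaves like a polynomial of degree k: the alternating sum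
vanishes on larger sets and isolates a multilinear part b on sets of size k. Multiplication by a
linear form raises the degree by one. -/
theorem altSum_of_recursion {a : ℕ → Finset ι → ℝ} {b : Finset ι → ℝ} (s : Finset ι) {k : ℕ}
    (y : ι → ℝ) (hk : k + 1 ≤ s.card)
    (h : ∀ t : Finset ι, k ≤ t.card → altSum (a k) t = if k = t.card then k.factorial * b t else 0) :
    altSum (fun S => (∑ i ∈ S, y i) * a k S) s
      = if k + 1 = s.card then k.factorial * ∑ i ∈ s, y i * b (s.erase i) else 0 := by
  rw [altSum_sum_mul]
  rw [Finset.sum_congr rfl fun i hi => by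
    rw [h s (by omega), if_neg (by omega), zero_add,
      h (s.erase i) (by rw [Finset.card_erase_of_mem hi]; omega), Finset.card_erase_of_mem hi]]
  by_cases hc : k + 1 = s.card
  · rw [if_pos hc, Finset.mul_sum]
    refine Finset.sum_congr rfl fun i _ => ?_
    rw [if_pos (by omega)]
    ring
  · rw [if_neg hc]
    refine Finset.sum_eq_zero fun i _ => ?_
    rw [if_neg (by omega), mul_zero]

theorem altSum_pow (x : ι → ℝ) (k : ℕ) (s : Finset ι) (hk : k ≤ s.card) :
    altSum (fun S => (∑ i ∈ S, x i) ^ k) s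
      = if k = s.card then (k.factorial : ℝ) * ∏ i ∈ s, x i else 0 := by
  induction k generalizing s with
  | zero =>
    simp only [pow_zero]
    rw [altSum_one]
    rcases s.eq_empty_or_nonempty with rfl | hs
    · simp
    · rw [if_neg hs.ne_empty, if_neg hs.card_pos.ne]
  | succ k ih =>
    simp only [pow_succ']
    rw [altSum_of_recursion (a := fun k S => (∑ i ∈ S, x i) ^ k) s x hk ih]
    split_ifs with h
    · rw [Finset.sum_congr rfl fun i hi => Finset.mul_prod_erase s x hi, Finset.sum_const,
        nsmul_eq_mul, ← h, Nat.factorial_succ]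
      push_cast
      ring
    · rfl

theorem charlierPoly_const_cons (I : (Z → ℝ) → ℝ) (z : Z) (l : List Z) (n : ℕ) (φ : Z → ℝ) :
    charlierPoly I (z :: l) (n + 1) (fun _ => φ)
      = charlierPoly I l (n + 1) (fun _ => φ) + (n + 1) * φ z * charlierPoly I l n (fun _ => φ) := by
  rw [charlierPoly_cons]
  simp
  ring

/-- Induction on the points. Adding z adds k+1 times φ(z) Q_k to Q_{k+1}(φ^{⊗(k+1)}), where φ(z) is
linear in φ, so the previous lemma applies and the factor k+1 completes the factorial. -/
theorem altSum_charlierPoly (I : (Z → ℝ) → ℝ) (ψ : ι → Z → ℝ)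
    (hI : ∀ S : Finset ι, I (∑ i ∈ S, ψ i) = ∑ i ∈ S, I (ψ i)) (l : List Z) (k : ℕ)
    (s : Finset ι) (hk : k ≤ s.card) :
    altSum (fun S => charlierPoly I l k fun _ => ∑ i ∈ S, ψ i) s
      = if k = s.card then k.factorial * charlierSet I ψ l s else 0 := by
  induction l generalizing k s with
  | nil =>
    rw [charlierSet, ← altSum_pow (fun i => -I (ψ i)) k s hk]
    congr 1
    funext S
    rw [charlierPoly_nil]
    simp [hI]
  | cons z l ih =>
    cases k with
    | zero =>
      have h := ih 0 s hk
      simp only [charlierPoly] at h ⊢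
      rw [h]
      split_ifs with hs
      · rw [Finset.card_eq_zero.1 hs.symm]
        simp [charlierSet]
      · rfl
    | succ k =>
      have h1 := ih (k + 1) s hk
      have h2 := altSum_of_recursion (a := fun k S => charlierPoly I l k fun _ => ∑ i ∈ S, ψ i)
        s (fun i => ψ i z) hk fun t ht => ih k t ht
      have h3 : altSum (fun S => charlierPoly I (z :: l) (k + 1) fun _ => ∑ i ∈ S, ψ i) s
          = altSum (fun S => charlierPoly I l (k + 1) fun _ => ∑ i ∈ S, ψ i) s
            + (k + 1) * altSum (fun S => (∑ i ∈ S, ψ i z) *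
              charlierPoly I l k fun _ => ∑ i ∈ S, ψ i) s := by
        simp only [altSum, charlierPoly_const_cons, Finset.mul_sum, ← Finset.sum_add_distrib]
        refine Finset.sum_congr rfl fun S _ => ?_
        rw [Finset.sum_apply]
        ring
      rw [h3, h1, h2, charlierSet, Nat.factorial_succ]
      split_ifs with h
      · push_cast
        ring
      · simp

theorem factorial_mul_charlierPoly {n : ℕ} (I : (Z → ℝ) → ℝ) (ψ : Fin n → Z → ℝ)
    (hI : ∀ S : Finset (Fin n), I (∑ i ∈ S, ψ i) = ∑ i ∈ S, I (ψ i)) (l : List Z) :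
    n.factorial * charlierPoly I l n ψ
      = altSum (fun S => charlierPoly I l n fun _ => ∑ i ∈ S, ψ i) Finset.univ := by
  rw [altSum_charlierPoly I ψ hI l n _ (by simp), if_pos (by simp)]
  have := charlierPoly_eq_charlierSet I ψ l (Function.Embedding.refl (Fin n))
  rw [Finset.map_refl] at this
  rw [← this]
  rfl

end Polarization

/-- The value of `Q_n(φ^{⊗n})` at a configuration of `N` points at which `φ` has the values `x i`,
when `a` is the integral of `φ`. -/
def charlierVal (a : ℝ) : (N : ℕ) → (Fin N → ℝ) → ℕ → ℝ
  | 0, _, n => (-a) ^ n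
  | N + 1, x, n =>
      charlierVal a N (Fin.tail x) n + n * x 0 * charlierVal a N (Fin.tail x) (n - 1)

/-- The values are the derivatives at t = 0 of the generating function e^{-at} ∏ (1 + t x_i), which
is symmetric in the x_i. Any coordinate can therefore play the role of the first. -/
theorem charlierVal_insertNth (a : ℝ) {N : ℕ} (i : Fin (N + 1)) (w : ℝ) (x : Fin N → ℝ) (n : ℕ) :
    charlierVal a (N + 1) (i.insertNth w x) n
      = charlierVal a N x n + n * w * charlierVal a N x (n - 1) := by
  induction N generalizing n with
  | zero =>
    obtain rfl : i = 0 := Fin.ext (by omega)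
    simp [charlierVal]
  | succ N ih =>
    cases i using Fin.cases with
    | zero => rw [charlierVal]; simp [Fin.insertNth_zero']
    | succ j =>
      have hx : (Fin.succ j).insertNth w x
          = (Fin.cons (x 0) (j.insertNth w (Fin.tail x)) : Fin (N + 2) → ℝ) := by
        rw [← Fin.insertNth_succ_cons]
        simp
      rw [hx]
      have e : ∀ m, charlierVal a (N + 1 + 1)
          (Fin.cons (x 0) (j.insertNth w (Fin.tail x)) : Fin (N + 2) → ℝ) m
          = charlierVal a (N + 1) (j.insertNth w (Fin.tail x)) m
            + m * x 0 * charlierVal a (N + 1) (j.insertNth w (Fin.tail x)) (m - 1) := fun m => rfl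
      have e' : ∀ m, charlierVal a (N + 1) x m = charlierVal a N (Fin.tail x) m
          + m * x 0 * charlierVal a N (Fin.tail x) (m - 1) := fun m => rfl
      rw [e, ih, ih, e', e']
      ring

/-- Differentiating the generating function e^{-at} ∏ (1 + t x_i) in t: the exponential yields -a,
and the i-th factor yields x_i with that factor removed. -/
theorem charlierVal_succ (a : ℝ) {N : ℕ} (x : Fin (N + 1) → ℝ) (n : ℕ) :
    charlierVal a (N + 1) x (n + 1) = -a * charlierVal a (N + 1) x n
      + ∑ i, x i * charlierVal a N (i.removeNth x) n := by
  induction N generalizing n with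
  | zero =>
    cases n with
    | zero => simp [charlierVal]
    | succ n => simp [charlierVal]; ring
  | succ N ih =>
    have e' : ∀ m, charlierVal a (N + 2) x m = charlierVal a (N + 1) (Fin.tail x) m
        + m * x 0 * charlierVal a (N + 1) (Fin.tail x) (m - 1) := fun m => rfl
    have e : ∀ i : Fin (N + 1), ∀ m, charlierVal a (N + 1) (i.succ.removeNth x) m
        = charlierVal a N (i.removeNth (Fin.tail x)) m
          + m * x 0 * charlierVal a N (i.removeNth (Fin.tail x)) (m - 1) := fun i m => by
      have : i.succ.removeNth x = (Fin.cons (x 0) (i.removeNth (Fin.tail x)) : Fin (N + 1) → ℝ) := by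
        funext j
        cases j using Fin.cases with
        | zero => simp [Fin.removeNth]
        | succ j => simp [Fin.removeNth, Fin.tail]
      rw [this]
      rfl
    have e0 : Fin.removeNth 0 x = Fin.tail x := by
      funext j
      simp [Fin.removeNth, Fin.tail]
    have ht : ∀ i, Fin.tail x i = x i.succ := fun _ => rfl
    rw [e', e', Fin.sum_univ_succ, e0]
    simp only [e, mul_add, Finset.sum_add_distrib, ← ht]
    have h1 := ih (Fin.tail x) n
    have h2 : ∑ i, Fin.tail x i * (n * x 0 * charlierVal a N (i.removeNth (Fin.tail x)) (n - 1))
        = n * x 0 * (∑ i, Fin.tail x i * charlierVal a N (i.removeNth (Fin.tail x)) (n - 1)) := by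
      rw [Finset.mul_sum]
      exact Finset.sum_congr rfl fun i _ => by ring
    rw [h2]
    cases n with
    | zero =>
      rw [h1]
      simp
      ring
    | succ n =>
      have h3 := ih (Fin.tail x) n
      simp only [Nat.add_sub_cancel]
      have h4 : ∑ i, Fin.tail x i * charlierVal a N (i.removeNth (Fin.tail x)) n
        = charlierVal a (N + 1) (Fin.tail x) (n + 1) + a * charlierVal a (N + 1) (Fin.tail x) n := by
        rw [h3]; ring
      rw [h1, h4]
      push_cast
      ring

theorem continuous_charlierVal (a : ℝ) (N n : ℕ) : Continuous fun x => charlierVal a N x n := by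
  induction N generalizing n with
  | zero => exact continuous_const
  | succ N ih =>
    have ht : Continuous fun x : Fin (N + 1) → ℝ => Fin.tail x :=
      continuous_pi fun i => continuous_apply _
    exact ((ih n).comp ht).add ((continuous_const.mul (continuous_apply 0)).mul ((ih _).comp ht))

theorem charlierPoly_const_nil (I : (Z → ℝ) → ℝ) (φ : Z → ℝ) (n : ℕ) :
    charlierPoly I [] n (fun _ => φ) = (-I φ) ^ n := by
  rw [charlierPoly_nil]
  simp

theorem charlierPoly_ofFn (I : (Z → ℝ) → ℝ) (φ : Z → ℝ) {N : ℕ} (z : Fin N → Z) (n : ℕ) :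
    charlierPoly I (List.ofFn z) n (fun _ => φ) = charlierVal (I φ) N (fun i => φ (z i)) n := by
  induction N generalizing n with
  | zero => rw [List.ofFn_zero, charlierPoly_const_nil, charlierVal]
  | succ N ih =>
    rw [List.ofFn_succ, charlierVal]
    cases n with
    | zero =>
      have h := ih (fun i => z i.succ) 0
      simp only [charlierPoly] at h ⊢
      rw [h]
      simp [Fin.tail_def]
    | succ n =>
      rw [charlierPoly_const_cons, ih, ih]
      simp [Fin.tail_def]

end CharlierAlgebra

/-! ### Charlier polynomials of marked configurations -/

section CharlierConfig

variable {X M : Type*} [TopologicalSpace X] [TopologicalSpace M]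

theorem MarkedConfig.finite_inter (ω : MarkedConfig X M) {K : Set X} (hK : IsCompact K) :
    (ω.1 ∩ Prod.fst ⁻¹' K).Finite := by
  refine Finite.of_finite_image ((ω.2.2 K hK).subset ?_) (ω.2.1.mono inter_subset_left)
  rintro _ ⟨z, ⟨hz, hzK⟩, rfl⟩
  exact ⟨⟨z, hz, rfl⟩, hzK⟩

theorem MarkedConfig.finite_inter_support (ω : MarkedConfig X M) {f : X × M → ℝ}
    (hf : HasCompactSupport f) : (ω.1 ∩ Function.support f).Finite :=
  (ω.finite_inter (hf.isCompact.image continuous_fst)).subset fun z hz =>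
    ⟨hz.1, z, subset_tsupport f hz.2, rfl⟩

/-- The part of a configuration over a compact set, as a list. -/
theorem MarkedConfig.exists_list (ω : MarkedConfig X M) {K : Set X} (hK : IsCompact K) :
    ∃ l : List (X × M), ∀ f : X × M → ℝ, (∀ z, f z ≠ 0 → z.1 ∈ K) → pairing f ω = pointSum l f := by
  refine ⟨(ω.finite_inter hK).toFinset.toList, fun f hf => ?_⟩
  rw [pairing, pointSum, Finset.sum_map_toList]
  refine finsum_mem_eq_sum_of_inter_support_eq f ?_
  ext z
  simp only [mem_inter_iff, Function.mem_support, Finset.mem_coe, Finite.mem_toFinset,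
    mem_preimage]
  exact ⟨fun h => ⟨⟨h.1, hf z h.2⟩, h.2⟩, fun h => ⟨h.1.1, h.2⟩⟩

theorem MarkedConfig.addPoint_val (ω : MarkedConfig X M) {z : X × M}
    (hz : z.1 ∉ Prod.fst '' ω.1) : (ω.addPoint z).1 = insert z ω.1 :=
  congrArg Subtype.val (dif_pos hz)

theorem pairing_addPoint {f : X × M → ℝ} (hf : HasCompactSupport f) (ω : MarkedConfig X M)
    {z : X × M} (hz : z.1 ∉ Prod.fst '' ω.1) :
    pairing f (ω.addPoint z) = pairing f ω + f z := by
  rw [pairing, pairing, ω.addPoint_val hz,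
    finsum_mem_insert' f (fun h => hz ⟨z, h, rfl⟩) (ω.finite_inter_support hf), add_comm]

variable [MeasurableSpace X] [MeasurableSpace M]

/-- The recursion multiplies arguments together, so the list must represent the configuration on a
class of functions closed under products. -/
theorem charlierQ_eq_charlierPoly (τ : Measure (X × M)) (ω : MarkedConfig X M) (l : List (X × M))
    {C : Set (X × M → ℝ)} (hmul : ∀ f ∈ C, ∀ g ∈ C, (fun z => f z * g z) ∈ C)
    (hC : ∀ f ∈ C, pairing f ω = pointSum l f) {n : ℕ} {φ : Fin n → X × M → ℝ}
    (hφ : ∀ i, φ i ∈ C) :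
    charlierQ τ ω n φ = charlierPoly (fun f => ∫ z, f z ∂τ) l n φ := by
  induction n using Nat.strong_induction_on with
  | _ n ih =>
    match n, ih with
    | 0, _ => rfl
    | 1, _ => rw [charlierQ, charlierPoly, hC _ (hφ 0)]
    | n + 2, ih =>
      have ht : ∀ i, Fin.tail φ i ∈ C := fun i => hφ i.succ
      rw [charlierQ, charlierPoly, hC _ (hφ 0), ih (n + 1) (by omega) ht]
      congr 1
      · congr 1
        refine Finset.sum_congr rfl fun i _ => ih (n + 1) (by omega) fun j => ?_
        rcases eq_or_ne j i with rfl | hj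
        · rw [Function.update_self]
          exact hmul _ (hφ 0) _ (ht _)
        · rw [Function.update_of_ne hj]
          exact ht j
      · exact Finset.sum_congr rfl fun i _ => by rw [ih n (by omega) fun j => ht _]

/-- The functions over a set `K` in the base form a class closed under products. -/
theorem charlierQ_eq_charlierPoly_of_support (τ : Measure (X × M)) (ω : MarkedConfig X M)
    {l : List (X × M)} {K : Set X}
    (hl : ∀ f : X × M → ℝ, (∀ z, f z ≠ 0 → z.1 ∈ K) → pairing f ω = pointSum l f) {n : ℕ}
    {φ : Fin n → X × M → ℝ} (hφ : ∀ i z, φ i z ≠ 0 → z.1 ∈ K) :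
    charlierQ τ ω n φ = charlierPoly (fun f => ∫ z, f z ∂τ) l n φ :=
  charlierQ_eq_charlierPoly τ ω l (C := {f | ∀ z, f z ≠ 0 → z.1 ∈ K})
    (fun _ hf _ _ z hz => hf z (left_ne_zero_of_mul hz)) hl hφ

/-- Gives the gradient of Q_n(φ^{⊗n}) as a multiple of φ. At n = 0 the truncated index n - 1 is
harmless, since its coefficient is 0. -/
theorem charlierQ_const_addPoint (τ : Measure (X × M)) {φ : X × M → ℝ} (hφ : HasCompactSupport φ)
    (ω : MarkedConfig X M) {z : X × M} (hz : z.1 ∉ Prod.fst '' ω.1) (n : ℕ) :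
    charlierQ τ (ω.addPoint z) n (fun _ => φ) = charlierQ τ ω n (fun _ => φ)
      + n * charlierQ τ ω (n - 1) (fun _ => φ) * φ z := by
  obtain ⟨l, hl⟩ := ω.exists_list (hφ.isCompact.image continuous_fst)
  have hC : ∀ m, charlierQ τ ω m (fun _ => φ)
      = charlierPoly (fun f => ∫ z, f z ∂τ) l m (fun _ => φ) := fun m =>
    charlierQ_eq_charlierPoly_of_support τ ω hl fun _ z hz => ⟨z, subset_tsupport φ hz, rfl⟩
  -- The new point z may lie outside the base support of φ, so the class also records compact
  -- support, under which the pairing gains exactly the summand f(z).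
  have hC' : charlierQ τ (ω.addPoint z) n (fun _ => φ)
      = charlierPoly (fun f => ∫ z, f z ∂τ) (z :: l) n (fun _ => φ) :=
    charlierQ_eq_charlierPoly τ _ _
      (C := {f | HasCompactSupport f ∧ ∀ z, f z ≠ 0 → z.1 ∈ Prod.fst '' tsupport φ})
      (fun _ hf _ _ => ⟨hf.1.mul_right, fun z hz => hf.2 z (left_ne_zero_of_mul hz)⟩)
      (fun f hf => by
        rw [pairing_addPoint hf.1 ω hz, hl f hf.2]
        simp [pointSum, add_comm])
      fun _ => ⟨hφ, fun z hz => ⟨z, subset_tsupport φ hz, rfl⟩⟩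
  rw [hC', hC, hC]
  cases n with
  | zero => simp [charlierPoly]
  | succ n =>
    rw [charlierPoly_const_cons, Nat.add_sub_cancel]
    push_cast
    ring

/-- Classes of test functions. -/
structure IsTestClass (τ : Measure (X × M)) (D : Set (X × M → ℝ)) : Prop where
  zero_mem : (0 : X × M → ℝ) ∈ D
  add_mem : ∀ f ∈ D, ∀ g ∈ D, f + g ∈ D
  mul_mem : ∀ f ∈ D, ∀ g ∈ D, (fun z => f z * g z) ∈ D
  hasCompactSupport : ∀ f ∈ D, HasCompactSupport f
  continuous : ∀ f ∈ D, Continuous f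
  integrable : ∀ f ∈ D, Integrable f τ

theorem IsTestClass.sum_mem {τ : Measure (X × M)} {D : Set (X × M → ℝ)} (hD : IsTestClass τ D)
    {ι : Type*} (s : Finset ι) {f : ι → X × M → ℝ} (hf : ∀ i, f i ∈ D) : ∑ i ∈ s, f i ∈ D := by
  classical
  induction s using Finset.induction_on with
  | empty => simpa using hD.zero_mem
  | insert i s hi ih =>
    rw [Finset.sum_insert hi]
    exact hD.add_mem _ (hf i) _ ih

theorem factorial_mul_charlierQ {τ : Measure (X × M)} {D : Set (X × M → ℝ)}
    (hD : IsTestClass τ D) (ω : MarkedConfig X M) {n : ℕ} {ψ : Fin n → X × M → ℝ}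
    (hψ : ∀ i, ψ i ∈ D) : n.factorial * charlierQ τ ω n ψ
      = altSum (fun S => charlierQ τ ω n fun _ => ∑ i ∈ S, ψ i) Finset.univ := by
  have hK : IsCompact (⋃ i, Prod.fst '' tsupport (ψ i)) :=
    isCompact_iUnion fun i => (hD.hasCompactSupport _ (hψ i)).isCompact.image continuous_fst
  obtain ⟨l, hl⟩ := ω.exists_list hK
  have hsupp : ∀ i z, ψ i z ≠ 0 → z.1 ∈ ⋃ i, Prod.fst '' tsupport (ψ i) := fun i z hz =>
    mem_iUnion.2 ⟨i, z, subset_tsupport _ hz, rfl⟩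
  rw [charlierQ_eq_charlierPoly_of_support τ ω hl hsupp, factorial_mul_charlierPoly]
  · congr 1
    funext S
    rw [charlierQ_eq_charlierPoly_of_support τ ω hl]
    intro _ z hz
    rw [Finset.sum_apply] at hz
    obtain ⟨i, -, hi⟩ := Finset.exists_ne_zero_of_sum_ne_zero hz
    exact hsupp i z hi
  · intro S
    simp only [Finset.sum_apply]
    exact integral_finsetSum S fun i _ => hD.integrable _ (hψ i)

/-- The span of the functions `Q_n(φ^{⊗n}; ·)`, `φ ∈ D`. -/
def charlierSpan (τ : Measure (X × M)) (D : Set (X × M → ℝ)) :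
    Submodule ℝ (MarkedConfig X M → ℝ) :=
  Submodule.span ℝ (range fun (q : ℕ × D) ω => charlierQ τ ω q.1 fun _ => q.2.1)

theorem charlierQ_mem_charlierSpan {τ : Measure (X × M)} {D : Set (X × M → ℝ)}
    (hD : IsTestClass τ D) {n : ℕ} {ψ : Fin n → X × M → ℝ} (hψ : ∀ i, ψ i ∈ D) :
    (fun ω => charlierQ τ ω n ψ) ∈ charlierSpan τ D := by
  have h : (fun ω => charlierQ τ ω n ψ) = (n.factorial : ℝ)⁻¹ •
      ∑ S ∈ (Finset.univ : Finset (Fin n)).powerset, (-1 : ℝ) ^ ((Finset.univ : Finset (Fin n)).card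
        + S.card) • fun ω => charlierQ τ ω n fun _ => ∑ i ∈ S, ψ i := by
    funext ω
    have := factorial_mul_charlierQ hD ω hψ
    simp only [altSum] at this
    simp only [Pi.smul_apply, Finset.sum_apply, smul_eq_mul]
    rw [← this, inv_mul_cancel_left₀ (by positivity)]
  rw [h]
  refine Submodule.smul_mem _ _ (Submodule.sum_mem _ fun S _ => Submodule.smul_mem _ _ ?_)
  exact Submodule.subset_span ⟨(n, ⟨_, hD.sum_mem S hψ⟩), rfl⟩

/-- The recursion is solved for its product term. The remaining terms have mixed arguments or lower
degree, and polarization puts them in the span of the pure powers. -/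
theorem pairing_mul_mem_charlierSpan {τ : Measure (X × M)} {D : Set (X × M → ℝ)}
    (hD : IsTestClass τ D) {φ : X × M → ℝ} (hφ : φ ∈ D) {F : MarkedConfig X M → ℝ}
    (hF : F ∈ charlierSpan τ D) : (fun ω => F ω * pairing φ ω) ∈ charlierSpan τ D := by
  induction hF using Submodule.span_induction with
  | mem F hF =>
    obtain ⟨⟨n, ψ⟩, rfl⟩ := hF
    cases n with
    | zero =>
      have h : (fun ω : MarkedConfig X M => charlierQ τ ω 0 (fun _ => ψ.1) * pairing φ ω)
          = (fun ω => charlierQ τ ω 1 fun _ => φ)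
            + (∫ z, φ z ∂τ) • fun ω => charlierQ τ ω 0 fun _ => φ := by
        funext ω
        simp [charlierQ]
      rw [h]
      exact Submodule.add_mem _ (charlierQ_mem_charlierSpan hD fun _ => hφ)
        (Submodule.smul_mem _ _ (charlierQ_mem_charlierSpan hD fun _ => hφ))
    | succ n =>
      have h : (fun ω : MarkedConfig X M => charlierQ τ ω (n + 1) (fun _ => ψ.1) * pairing φ ω)
          = (fun ω => charlierQ τ ω (n + 2) (Fin.cons φ fun _ => ψ.1))
            + (∫ z, φ z ∂τ) • (fun ω => charlierQ τ ω (n + 1) fun _ => ψ.1)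
            + ∑ i : Fin (n + 1), (fun ω => charlierQ τ ω (n + 1)
                (Function.update (fun _ => ψ.1) i fun z => φ z * ψ.1 z))
            + ∑ i : Fin (n + 1), (∫ z, φ z * ψ.1 z ∂τ) •
                (fun ω => charlierQ τ ω n fun _ => ψ.1) := by
        funext ω
        simp only [Pi.add_apply, Pi.smul_apply, Finset.sum_apply, smul_eq_mul]
        conv_rhs => rw [charlierQ]
        simp only [Fin.cons_zero, Fin.tail_cons]
        ring
      rw [h]
      refine Submodule.add_mem _ (Submodule.add_mem _ (Submodule.add_mem _ ?_ ?_) ?_) ?_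
      · refine charlierQ_mem_charlierSpan hD fun i => ?_
        cases i using Fin.cases with
        | zero => exact hφ
        | succ i => exact ψ.2
      · exact Submodule.smul_mem _ _ (charlierQ_mem_charlierSpan hD fun _ => ψ.2)
      · refine Submodule.sum_mem _ fun i _ => charlierQ_mem_charlierSpan hD fun j => ?_
        rcases eq_or_ne j i with rfl | hj
        · rw [Function.update_self]
          exact hD.mul_mem _ hφ _ ψ.2
        · rw [Function.update_of_ne hj]
          exact ψ.2
      · exact Submodule.sum_mem _ fun i _ =>
          Submodule.smul_mem _ _ (charlierQ_mem_charlierSpan hD fun _ => ψ.2)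
  | zero => 
    simp only [Pi.zero_apply, zero_mul]
    exact (charlierSpan τ D).zero_mem
  | add F G _ _ hF hG =>
    simp only [Pi.add_apply, add_mul]
    exact Submodule.add_mem _ hF hG
  | smul a F _ hF =>
    simp only [Pi.smul_apply, smul_eq_mul, mul_assoc]
    exact Submodule.smul_mem _ a hF

theorem polyCylinder_subset_charlierSpan {τ : Measure (X × M)} {D : Set (X × M → ℝ)}
    (hD : IsTestClass τ D) : PolyCylinder D ⊆ (charlierSpan τ D : Set (MarkedConfig X M → ℝ)) := by
  rintro F ⟨N, φ, g, hφ, hF⟩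
  obtain rfl : F = fun ω => MvPolynomial.eval (fun i => pairing (φ i) ω) g := funext hF
  clear hF
  change _ ∈ charlierSpan τ D
  induction g using MvPolynomial.induction_on with
  | C a =>
    have h : (fun ω : MarkedConfig X M => MvPolynomial.eval (fun i => pairing (φ i) ω)
        (MvPolynomial.C a)) = a • fun ω => charlierQ τ ω 0 fun _ => 0 := by
      funext ω
      simp [charlierQ]
    rw [h]
    exact Submodule.smul_mem _ _ (charlierQ_mem_charlierSpan hD fun _ => hD.zero_mem)
  | add p q hp hq =>
    simp only [map_add]
    exact Submodule.add_mem _ hp hq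
  | mul_X p i hp =>
    simp only [map_mul, MvPolynomial.eval_X]
    exact pairing_mul_mem_charlierSpan hD (hφ i) hp

end CharlierConfig

/-! ### Measurability on the marked configuration space -/

section Measurability

variable {X M : Type*} [TopologicalSpace X] [MeasurableSpace X] [MeasurableSpace M]

theorem measurable_countIn {B : Set (X × M)} (hB : IsBcMarked B) :
    Measurable (countIn B : MarkedConfig X M → ℕ) :=
  measurable_iff_comap_le.2 (le_iSup₂_of_le B hB le_rfl)

theorem measurable_markedConfig {α : Type*} [MeasurableSpace α] {g : α → MarkedConfig X M}
    (h : ∀ B : Set (X × M), IsBcMarked B → Measurable fun a => countIn B (g a)) :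
    Measurable g := by
  rw [measurable_iff_comap_le, MarkedConfig.instMeasurableSpace, MeasurableSpace.comap_iSup]
  refine iSup_le fun B => ?_
  rw [MeasurableSpace.comap_iSup]
  refine iSup_le fun hB => ?_
  rw [MeasurableSpace.comap_comp]
  exact (h B hB).comap_le

theorem IsBc.inter {L K : Set X} (hL : IsBc L) (hK : MeasurableSet K) : IsBc (L ∩ K) :=
  ⟨hL.1.inter hK, hL.2.of_isClosed_subset isClosed_closure (closure_mono inter_subset_left)⟩

theorem IsBcMarked.inter_prod_univ {B : Set (X × M)} (hB : IsBcMarked B) {L : Set X}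
    (hL : MeasurableSet L) : IsBcMarked (B ∩ L ×ˢ univ) := by
  refine ⟨hB.1.inter (hL.prod MeasurableSet.univ), ?_⟩
  have h : Prod.fst '' (B ∩ L ×ˢ univ) = Prod.fst '' B ∩ L := by
    ext x
    constructor
    · rintro ⟨z, ⟨hz, hzL, -⟩, rfl⟩
      exact ⟨⟨z, hz, rfl⟩, hzL⟩
    · rintro ⟨⟨z, hz, rfl⟩, hzL⟩
      exact ⟨z, ⟨hz, hzL, trivial⟩, rfl⟩
  rw [h]
  exact hB.2.inter hL

theorem isBcMarked_prod_univ {L : Set X} (hL : IsBc L) : IsBcMarked (L ×ˢ (univ : Set M)) := by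
  refine ⟨hL.1.prod MeasurableSet.univ, ?_⟩
  rcases isEmpty_or_nonempty M with hM | hM
  · rw [eq_empty_of_isEmpty (L ×ˢ (univ : Set M)), image_empty]
    exact ⟨MeasurableSet.empty, by simp⟩
  · rw [fst_image_prod _ univ_nonempty]
    exact hL

theorem countIn_restrict (B : Set (X × M)) (L : Set X) (ω : MarkedConfig X M) :
    countIn B (ω.restrict L) = countIn (B ∩ L ×ˢ univ) ω := by
  rw [countIn, countIn, MarkedConfig.restrict, inter_assoc, inter_comm B]

theorem MarkedConfig.measurable_restrict {L : Set X} (hL : MeasurableSet L) :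
    Measurable (MarkedConfig.restrict L : MarkedConfig X M → MarkedConfig X M) := by
  refine measurable_markedConfig fun B hB => ?_
  simp only [countIn_restrict]
  exact measurable_countIn (hB.inter_prod_univ hL)

theorem countIn_prod_univ_restrict (L : Set X) (ω : MarkedConfig X M) :
    countIn (L ×ˢ univ) (ω.restrict L) = countIn (L ×ˢ univ) ω := by
  rw [countIn_restrict, inter_self]

theorem ofTuple_val {n : ℕ} {z : Fin n → X × M} (h : Function.Injective fun i => (z i).1) :
    (MarkedConfig.ofTuple n z).1 = range z :=
  congrArg Subtype.val (dif_pos h)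

theorem ofTuple_val_of_not {n : ℕ} {z : Fin n → X × M}
    (h : ¬ Function.Injective fun i => (z i).1) : (MarkedConfig.ofTuple n z).1 = ∅ :=
  congrArg Subtype.val (dif_neg h)

theorem countIn_ofTuple_le {n : ℕ} (B : Set (X × M)) (z : Fin n → X × M) :
    countIn B (MarkedConfig.ofTuple n z) ≤ n := by
  by_cases h : Function.Injective fun i => (z i).1
  · rw [countIn, ofTuple_val h]
    refine (ncard_le_ncard inter_subset_left (finite_range z)).trans ?_
    rw [← image_univ]
    refine (ncard_image_le finite_univ).trans ?_
    simp [ncard_univ]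
  · rw [countIn, ofTuple_val_of_not h]
    simp

theorem pairing_ofTuple {n : ℕ} {z : Fin n → X × M} (h : Function.Injective fun i => (z i).1)
    (f : X × M → ℝ) : pairing f (MarkedConfig.ofTuple n z) = pointSum (List.ofFn z) f := by
  have hz : Function.Injective z := fun i j hij => h (congrArg Prod.fst hij)
  rw [pairing, ofTuple_val h, finsum_mem_range hz, finsum_eq_sum_of_fintype, pointSum,
    List.map_ofFn, List.sum_ofFn]
  rfl

theorem pairing_indicator_one {B : Set (X × M)} {ω : MarkedConfig X M} (h : (ω.1 ∩ B).Finite) :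
    pairing (B.indicator 1) ω = countIn B ω := by
  rw [pairing, countIn, ncard_eq_toFinset_card _ h,
    finsum_mem_eq_sum_of_inter_support_eq (t := h.toFinset)]
  · rw [Finset.sum_congr rfl (g := fun _ => (1 : ℝ)), Finset.sum_const, nsmul_eq_mul, mul_one]
    intro z hz
    rw [Finite.mem_toFinset] at hz
    simp [hz.2]
  · ext z
    simp only [mem_inter_iff, Function.mem_support, Finset.mem_coe, Finite.mem_toFinset,
      indicator_apply_ne_zero]
    simp only [Pi.one_apply, ne_eq, one_ne_zero, not_false_eq_true]
    tauto

theorem measurableSet_injective_fst [SecondCountableTopology X] [T2Space X] [BorelSpace X] (n : ℕ) :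
    MeasurableSet {z : Fin n → X × M | Function.Injective fun i => (z i).1} := by
  have h : {z : Fin n → X × M | Function.Injective fun i => (z i).1}
      = ⋂ i, ⋂ j, {z | (z i).1 = (z j).1 → i = j} := by
    ext z
    simp [Function.Injective]
  rw [h]
  refine MeasurableSet.iInter fun i => MeasurableSet.iInter fun j => ?_
  by_cases hij : i = j
  · simp [hij]
  · simp only [hij, imp_false]
    exact (measurableSet_eq_fun (measurable_fst.comp (measurable_pi_apply i))
      (measurable_fst.comp (measurable_pi_apply j))).compl

theorem measurable_ofTuple [SecondCountableTopology X] [T2Space X] [BorelSpace X] (n : ℕ) :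
    Measurable (MarkedConfig.ofTuple n : (Fin n → X × M) → MarkedConfig X M) := by
  classical
  refine measurable_markedConfig fun B hB => ?_
  have h : (fun z : Fin n → X × M => countIn B (MarkedConfig.ofTuple n z))
      = fun z => if Function.Injective (fun i => (z i).1) then
        ∑ i, (if z i ∈ B then 1 else 0) else 0 := by
    funext z
    split_ifs with hz
    · have hz' : Function.Injective z := fun i j hij => hz (congrArg Prod.fst hij)
      have hr : range z ∩ B = z '' {i | z i ∈ B} := by
        ext x
        constructor
        · rintro ⟨⟨i, rfl⟩, hi⟩
          exact ⟨i, hi, rfl⟩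
        · rintro ⟨i, hi, rfl⟩
          exact ⟨⟨i, rfl⟩, hi⟩
      rw [countIn, ofTuple_val hz, hr, ncard_image_of_injective _ hz', Finset.sum_boole,
        ← ncard_coe_finset]
      simp
    · rw [countIn, ofTuple_val_of_not hz]
      simp
  rw [h]
  refine Measurable.ite (measurableSet_injective_fst n) (Finset.measurable_sum _ fun i _ => ?_)
    measurable_const
  exact Measurable.ite (measurable_pi_apply i hB.1) measurable_const measurable_const

theorem tendsto_pointSum {Z : Type*} (l : List Z) {f : ℕ → Z → ℝ} {g : Z → ℝ}
    (h : ∀ z, Tendsto (fun n => f n z) atTop (𝓝 (g z))) :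
    Tendsto (fun n => pointSum l (f n)) atTop (𝓝 (pointSum l g)) := by
  induction l with
  | nil => simp [pointSum]
  | cons z l ih => simpa [pointSum] using (h z).add ih

theorem pointSum_sum {Z ι : Type*} (l : List Z) (s : Finset ι) (c : ι → ℝ) (f : ι → Z → ℝ) :
    pointSum l (fun z => ∑ i ∈ s, c i * f i z) = ∑ i ∈ s, c i * pointSum l (f i) := by
  induction l with
  | nil => simp [pointSum]
  | cons z l ih =>
    simp only [pointSum, List.map_cons, List.sum_cons, mul_add, Finset.sum_add_distrib] at ih ⊢
    rw [ih]

theorem sum_indicator_le_eq_floor {y : ℝ} (hy : 0 ≤ y) {K : ℕ} (hK : y ≤ K) :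
    ∑ k ∈ Finset.Icc 1 K, (if (k : ℝ) ≤ y then (1 : ℝ) else 0) = ⌊y⌋₊ := by
  rw [Finset.sum_boole]
  congr 1
  have : (Finset.Icc 1 K).filter (fun k : ℕ => (k : ℝ) ≤ y) = Finset.Icc 1 ⌊y⌋₊ := by
    ext k
    simp only [Finset.mem_filter, Finset.mem_Icc]
    constructor
    · rintro ⟨⟨h1, -⟩, h3⟩
      exact ⟨h1, Nat.le_floor h3⟩
    · rintro ⟨h1, h2⟩
      have h3 : (k : ℝ) ≤ y := (Nat.le_floor_iff hy).1 h2
      exact ⟨⟨h1, by exact_mod_cast h3.trans hK⟩, h3⟩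
  rw [this]
  simp

variable [TopologicalSpace M] [T2Space X] [T2Space M] [BorelSpace X]
  [BorelSpace (X × M)]

/-- Only counting functions are measurable by definition. The discretization ⌊m f⌋/m is a finite
combination of indicators of the superlevel sets {k ≤ m f}, which for k ≥ 1 are compact, and it
converges to f pointwise. Over a fixed configuration the pairing is a finite sum, so the pairings
converge too. -/
theorem measurable_pairing_of_nonneg {f : X × M → ℝ} (hf : Continuous f)
    (hfc : HasCompactSupport f) (h0 : ∀ z, 0 ≤ f z) :
    Measurable (pairing f : MarkedConfig X M → ℝ) := by
  obtain ⟨R, hR⟩ := hfc.exists_bound_of_continuous hf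
  have hfR : ∀ z, f z ≤ R := fun z => (le_abs_self _).trans (hR z)
  let S : ℕ → ℕ → Set (X × M) := fun m k => {z | (k : ℝ) ≤ f z * m}
  have hS : ∀ m k, 1 ≤ k → IsCompact (S m k) := fun m k hk => by
    refine hfc.isCompact.of_isClosed_subset
      (isClosed_le continuous_const (hf.mul continuous_const)) fun z hz => ?_
    refine subset_tsupport f fun hz0 => ?_
    have hz' : (k : ℝ) ≤ f z * m := hz
    rw [hz0, zero_mul] at hz'
    have : (1 : ℝ) ≤ k := by exact_mod_cast hk
    linarith
  have hBc : ∀ m k, 1 ≤ k → IsBcMarked (S m k) := fun m k hk => by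
    have hc := (hS m k hk).image (continuous_fst (X := X) (Y := M))
    exact ⟨(hS m k hk).measurableSet, hc.measurableSet, by rwa [hc.isClosed.closure_eq]⟩
  -- A bound for m f: no level k above it is ever reached.
  let K : ℕ → ℕ := fun m => ⌈R * m⌉₊
  have hlim : Tendsto (fun m (ω : MarkedConfig X M) =>
      ∑ k ∈ Finset.Icc 1 (K m), (m : ℝ)⁻¹ * (countIn (S m k) ω : ℝ)) atTop (𝓝 (pairing f)) := by
    refine tendsto_pi_nhds.2 fun ω => ?_
    have hcK := hfc.isCompact.image (continuous_fst (X := X) (Y := M))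
    obtain ⟨l, hl⟩ := ω.exists_list hcK
    rw [hl f fun z hz => ⟨z, subset_tsupport f hz, rfl⟩]
    have hpt : ∀ z, Tendsto (fun m : ℕ => (⌊f z * m⌋₊ : ℝ) / m) atTop (𝓝 (f z)) := fun z =>
      (tendsto_nat_floor_mul_div_atTop (h0 z)).comp tendsto_natCast_atTop_atTop
    refine (tendsto_pointSum l hpt).congr fun m => ?_
    have hfloor : (fun z => (⌊f z * m⌋₊ : ℝ) / m) = fun z =>
        ∑ k ∈ Finset.Icc 1 (K m), (m : ℝ)⁻¹ * (S m k).indicator 1 z := by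
      funext z
      rw [← sum_indicator_le_eq_floor (K := K m) (mul_nonneg (h0 z) (by positivity))
        ((mul_le_mul_of_nonneg_right (hfR z) (by positivity)).trans (Nat.le_ceil _)),
        div_eq_inv_mul, Finset.mul_sum]
      refine Finset.sum_congr rfl fun k _ => ?_
      simp [S, indicator_apply]
    rw [hfloor, pointSum_sum]
    refine Finset.sum_congr rfl fun k hk => ?_
    have hk1 := (Finset.mem_Icc.1 hk).1
    have hsub : ∀ z ∈ S m k, z.1 ∈ Prod.fst '' tsupport f := fun z hz => by
      refine ⟨z, subset_tsupport f fun hz0 => ?_, rfl⟩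
      have hz' : (k : ℝ) ≤ f z * m := hz
      rw [hz0, zero_mul] at hz'
      have : (1 : ℝ) ≤ k := by exact_mod_cast hk1
      linarith
    rw [← pairing_indicator_one, hl]
    · intro z hz
      exact hsub z (by_contra fun h => hz (indicator_of_notMem h _))
    · exact (ω.finite_inter hcK).subset fun z hz => ⟨hz.1, hsub z hz.2⟩
  refine measurable_of_tendsto_metrizable (fun m => ?_) hlim
  refine Finset.measurable_sum _ fun k hk => Measurable.const_mul ?_ _
  exact (measurable_from_top (f := fun n : ℕ => (n : ℝ))).comp
    (measurable_countIn (hBc m k (Finset.mem_Icc.1 hk).1))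

theorem measurable_pairing {f : X × M → ℝ} (hf : Continuous f) (hfc : HasCompactSupport f) :
    Measurable (pairing f : MarkedConfig X M → ℝ) := by
  have hc : ∀ g : ℝ → ℝ, g 0 = 0 → HasCompactSupport fun z => g (f z) := fun g hg =>
    hfc.comp_left hg
  have h1 := measurable_pairing_of_nonneg (f := fun z => max (f z) 0)
    (hf.max continuous_const) (hc (fun y => max y 0) (by simp)) fun z => le_max_right _ _
  have h2 := measurable_pairing_of_nonneg (f := fun z => max (-f z) 0)
    (hf.neg.max continuous_const) (hc (fun y => max (-y) 0) (by simp)) fun z => le_max_right _ _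
  have h : (pairing f : MarkedConfig X M → ℝ)
      = fun ω => pairing (fun z => max (f z) 0) ω - pairing (fun z => max (-f z) 0) ω := by
    funext ω
    obtain ⟨l, hl⟩ := ω.exists_list (hfc.isCompact.image continuous_fst)
    have hs : ∀ g : ℝ → ℝ, g 0 = 0 → ∀ z, g (f z) ≠ 0 → z.1 ∈ Prod.fst '' tsupport f :=
      fun g hg z hz => ⟨z, subset_tsupport f fun h0 => hz (by rw [h0, hg]), rfl⟩
    rw [hl f (hs id rfl), hl _ (hs (fun y => max y 0) (by simp)),
      hl _ (hs (fun y => max (-y) 0) (by simp))]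
    clear hl
    induction l with
    | nil => simp [pointSum]
    | cons z l ih =>
      simp only [pointSum, List.map_cons, List.sum_cons] at ih ⊢
      rw [ih]
      have : f z = max (f z) 0 - max (-f z) 0 := by
        rcases le_total 0 (f z) with h | h
        · rw [max_eq_left h, max_eq_right (by linarith), sub_zero]
        · rw [max_eq_right h, max_eq_left (by linarith)]
          ring
      linarith
  rw [h]
  exact h1.sub h2

end Measurability

/-! ### Integrability with respect to the marked Poisson measure -/

section Integrability

variable {X M : Type*} [TopologicalSpace X] [MeasurableSpace X] [MeasurableSpace M]
  [SecondCountableTopology X] [T2Space X] [BorelSpace X]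

theorem isBc_of_isOpen {L : Set X} (hL : IsOpen L) (hLc : IsCompact (closure L)) : IsBc L :=
  ⟨hL.measurableSet, hLc⟩

theorem lintegral_poissonIn (τ : Measure (X × M)) (L : Set X) (f : MarkedConfig X M → ℝ≥0∞)
    (hf : Measurable f) : ∫⁻ ω, f ω ∂(poissonIn τ L)
      = ENNReal.ofReal (Real.exp (-(τ (L ×ˢ univ)).toReal)) * ∑' n : ℕ, (n.factorial : ℝ≥0∞)⁻¹ *
        ∫⁻ z, f (MarkedConfig.ofTuple n z) ∂(Measure.pi fun _ : Fin n => τ.restrict (L ×ˢ univ)) := by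
  rw [poissonIn, lintegral_smul_measure, lintegral_sum_measure, smul_eq_mul]
  congr 2
  funext n
  rw [lintegral_smul_measure, lintegral_map hf (measurable_ofTuple n), smul_eq_mul]

/-- An n-tuple yields at most n points, so the integral is dominated by a multiple of the
exponential series ∑ (e^c τ(L × M))^n / n!. -/
theorem integrable_exp_poissonIn {τ : Measure (X × M)} {L : Set X} (hL : IsOpen L)
    (hLc : IsCompact (closure L)) (hτ : τ (L ×ˢ univ) < ∞) {c : ℝ} (hc : 0 ≤ c) :
    Integrable (fun ω : MarkedConfig X M => Real.exp (c * countIn (L ×ˢ univ) ω))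
      (poissonIn τ L) := by
  have hm : Measurable fun ω : MarkedConfig X M => Real.exp (c * countIn (L ×ˢ univ) ω) :=
    Real.measurable_exp.comp (Measurable.const_mul
      ((measurable_from_top (f := fun n : ℕ => (n : ℝ))).comp
        (measurable_countIn (isBcMarked_prod_univ (isBc_of_isOpen hL hLc)))) c)
  refine ⟨hm.aestronglyMeasurable, ?_⟩
  rw [hasFiniteIntegral_iff_ofReal (ae_of_all _ fun ω => (Real.exp_pos _).le),
    lintegral_poissonIn _ _ _ hm.ennreal_ofReal]
  have : IsFiniteMeasure (τ.restrict (L ×ˢ (univ : Set M))) := ⟨by simpa using hτ⟩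
  refine ENNReal.mul_lt_top ENNReal.ofReal_lt_top ?_
  have hle : ∀ n : ℕ, (n.factorial : ℝ≥0∞)⁻¹ * ∫⁻ z, ENNReal.ofReal (Real.exp
      (c * countIn (L ×ˢ univ) (MarkedConfig.ofTuple n z)))
        ∂(Measure.pi fun _ : Fin n => τ.restrict (L ×ˢ univ))
      ≤ ENNReal.ofReal ((Real.exp c * (τ (L ×ˢ univ)).toReal) ^ n / n.factorial) := fun n => by
    have h1 : ∫⁻ z, ENNReal.ofReal (Real.exp
        (c * countIn (L ×ˢ univ) (MarkedConfig.ofTuple n z)))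
        ∂(Measure.pi fun _ : Fin n => τ.restrict (L ×ˢ univ))
        ≤ ENNReal.ofReal (Real.exp (c * n)) * τ (L ×ˢ univ) ^ n := by
      refine (lintegral_mono (g := fun _ => ENNReal.ofReal (Real.exp (c * n))) fun z => ?_).trans ?_
      · refine ENNReal.ofReal_le_ofReal (Real.exp_le_exp.2 (mul_le_mul_of_nonneg_left ?_ hc))
        exact_mod_cast countIn_ofTuple_le _ z
      · rw [lintegral_const, Measure.pi_univ]
        simp
    refine (mul_le_mul_right h1 _).trans_eq ?_
    rw [div_eq_inv_mul, mul_pow, ENNReal.ofReal_mul (by positivity),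
      ENNReal.ofReal_mul (by positivity), ENNReal.ofReal_inv_of_pos (by positivity),
      ENNReal.ofReal_natCast, ENNReal.ofReal_pow ENNReal.toReal_nonneg,
      ENNReal.ofReal_toReal hτ.ne, ← Real.exp_nat_mul, mul_comm c]
  refine (ENNReal.tsum_le_tsum hle).trans_lt ?_
  rw [← ENNReal.ofReal_tsum_of_nonneg (fun n => by positivity)
    (Real.summable_pow_div_factorial _)]
  exact ENNReal.ofReal_lt_top

theorem integrable_exp_countIn {τ : Measure (X × M)} {π : Measure (MarkedConfig X M)}
    (hπ : IsMarkedPoisson τ π) {L : Set X} (hL : IsOpen L) (hLc : IsCompact (closure L))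
    (hτ : τ (L ×ˢ univ) < ∞) {c : ℝ} (hc : 0 ≤ c) :
    Integrable (fun ω : MarkedConfig X M => Real.exp (c * countIn (L ×ˢ univ) ω)) π := by
  have h := integrable_exp_poissonIn (M := M) hL hLc hτ hc
  rw [← hπ.2 L hL hLc] at h
  have h' := (integrable_map_measure h.aestronglyMeasurable
    (MarkedConfig.measurable_restrict hL.measurableSet).aemeasurable).1 h
  refine h'.congr (ae_of_all _ fun ω => ?_)
  simp only [Function.comp_apply, countIn_prod_univ_restrict]

/-- Measurable functions bounded by an exponential of the number of points in a bounded set. -/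
def IsExpBounded (F : MarkedConfig X M → ℝ) : Prop :=
  Measurable F ∧ ∃ (C c : ℝ) (L : Set X), 0 ≤ C ∧ 0 ≤ c ∧ IsOpen L ∧ IsCompact (closure L) ∧
    ∀ ω, |F ω| ≤ C * Real.exp (c * countIn (L ×ˢ univ) ω)

theorem countIn_mono (ω : MarkedConfig X M) {L L' : Set X} (h : L ⊆ L')
    (hL' : IsCompact (closure L')) :
    countIn (L ×ˢ univ) ω ≤ countIn (L' ×ˢ univ) ω := by
  have hfin : (ω.1 ∩ L' ×ˢ univ).Finite := by
    refine Finite.of_finite_image ((ω.2.2 _ hL').subset ?_) (ω.2.1.mono inter_subset_left)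
    rintro _ ⟨z, ⟨hz, hzL, -⟩, rfl⟩
    exact ⟨⟨z, hz, rfl⟩, subset_closure hzL⟩
  exact ncard_le_ncard (inter_subset_inter_right _ (prod_mono_left h)) hfin

theorem IsExpBounded.const (a : ℝ) : IsExpBounded fun _ : MarkedConfig X M => a :=
  ⟨measurable_const, |a|, 0, ∅, abs_nonneg a, le_rfl, isOpen_empty, by simp, fun ω => by simp⟩

theorem exists_common_expBound {F G : MarkedConfig X M → ℝ} (hF : IsExpBounded F)
    (hG : IsExpBounded G) : ∃ (C c : ℝ) (L : Set X), 0 ≤ C ∧ 0 ≤ c ∧ IsOpen L ∧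
      IsCompact (closure L) ∧ (∀ ω, |F ω| ≤ C * Real.exp (c * countIn (L ×ˢ univ) ω)) ∧
        ∀ ω, |G ω| ≤ C * Real.exp (c * countIn (L ×ˢ univ) ω) := by
  obtain ⟨-, C, c, L, hC, hc, hL, hLc, h⟩ := hF
  obtain ⟨-, C', c', L', hC', hc', hL', hLc', h'⟩ := hG
  have hcl : IsCompact (closure (L ∪ L')) := by
    rw [closure_union]
    exact hLc.union hLc'
  refine ⟨max C C', max c c', L ∪ L', hC.trans (le_max_left _ _), hc.trans (le_max_left _ _),
    hL.union hL', hcl, fun ω => (h ω).trans ?_, fun ω => (h' ω).trans ?_⟩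
  · refine mul_le_mul (le_max_left _ _) (Real.exp_le_exp.2 ?_) (Real.exp_pos _).le
      (hC.trans (le_max_left _ _))
    refine mul_le_mul (le_max_left _ _) ?_ (by positivity) (hc.trans (le_max_left _ _))
    exact_mod_cast countIn_mono ω subset_union_left hcl
  · refine mul_le_mul (le_max_right _ _) (Real.exp_le_exp.2 ?_) (Real.exp_pos _).le
      (hC.trans (le_max_left _ _))
    refine mul_le_mul (le_max_right _ _) ?_ (by positivity) (hc.trans (le_max_left _ _))
    exact_mod_cast countIn_mono ω subset_union_right hcl

theorem IsExpBounded.add {F G : MarkedConfig X M → ℝ} (hF : IsExpBounded F)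
    (hG : IsExpBounded G) : IsExpBounded fun ω => F ω + G ω := by
  obtain ⟨C, c, L, hC, hc, hL, hLc, h, h'⟩ := exists_common_expBound hF hG
  refine ⟨hF.1.add hG.1, 2 * C, c, L, by positivity, hc, hL, hLc, fun ω => ?_⟩
  linarith [abs_add_le (F ω) (G ω), h ω, h' ω]

theorem IsExpBounded.mul {F G : MarkedConfig X M → ℝ} (hF : IsExpBounded F)
    (hG : IsExpBounded G) : IsExpBounded fun ω => F ω * G ω := by
  obtain ⟨C, c, L, hC, hc, hL, hLc, h, h'⟩ := exists_common_expBound hF hG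
  refine ⟨hF.1.mul hG.1, C * C, 2 * c, L, by positivity, by positivity, hL, hLc, fun ω => ?_⟩
  rw [abs_mul]
  refine (mul_le_mul (h ω) (h' ω) (abs_nonneg _) (by positivity)).trans_eq ?_
  rw [mul_mul_mul_comm, ← Real.exp_add]
  ring_nf

theorem IsExpBounded.const_mul {F : MarkedConfig X M → ℝ} (hF : IsExpBounded F) (a : ℝ) :
    IsExpBounded fun ω => a * F ω :=
  (IsExpBounded.const a).mul hF

theorem IsExpBounded.sub {F G : MarkedConfig X M → ℝ} (hF : IsExpBounded F)
    (hG : IsExpBounded G) : IsExpBounded fun ω => F ω - G ω := by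
  have := hF.add (hG.const_mul (-1))
  simpa [sub_eq_add_neg] using this

theorem IsExpBounded.sum {ι : Type*} (s : Finset ι) {F : ι → MarkedConfig X M → ℝ}
    (hF : ∀ i, IsExpBounded (F i)) : IsExpBounded fun ω => ∑ i ∈ s, F i ω := by
  classical
  induction s using Finset.induction_on with
  | empty => simpa using IsExpBounded.const 0
  | insert i s hi ih =>
    simp only [Finset.sum_insert hi]
    exact (hF i).add ih

theorem IsExpBounded.integrable {τ : Measure (X × M)}
    (hfin : ∀ L : Set X, IsBc L → τ (L ×ˢ univ) < ∞) {π : Measure (MarkedConfig X M)}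
    (hπ : IsMarkedPoisson τ π) {F : MarkedConfig X M → ℝ} (hF : IsExpBounded F) :
    Integrable F π := by
  obtain ⟨hm, C, c, L, -, hc, hL, hLc, h⟩ := hF
  exact ((integrable_exp_countIn hπ hL hLc (hfin L (isBc_of_isOpen hL hLc)) hc).const_mul C).mono'
    hm.aestronglyMeasurable (ae_of_all _ h)

theorem IsExpBounded.memLp_two {τ : Measure (X × M)}
    (hfin : ∀ L : Set X, IsBc L → τ (L ×ˢ univ) < ∞) {π : Measure (MarkedConfig X M)}
    (hπ : IsMarkedPoisson τ π) {F : MarkedConfig X M → ℝ} (hF : IsExpBounded F) :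
    MemLp F 2 π := by
  rw [memLp_two_iff_integrable_sq hF.1.aestronglyMeasurable]
  refine ((hF.mul hF).integrable hfin hπ).congr (ae_of_all _ fun ω => ?_)
  simp only [sq]

/-- The finite-volume description determines the integral of any integrable measurable G that sees
only the points over L. -/
theorem hasSum_integral_markedPoisson {τ : Measure (X × M)} {π : Measure (MarkedConfig X M)}
    (hπ : IsMarkedPoisson τ π) {L : Set X} (hL : IsOpen L) (hLc : IsCompact (closure L))
    {G : MarkedConfig X M → ℝ} (hG : Measurable G) (hint : Integrable G π)
    (hres : ∀ ω, G (ω.restrict L) = G ω) :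
    HasSum (fun n : ℕ => Real.exp (-(τ (L ×ˢ univ)).toReal) * ((n.factorial : ℝ)⁻¹ *
      ∫ z, G (MarkedConfig.ofTuple n z) ∂(Measure.pi fun _ : Fin n => τ.restrict (L ×ˢ univ))))
      (∫ ω, G ω ∂π) := by
  have hr := MarkedConfig.measurable_restrict (M := M) hL.measurableSet
  have h1 : ∫ ω, G ω ∂π = ∫ ω, G ω ∂(poissonIn τ L) := by
    rw [← hπ.2 L hL hLc, integral_map hr.aemeasurable hG.aestronglyMeasurable]
    simp only [hres]
  have h2 : Integrable G (poissonIn τ L) := by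
    rw [← hπ.2 L hL hLc, integrable_map_measure hG.aestronglyMeasurable hr.aemeasurable]
    exact hint.congr (ae_of_all _ fun ω => (hres ω).symm)
  have hpos : ENNReal.ofReal (Real.exp (-(τ (L ×ˢ univ)).toReal)) ≠ 0 := by
    simpa using Real.exp_pos _
  rw [poissonIn, integrable_smul_measure hpos ENNReal.ofReal_ne_top] at h2
  rw [h1, poissonIn, integral_smul_measure, ENNReal.toReal_ofReal (Real.exp_pos _).le]
  refine ((hasSum_integral_measure h2).mul_left _).congr_fun fun n => ?_
  rw [integral_smul_measure, integral_map (measurable_ofTuple n).aemeasurable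
    hG.aestronglyMeasurable]
  simp

end Integrability

/-! ### Locality and exponential bounds for Charlier polynomials -/

section IntegrabilityCharlier

variable {X M : Type*} [TopologicalSpace X] [MeasurableSpace X] [MeasurableSpace M]
  [SecondCountableTopology X] [T2Space X] [BorelSpace X] [LocallyCompactSpace X]
  [TopologicalSpace M] [T2Space M] [BorelSpace (X × M)]

theorem pairing_restrict {f : X × M → ℝ} {L : Set X} (hf : ∀ z, f z ≠ 0 → z.1 ∈ L)
    (ω : MarkedConfig X M) : pairing f (ω.restrict L) = pairing f ω := by
  refine finsum_congr fun z => ?_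
  by_cases hz : f z = 0
  · simp [hz]
  · have hm : z ∈ (ω.restrict L).1 ↔ z ∈ ω.1 :=
      ⟨fun h => h.1, fun h => ⟨h, hf z hz, trivial⟩⟩
    simp only [hm]

theorem charlierQ_restrict (τ : Measure (X × M)) {φ : X × M → ℝ} (hφ : HasCompactSupport φ)
    {L : Set X} (hL : Prod.fst '' tsupport φ ⊆ L) (ω : MarkedConfig X M) (n : ℕ) :
    charlierQ τ (ω.restrict L) n (fun _ => φ) = charlierQ τ ω n (fun _ => φ) := by
  obtain ⟨l, hl⟩ := ω.exists_list (hφ.isCompact.image continuous_fst)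
  have hs : ∀ _ : Fin n, ∀ z, φ z ≠ 0 → z.1 ∈ Prod.fst '' tsupport φ :=
    fun _ z hz => ⟨z, subset_tsupport φ hz, rfl⟩
  rw [charlierQ_eq_charlierPoly_of_support τ ω hl hs,
    charlierQ_eq_charlierPoly_of_support τ (ω.restrict L) (l := l) _ hs]
  intro f hf
  rw [pairing_restrict (fun z hz => hL (hf z hz)), hl f hf]

theorem isExpBounded_pairing {f : X × M → ℝ} (hf : Continuous f) (hfc : HasCompactSupport f) :
    IsExpBounded (pairing f : MarkedConfig X M → ℝ) := by
  obtain ⟨R, hR⟩ := hfc.exists_bound_of_continuous hf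
  obtain ⟨L, hL, hKL, hLc⟩ := exists_isOpen_superset_and_isCompact_closure
    (hfc.isCompact.image (continuous_fst (X := X) (Y := M)))
  refine ⟨measurable_pairing hf hfc, |R|, 1, L, abs_nonneg R, zero_le_one, hL, hLc, fun ω => ?_⟩
  have hfin : (ω.1 ∩ L ×ˢ univ).Finite :=
    (ω.finite_inter hLc).subset fun z hz => ⟨hz.1, subset_closure hz.2.1⟩
  have hp : pairing f ω = ∑ z ∈ hfin.toFinset, f z := by
    refine finsum_mem_eq_sum_of_inter_support_eq f ?_
    ext z
    simp only [mem_inter_iff, Function.mem_support, Finset.mem_coe, Finite.mem_toFinset]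
    exact ⟨fun h => ⟨⟨h.1, hKL ⟨z, subset_tsupport f h.2, rfl⟩, trivial⟩, h.2⟩,
      fun h => ⟨h.1.1, h.2⟩⟩
  rw [hp, countIn, ncard_eq_toFinset_card _ hfin, one_mul]
  refine (Finset.abs_sum_le_sum_abs _ _).trans ?_
  refine (Finset.sum_le_card_nsmul _ _ |R| fun z _ => (hR z).trans (le_abs_self R)).trans ?_
  rw [nsmul_eq_mul, mul_comm]
  refine mul_le_mul_of_nonneg_left ?_ (abs_nonneg R)
  linarith [Real.add_one_le_exp (hfin.toFinset.card : ℝ)]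

theorem IsTestClass.isExpBounded_charlierQ {τ : Measure (X × M)} {D : Set (X × M → ℝ)}
    (hD : IsTestClass τ D) {n : ℕ} {φ : Fin n → X × M → ℝ} (hφ : ∀ i, φ i ∈ D) :
    IsExpBounded fun ω => charlierQ τ ω n φ := by
  have hp : ∀ f ∈ D, IsExpBounded (pairing f : MarkedConfig X M → ℝ) := fun f hf =>
    isExpBounded_pairing (hD.continuous f hf) (hD.hasCompactSupport f hf)
  induction n using Nat.strong_induction_on with
  | _ n ih =>
    match n, ih with
    | 0, _ => exact IsExpBounded.const 1
    | 1, _ => exact (hp _ (hφ 0)).sub (IsExpBounded.const _)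
    | n + 2, ih =>
      have ht : ∀ i, Fin.tail φ i ∈ D := fun i => hφ i.succ
      simp only [charlierQ]
      refine IsExpBounded.sub (IsExpBounded.sub
        ((ih (n + 1) (by omega) ht).mul ((hp _ (hφ 0)).sub (IsExpBounded.const _)))
        (IsExpBounded.sum _ fun i => ih (n + 1) (by omega) fun j => ?_))
        (IsExpBounded.sum _ fun i => (ih n (by omega) fun j => ht _).const_mul _)
      rcases eq_or_ne j i with rfl | hj
      · rw [Function.update_self]
        exact hD.mul_mem _ (hφ 0) _ (ht _)
      · rw [Function.update_of_ne hj]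
        exact ht j

end IntegrabilityCharlier

/-! ### Orthogonality of the Charlier polynomials -/

section TupleIntegrals

variable {Z : Type*} [MeasurableSpace Z] (μ : Measure Z) [IsFiniteMeasure μ]

theorem integrable_comp_tuple {N : ℕ} {φ ψ : Z → ℝ} (hφ : Measurable φ) (hψ : Measurable ψ)
    {R : ℝ} (hφR : ∀ z, |φ z| ≤ R) (hψR : ∀ z, |ψ z| ≤ R)
    {F : (Fin N → ℝ) × (Fin N → ℝ) → ℝ} (hF : Continuous F) :
    Integrable (fun z : Fin N → Z => F (fun i => φ (z i), fun i => ψ (z i)))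
      (Measure.pi fun _ => μ) := by
  have hK : IsCompact ((univ.pi fun _ : Fin N => Icc (-R) R) ×ˢ
      (univ.pi fun _ : Fin N => Icc (-R) R)) :=
    (isCompact_univ_pi fun _ => isCompact_Icc).prod (isCompact_univ_pi fun _ => isCompact_Icc)
  obtain ⟨C, hC⟩ := hK.exists_bound_of_continuousOn hF.continuousOn
  have hm : Measurable fun z : Fin N → Z => F (fun i => φ (z i), fun i => ψ (z i)) := by
    refine hF.measurable.comp (Measurable.prodMk ?_ ?_)
    · exact measurable_pi_lambda _ fun i => hφ.comp (measurable_pi_apply i)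
    · exact measurable_pi_lambda _ fun i => hψ.comp (measurable_pi_apply i)
  refine Integrable.of_bound hm.aestronglyMeasurable C (ae_of_all _ fun z => hC _ ?_)
  exact ⟨fun i _ => abs_le.1 (hφR _), fun i _ => abs_le.1 (hψR _)⟩

/-- The integral over `N`-point configurations of the product of the `n`-th and `m`-th Charlier
polynomials of `φ` and `ψ`, with `a` and `b` in place of the integrals of `φ` and `ψ`. -/
def charlierMoment (φ ψ : Z → ℝ) (a b : ℝ) (N n m : ℕ) : ℝ :=
  ∫ z : Fin N → Z, charlierVal a N (fun i => φ (z i)) n * charlierVal b N (fun i => ψ (z i)) m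
    ∂(Measure.pi fun _ => μ)

theorem charlierMoment_zero_succ (φ ψ : Z → ℝ) (a b : ℝ) (n m : ℕ) :
    charlierMoment μ φ ψ a b 0 (n + 1) m = -a * charlierMoment μ φ ψ a b 0 n m := by
  simp [charlierMoment, charlierVal, pow_succ]
  ring

theorem integrable_charlierVal_mul {φ ψ : Z → ℝ} (hφ : Measurable φ) (hψ : Measurable ψ) {R : ℝ}
    (hφR : ∀ z, |φ z| ≤ R) (hψR : ∀ z, |ψ z| ≤ R) (a b : ℝ) (N n m : ℕ) :
    Integrable (fun z : Fin N → Z => charlierVal a N (fun i => φ (z i)) n *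
      charlierVal b N (fun i => ψ (z i)) m) (Measure.pi fun _ => μ) :=
  integrable_comp_tuple μ hφ hψ hφR hψR
    (F := fun q => charlierVal a N q.1 n * charlierVal b N q.2 m)
    (((continuous_charlierVal a N n).comp continuous_fst).mul
      ((continuous_charlierVal b N m).comp continuous_snd))

/-- By `charlierVal_succ` the φ-polynomial splits into a term -a and N + 1 terms that single out one
coordinate. Integrating that coordinate separately, the ψ-polynomial either ignores it, which gives
∫ φ, or uses it, which gives m ∫ φψ and lowers m by one. -/
theorem charlierMoment_succ {φ ψ : Z → ℝ} (hφ : Measurable φ) (hψ : Measurable ψ) {R : ℝ}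
    (hφR : ∀ z, |φ z| ≤ R) (hψR : ∀ z, |ψ z| ≤ R) (b : ℝ) (N n m : ℕ) :
    charlierMoment μ φ ψ (∫ z, φ z ∂μ) b (N + 1) (n + 1) m
      = -(∫ z, φ z ∂μ) * charlierMoment μ φ ψ (∫ z, φ z ∂μ) b (N + 1) n m
        + (N + 1) * ((∫ z, φ z ∂μ) * charlierMoment μ φ ψ (∫ z, φ z ∂μ) b N n m
          + m * (∫ z, φ z * ψ z ∂μ) * charlierMoment μ φ ψ (∫ z, φ z ∂μ) b N n (m - 1)) := by
  set a := ∫ z, φ z ∂μ with ha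
  have hterm : ∀ i : Fin (N + 1),
      Integrable (fun z : Fin (N + 1) → Z => φ (z i) *
        charlierVal a N (i.removeNth fun j => φ (z j)) n *
          charlierVal b (N + 1) (fun j => ψ (z j)) m) (Measure.pi fun _ => μ) ∧
      ∫ z : Fin (N + 1) → Z, φ (z i) * charlierVal a N (i.removeNth fun j => φ (z j)) n *
          charlierVal b (N + 1) (fun j => ψ (z j)) m ∂(Measure.pi fun _ => μ)
        = a * charlierMoment μ φ ψ a b N n m
          + m * (∫ z, φ z * ψ z ∂μ) * charlierMoment μ φ ψ a b N n (m - 1) := fun i => by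
    refine ⟨integrable_comp_tuple μ hφ hψ hφR hψR
      (F := fun q => q.1 i * charlierVal a N (i.removeNth q.1) n * charlierVal b (N + 1) q.2 m)
      ?_, ?_⟩
    · refine ((((continuous_apply i).comp continuous_fst).mul
        ((continuous_charlierVal a N n).comp ?_)).mul
        ((continuous_charlierVal b (N + 1) m).comp continuous_snd))
      exact continuous_pi fun j => (continuous_apply (i.succAbove j)).comp continuous_fst
    · have hmp := (measurePreserving_piFinSuccAbove (fun _ : Fin (N + 1) => μ) i).symm
      rw [← hmp.integral_comp' (g := fun z : Fin (N + 1) → Z => φ (z i) *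
        charlierVal a N (i.removeNth fun j => φ (z j)) n *
          charlierVal b (N + 1) (fun j => ψ (z j)) m)]
      -- The inserted point no longer occurs in the φ-polynomial, and `charlierVal_insertNth` peels
      -- it off the ψ-polynomial, so the integrand becomes a sum of two products with separated
      -- variables.
      have hpt : ∀ q : Z × (Fin N → Z), φ (((MeasurableEquiv.piFinSuccAbove (fun _ => Z) i).symm q) i)
          * charlierVal a N (i.removeNth fun j =>
              φ (((MeasurableEquiv.piFinSuccAbove (fun _ => Z) i).symm q) j)) n
          * charlierVal b (N + 1) (fun j =>
              ψ (((MeasurableEquiv.piFinSuccAbove (fun _ => Z) i).symm q) j)) m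
          = φ q.1 * (charlierVal a N (fun j => φ (q.2 j)) n * charlierVal b N (fun j => ψ (q.2 j)) m)
            + (φ q.1 * ψ q.1) * (m * (charlierVal a N (fun j => φ (q.2 j)) n *
              charlierVal b N (fun j => ψ (q.2 j)) (m - 1))) := fun q => by
        have e0 : (MeasurableEquiv.piFinSuccAbove (fun _ => Z) i).symm q
            = (i.insertNth q.1 q.2 : Fin (N + 1) → Z) := rfl
        have e1 : (fun j => ψ ((i.insertNth q.1 q.2 : Fin (N + 1) → Z) j))
            = (i.insertNth (ψ q.1) (fun j => ψ (q.2 j)) : Fin (N + 1) → ℝ) := by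
          funext j
          refine Fin.succAboveCases i ?_ (fun k => ?_) j <;> simp
        have e2 : (i.removeNth fun j => φ ((i.insertNth q.1 q.2 : Fin (N + 1) → Z) j))
            = fun j => φ (q.2 j) := by
          funext j
          simp [Fin.removeNth]
        rw [e0, e1, e2, charlierVal_insertNth, Fin.insertNth_apply_same]
        ring
      simp_rw [hpt]
      have hφi : Integrable φ μ :=
        Integrable.of_bound hφ.aestronglyMeasurable R (ae_of_all _ hφR)
      have hφψ : Integrable (fun z => φ z * ψ z) μ := by
        exact hφi.mul_bdd hψ.aestronglyMeasurable (ae_of_all _ hψR)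
      rw [integral_add, integral_prod_mul φ (fun y : Fin N → Z =>
          charlierVal a N (fun j => φ (y j)) n * charlierVal b N (fun j => ψ (y j)) m),
        integral_prod_mul (fun z => φ z * ψ z) (fun y : Fin N → Z =>
          (m : ℝ) * (charlierVal a N (fun j => φ (y j)) n *
            charlierVal b N (fun j => ψ (y j)) (m - 1))),
        integral_const_mul, ← ha]
      · simp only [charlierMoment]
        ring
      · exact hφi.mul_prod (integrable_charlierVal_mul μ hφ hψ hφR hψR a b N n m)
      · exact hφψ.mul_prod ((integrable_charlierVal_mul μ hφ hψ hφR hψR a b N n (m - 1)).const_mul _)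
  have hsplit : charlierMoment μ φ ψ a b (N + 1) (n + 1) m
      = -a * charlierMoment μ φ ψ a b (N + 1) n m
        + ∑ i : Fin (N + 1), ∫ z : Fin (N + 1) → Z, φ (z i) *
          charlierVal a N (i.removeNth fun j => φ (z j)) n *
          charlierVal b (N + 1) (fun j => ψ (z j)) m ∂(Measure.pi fun _ => μ) := by
    rw [← integral_finsetSum _ fun i _ => (hterm i).1, charlierMoment, charlierMoment,
      ← integral_const_mul, ← integral_add]
    · refine integral_congr_ae (ae_of_all _ fun z => ?_)
      simp only [charlierVal_succ, ← Finset.sum_mul]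
      ring
    · exact (integrable_charlierVal_mul μ hφ hψ hφR hψR a b (N + 1) n m).const_mul _
    · exact integrable_finsetSum _ fun i _ => (hterm i).1
  rw [hsplit, Finset.sum_congr rfl fun i _ => (hterm i).2, Finset.sum_const, Finset.card_univ,
    Fintype.card_fin, nsmul_eq_mul]
  push_cast
  ring

end TupleIntegrals

/-! ### Almost every tuple has distinct base points -/

section InjectiveTuples

variable {X M : Type*} [MeasurableSpace X] [MeasurableSpace M] [TopologicalSpace X]
  [SecondCountableTopology X] [T2Space X] [BorelSpace X]

/-- By Fubini in the i-th coordinate: once the others are fixed, a coincidence forces z_i into a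
single strip {x} × M, which is null. -/
theorem ae_fst_ne {μ : Measure (X × M)} [SigmaFinite μ]
    (hμ : ∀ x, μ (Prod.fst ⁻¹' {x}) = 0) {N : ℕ} {i j : Fin N} (hij : i ≠ j) :
    ∀ᵐ z ∂(Measure.pi fun _ : Fin N => μ), (z i).1 ≠ (z j).1 := by
  cases N with
  | zero => exact i.elim0
  | succ N =>
    obtain ⟨k, rfl⟩ := Fin.exists_succAbove_eq hij.symm
    have hmp := measurePreserving_piFinSuccAbove (fun _ : Fin (N + 1) => μ) i
    have hs : MeasurableSet {q : (X × M) × (Fin N → X × M) | q.1.1 = (q.2 k).1} :=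
      measurableSet_eq_fun (measurable_fst.comp measurable_fst)
        (measurable_fst.comp ((measurable_pi_apply k).comp measurable_snd))
    have h0 : (μ.prod (Measure.pi fun _ : Fin N => μ))
        {q : (X × M) × (Fin N → X × M) | q.1.1 = (q.2 k).1} = 0 := by
      rw [Measure.prod_apply_symm hs]
      refine (lintegral_congr fun y => ?_).trans lintegral_zero
      exact hμ (y k).1
    have h1 := hmp.measure_preimage hs.nullMeasurableSet
    rw [h0] at h1
    rw [ae_iff]
    refine measure_mono_null (fun z hz => ?_) h1
    exact not_not.1 hz

theorem ae_injective_fst {μ : Measure (X × M)} [SigmaFinite μ]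
    (hμ : ∀ x, μ (Prod.fst ⁻¹' {x}) = 0) (N : ℕ) :
    ∀ᵐ z ∂(Measure.pi fun _ : Fin N => μ), Function.Injective fun i => (z i).1 := by
  have h : ∀ᵐ z ∂(Measure.pi fun _ : Fin N => μ), ∀ i j, i ≠ j → (z i).1 ≠ (z j).1 := by
    refine ae_all_iff.2 fun i => ae_all_iff.2 fun j => ?_
    by_cases hij : i = j
    · simp [hij]
    · filter_upwards [ae_fst_ne hμ hij] with z hz _
      exact hz
  filter_upwards [h] with z hz i j hij
  by_contra hne
  exact hz i j hne hij

end InjectiveTuples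

/-! ### Orthogonality under the marked Poisson measure -/

section Orthogonality

variable {X M : Type*} [TopologicalSpace X] [MeasurableSpace X] [MeasurableSpace M]
  [SecondCountableTopology X] [T2Space X] [BorelSpace X] [LocallyCompactSpace X]
  [TopologicalSpace M] [T2Space M] [BorelSpace (X × M)]

/-- Divided by (N+1)!, the factor N + 1 in `charlierMoment_succ` turns the terms with N points into
the Poisson series over N. The two contributions of ∫ φ then cancel and only the contraction of φ
with ψ remains. -/
theorem integral_charlierQ_succ {τ : Measure (X × M)}
    (hfin : ∀ L : Set X, IsBc L → τ (L ×ˢ univ) < ∞) (hnull : ∀ x, τ (Prod.fst ⁻¹' {x}) = 0)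
    {π : Measure (MarkedConfig X M)} (hπ : IsMarkedPoisson τ π) {D : Set (X × M → ℝ)}
    (hD : IsTestClass τ D) {φ ψ : X × M → ℝ} (hφ : φ ∈ D) (hψ : ψ ∈ D) (n m : ℕ) :
    ∫ ω, charlierQ τ ω (n + 1) (fun _ => φ) * charlierQ τ ω m (fun _ => ψ) ∂π
      = m * (∫ z, φ z * ψ z ∂τ) *
        ∫ ω, charlierQ τ ω n (fun _ => φ) * charlierQ τ ω (m - 1) (fun _ => ψ) ∂π := by
  have hφc := hD.hasCompactSupport φ hφ
  have hψc := hD.hasCompactSupport ψ hψ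
  obtain ⟨L, hL, hKL, hLc⟩ := exists_isOpen_superset_and_isCompact_closure
    ((hφc.isCompact.image (continuous_fst (X := X) (Y := M))).union
      (hψc.isCompact.image (continuous_fst (X := X) (Y := M))))
  have hφL : Prod.fst '' tsupport φ ⊆ L := subset_union_left.trans hKL
  have hψL : Prod.fst '' tsupport ψ ⊆ L := subset_union_right.trans hKL
  have hTfin := hfin L (isBc_of_isOpen hL hLc)
  let μ := τ.restrict (L ×ˢ (univ : Set M))
  have : IsFiniteMeasure μ := ⟨by simpa [μ] using hTfin⟩
  have hμ : ∀ x, μ (Prod.fst ⁻¹' {x}) = 0 := fun x =>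
    le_antisymm ((Measure.restrict_apply_le _ _).trans (hnull x).le) bot_le
  have hsupp : ∀ f : X × M → ℝ, Prod.fst '' tsupport f ⊆ L →
      ∀ z, z ∉ L ×ˢ (univ : Set M) → f z = 0 := fun f hf z hz => by
    by_contra h
    exact hz ⟨hf ⟨z, subset_tsupport f h, rfl⟩, trivial⟩
  have hint : ∀ f : X × M → ℝ, (∀ z, z ∉ L ×ˢ (univ : Set M) → f z = 0) →
      ∫ z, f z ∂τ = ∫ z, f z ∂μ := fun f hf =>
    (setIntegral_eq_integral_of_forall_compl_eq_zero hf).symm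
  obtain ⟨R₁, hR₁⟩ := hφc.exists_bound_of_continuous (hD.continuous φ hφ)
  obtain ⟨R₂, hR₂⟩ := hψc.exists_bound_of_continuous (hD.continuous ψ hψ)
  have hφR : ∀ z, |φ z| ≤ max R₁ R₂ := fun z => (hR₁ z).trans (le_max_left _ _)
  have hψR : ∀ z, |ψ z| ≤ max R₁ R₂ := fun z => (hR₂ z).trans (le_max_right _ _)
  have hφm : Measurable φ := (hD.continuous φ hφ).measurable
  have hψm : Measurable ψ := (hD.continuous ψ hψ).measurable
  let E := Real.exp (-(τ (L ×ˢ univ)).toReal)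
  let u := charlierMoment μ φ ψ (∫ z, φ z ∂μ) (∫ z, ψ z ∂μ)
  let S : ℕ → ℕ → ℝ := fun n m =>
    ∫ ω, charlierQ τ ω n (fun _ => φ) * charlierQ τ ω m (fun _ => ψ) ∂π
  have hS : ∀ n m, HasSum (fun N : ℕ => E * ((N.factorial : ℝ)⁻¹ * u N n m)) (S n m) := by
    intro n m
    have hb := (hD.isExpBounded_charlierQ (n := n) fun _ => hφ).mul
      (hD.isExpBounded_charlierQ (n := m) fun _ => hψ)
    refine (hasSum_integral_markedPoisson hπ hL hLc hb.1 (hb.integrable hfin hπ)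
      fun ω => ?_).congr_fun fun N => ?_
    · simp only [charlierQ_restrict τ hφc hφL, charlierQ_restrict τ hψc hψL]
    · congr 2
      refine integral_congr_ae ?_
      filter_upwards [ae_injective_fst hμ N] with z hz
      have hQ : ∀ f : X × M → ℝ, Prod.fst '' tsupport f ⊆ L → ∀ k,
          charlierQ τ (MarkedConfig.ofTuple N z) k (fun _ => f)
            = charlierVal (∫ z, f z ∂μ) N (fun i => f (z i)) k := fun f hf k => by
        rw [charlierQ_eq_charlierPoly τ _ (List.ofFn z) (C := univ) (fun _ _ _ _ => trivial)
          (fun f _ => pairing_ofTuple hz f) (fun _ => trivial), charlierPoly_ofFn,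
          hint f (hsupp f hf)]
      simp only [hQ φ hφL, hQ ψ hψL]
  have hg : ∫ z, φ z * ψ z ∂τ = ∫ z, φ z * ψ z ∂μ :=
    hint _ fun z hz => by rw [hsupp φ hφL z hz, zero_mul]
  set a := ∫ z, φ z ∂μ with ha
  set g := ∫ z, φ z * ψ z ∂μ with hgdef
  have h1 := (hS (n + 1) m).add ((hS n m).mul_left a)
  have h2 := ((hS n m).mul_left a).add ((hS n (m - 1)).mul_left (m * g))
  -- The series for S(n+1, m) + a S(n, m) without its term N = 0, summed by means of the recursion
  -- for the moments.
  have h3 : HasSum (fun N : ℕ => E * (((N + 1).factorial : ℝ)⁻¹ * u (N + 1) (n + 1) m)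
      + a * (E * (((N + 1).factorial : ℝ)⁻¹ * u (N + 1) n m)))
      (a * S n m + m * g * S n (m - 1)) := by
    refine h2.congr_fun fun N => ?_
    have hrec := charlierMoment_succ μ hφm hψm hφR hψR (∫ z, ψ z ∂μ) N n m
    simp only [u]
    rw [hrec, Nat.factorial_succ]
    push_cast
    field_simp
    ring
  rw [hasSum_nat_add_iff (f := fun N : ℕ => E * ((N.factorial : ℝ)⁻¹ * u N (n + 1) m)
      + a * (E * ((N.factorial : ℝ)⁻¹ * u N n m))) 1] at h3
  have h4 := h1.unique h3
  -- The omitted term N = 0 vanishes, since without points Q_{n+1} = -a Q_n.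
  have h5 : u 0 (n + 1) m = -a * u 0 n m := charlierMoment_zero_succ μ φ ψ _ _ n m
  simp only [Finset.sum_range_one, h5] at h4
  rw [hg]
  change S (n + 1) m = m * g * S n (m - 1)
  linarith

theorem integral_charlierQ_mul {τ : Measure (X × M)}
    (hfin : ∀ L : Set X, IsBc L → τ (L ×ˢ univ) < ∞) (hnull : ∀ x, τ (Prod.fst ⁻¹' {x}) = 0)
    {π : Measure (MarkedConfig X M)} (hπ : IsMarkedPoisson τ π) {D : Set (X × M → ℝ)}
    (hD : IsTestClass τ D) {φ ψ : X × M → ℝ} (hφ : φ ∈ D) (hψ : ψ ∈ D) (n m : ℕ) :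
    ∫ ω, charlierQ τ ω n (fun _ => φ) * charlierQ τ ω m (fun _ => ψ) ∂π
      = if n = m then (n.factorial : ℝ) * (∫ z, φ z * ψ z ∂τ) ^ n else 0 := by
  have := hπ.1
  induction n generalizing m with
  | zero =>
    cases m with
    | zero => simp [charlierQ]
    | succ m =>
      -- With the roles of φ and ψ exchanged, the second degree is 0, so the factor in front of the
      -- contraction is 0.
      have h := integral_charlierQ_succ hfin hnull hπ hD hψ hφ m 0
      simp only [mul_comm (charlierQ τ _ 0 _)]
      rw [h]
      simp
  | succ n ih =>
    rw [integral_charlierQ_succ hfin hnull hπ hD hφ hψ]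
    cases m with
    | zero => simp
    | succ m =>
      rw [Nat.add_sub_cancel, ih]
      by_cases h : n = m
      · subst h
        rw [if_pos rfl, if_pos rfl, Nat.factorial_succ]
        push_cast
        ring
      · rw [if_neg h, if_neg (by omega), mul_zero]

end Orthogonality

/-! ### The gradient and the second quantized operator on cylinder functions -/

theorem MarkedConfig.countable_image_fst {X M : Type*} [TopologicalSpace X] [SigmaCompactSpace X]
    (ω : MarkedConfig X M) : (Prod.fst '' ω.1).Countable := by
  rw [← inter_univ (Prod.fst '' ω.1), ← iUnion_compactCovering X, inter_iUnion]
  exact countable_iUnion fun n => (ω.2.2 _ (isCompact_compactCovering X n)).countable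

section Gradient

variable {X M : Type*} [TopologicalSpace X] [MeasurableSpace X] [MeasurableSpace M]
  [SecondCountableTopology X] [T2Space X] [BorelSpace X] [LocallyCompactSpace X]
  [TopologicalSpace M] [T2Space M] [BorelSpace (X × M)]
  {τ : Measure (X × M)} {D : Set (X × M → ℝ)}

theorem IsTestClass.memLp_two (hD : IsTestClass τ D) {φ : X × M → ℝ} (hφ : φ ∈ D) :
    MemLp φ 2 τ := by
  rw [memLp_two_iff_integrable_sq (hD.integrable φ hφ).aestronglyMeasurable]
  simpa only [sq] using hD.integrable _ (hD.mul_mem φ hφ φ hφ)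

theorem ae_fst_notMem (hnull : ∀ x, τ (Prod.fst ⁻¹' {x}) = 0) (ω : MarkedConfig X M) :
    ∀ᵐ z ∂τ, z.1 ∉ Prod.fst '' ω.1 := by
  have h : τ (Prod.fst ⁻¹' (Prod.fst '' ω.1)) = 0 := by
    rw [← biUnion_of_singleton (Prod.fst '' ω.1), preimage_iUnion₂]
    exact (measure_biUnion_null_iff ω.countable_image_fst).2 fun x _ => hnull x
  refine measure_mono_null (fun z hz => ?_) h
  exact not_not.1 hz

/-- A finite linear combination of the functions `ω ↦ Q_n(φ^{⊗n}; ω)`. -/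
def charlierSum (τ : Measure (X × M)) (c : ℕ × D →₀ ℝ) (ω : MarkedConfig X M) : ℝ :=
  ∑ q ∈ c.support, c q * charlierQ τ ω q.1 fun _ => q.2.1

theorem exists_eq_charlierSum (hD : IsTestClass τ D) {F : MarkedConfig X M → ℝ}
    (hF : F ∈ PolyCylinder D) : ∃ c : ℕ × D →₀ ℝ, F = charlierSum τ c := by
  have h := polyCylinder_subset_charlierSpan hD hF
  obtain ⟨c, hc⟩ := Finsupp.mem_span_range_iff_exists_finsupp.1 h
  refine ⟨c, ?_⟩
  rw [← hc]
  funext ω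
  simp [Finsupp.sum, charlierSum]

/-- The coefficient of `φ` in the gradient of `Q_n(φ^{⊗n}; ·)`. -/
def gradCoeff (τ : Measure (X × M)) (c : ℕ × D →₀ ℝ) (ω : MarkedConfig X M) (q : ℕ × D) : ℝ :=
  c q * (q.1 * charlierQ τ ω (q.1 - 1) fun _ => q.2.1)

/-- For fixed ω the strips over its countably many base points are null, so almost everywhere the
gradient is a finite linear combination of test functions. This puts it in the domain of A for every
ω, not just for almost every ω. -/
theorem gradMP_charlierSum_ae (hD : IsTestClass τ D) (hnull : ∀ x, τ (Prod.fst ⁻¹' {x}) = 0)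
    (c : ℕ × D →₀ ℝ) (ω : MarkedConfig X M) :
    (fun z => ∑ q ∈ c.support, gradCoeff τ c ω q * q.2.1 z) =ᵐ[τ] gradMP (charlierSum τ c) ω := by
  filter_upwards [ae_fst_notMem hnull ω] with z hz
  rw [gradMP, charlierSum, charlierSum, ← Finset.sum_sub_distrib]
  refine Finset.sum_congr rfl fun q _ => ?_
  rw [charlierQ_const_addPoint τ (hD.hasCompactSupport _ q.2.2) ω hz, gradCoeff]
  ring

theorem memLp_gradMP_charlierSum (hD : IsTestClass τ D) (hnull : ∀ x, τ (Prod.fst ⁻¹' {x}) = 0)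
    (c : ℕ × D →₀ ℝ) (ω : MarkedConfig X M) : MemLp (gradMP (charlierSum τ c) ω) 2 τ :=
  (memLp_finsetSum _ fun q _ => (hD.memLp_two q.2.2).const_mul (gradCoeff τ c ω q)).ae_eq
    (gradMP_charlierSum_ae hD hnull c ω)

theorem toL2_gradMP_charlierSum (hD : IsTestClass τ D) (hnull : ∀ x, τ (Prod.fst ⁻¹' {x}) = 0)
    (c : ℕ × D →₀ ℝ) (ω : MarkedConfig X M) :
    toL2 τ (gradMP (charlierSum τ c) ω)
      = ∑ q ∈ c.support, gradCoeff τ c ω q • toL2 τ q.2.1 := by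
  rw [← toL2_congr (gradMP_charlierSum_ae hD hnull c ω)]
  exact toL2_sum_smul c.support (gradCoeff τ c ω) fun q => hD.memLp_two q.2.2

theorem mem_graph_gradMP_charlierSum (hD : IsTestClass τ D)
    (hnull : ∀ x, τ (Prod.fst ⁻¹' {x}) = 0) {A : Lp ℝ 2 τ →ₗ.[ℝ] Lp ℝ 2 τ}
    {a : D → Lp ℝ 2 τ} (ha : ∀ φ : D, (toL2 τ φ.1, a φ) ∈ A.graph)
    (c : ℕ × D →₀ ℝ) (ω : MarkedConfig X M) :
    (toL2 τ (gradMP (charlierSum τ c) ω), ∑ q ∈ c.support, gradCoeff τ c ω q • a q.2)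
      ∈ A.graph := by
  have h := A.graph.sum_mem (t := c.support) fun q _ =>
    A.graph.smul_mem (gradCoeff τ c ω q) (ha q.2)
  rw [toL2_gradMP_charlierSum hD hnull]
  convert h using 1
  refine Prod.ext ?_ ?_
  · simp [Prod.fst_sum]
  · simp [Prod.snd_sum]

end Gradient

/-! ### The chaos isometry and the formula on the spanning family -/

section Formula

variable {X M : Type*} [TopologicalSpace X] [MeasurableSpace X] [MeasurableSpace M]
  [SecondCountableTopology X] [T2Space X] [BorelSpace X] [LocallyCompactSpace X]
  [TopologicalSpace M] [T2Space M] [BorelSpace (X × M)]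
  {τ : Measure (X × M)} {D : Set (X × M → ℝ)} {π : Measure (MarkedConfig X M)}

theorem isExpBounded_charlierSum (hD : IsTestClass τ D) (c : ℕ × D →₀ ℝ) :
    IsExpBounded (charlierSum τ c) :=
  IsExpBounded.sum c.support fun q =>
    (hD.isExpBounded_charlierQ fun _ => q.2.2).const_mul (c q)

theorem exists_chaosMap_eq [SigmaFinite τ] (hfin : ∀ L : Set X, IsBc L → τ (L ×ˢ univ) < ∞)
    (hnull : ∀ x, τ (Prod.fst ⁻¹' {x}) = 0) (hπ : IsMarkedPoisson τ π) (hD : IsTestClass τ D)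
    (hdense : DenseRange fun φ : D => toL2 τ φ.1) :
    ∃ U : Fock τ →ₗᵢ[ℝ] Lp ℝ 2 π, chaosMap D τ π = U.toLinearMap ∧ ∀ n, ∀ φ ∈ D,
      U (fockPow τ n (toL2 τ φ)) = toL2 π fun ω => charlierQ τ ω n fun _ => φ := by
  have h : ∃ U : Fock τ →ₗᵢ[ℝ] Lp ℝ 2 π, ∀ n, ∀ φ ∈ D,
      U (fockPow τ n (toL2 τ φ)) = toL2 π fun ω => charlierQ τ ω n fun _ => φ := by
    have hQ : ∀ q : ℕ × D, MemLp (fun ω => charlierQ τ ω q.1 fun _ => q.2.1) 2 π := fun q =>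
      (hD.isExpBounded_charlierQ fun _ => q.2.2).memLp_two hfin hπ
    obtain ⟨U, hU⟩ := exists_linearIsometry_of_gram_eq
      (w := fun q : ℕ × D => toL2 π fun ω => charlierQ τ ω q.1 fun _ => q.2.1)
      (topologicalClosure_span_fockPow τ hdense) fun q q' => by
        rw [inner_toL2 (hQ q) (hQ q'), integral_charlierQ_mul hfin hnull hπ hD q.2.2 q'.2.2,
          inner_fockPow, inner_toL2 (hD.memLp_two q.2.2) (hD.memLp_two q'.2.2)]
    exact ⟨U, fun n φ hφ => hU (n, ⟨φ, hφ⟩)⟩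
  exact ⟨h.choose, by rw [chaosMap, dif_pos h], h.choose_spec⟩

theorem mem_graph_imageOperator {H K : Type*} [NormedAddCommGroup H] [InnerProductSpace ℝ H]
    [NormedAddCommGroup K] [InnerProductSpace ℝ K] (U : H →ₗᵢ[ℝ] K) {L : H →ₗ.[ℝ] H} {x : H × H}
    (hx : x ∈ L.graph) : (U x.1, U x.2) ∈ (imageOperator U.toLinearMap L).graph := by
  rw [imageOperator, Submodule.toLinearPMap_graph_eq]
  · exact ⟨x, hx, rfl⟩
  · rintro _ ⟨y, hy, rfl⟩ h0
    have h1 : y.1 = 0 := U.injective (h0.trans (map_zero U).symm)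
    have h2 : y.2 = 0 := L.graph_fst_eq_zero_snd hy h1
    change U y.2 = 0
    rw [h2, map_zero]

theorem LinearPMap.apply_eq_of_mem_graph {E F : Type*} [AddCommGroup E] [Module ℝ E]
    [AddCommGroup F] [Module ℝ F] {L : E →ₗ.[ℝ] F} {x : E} {y : F} (h : (x, y) ∈ L.graph)
    (hx : x ∈ L.domain) : L ⟨x, hx⟩ = y :=
  (L.mem_graph_snd_inj (L.mem_graph ⟨x, hx⟩) h rfl)

/-- The formula `(H F₁, F₂) = ∫ (∇F₁, A ∇F₂) dπ` for any class of test functions that is dense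
in `L²(τ)` and contained in the domain of `A`. -/
theorem inner_hamiltonianMP [SigmaFinite τ] (hfin : ∀ L : Set X, IsBc L → τ (L ×ˢ univ) < ∞)
    (hnull : ∀ x, τ (Prod.fst ⁻¹' {x}) = 0) (hπ : IsMarkedPoisson τ π) (hD : IsTestClass τ D)
    (hdense : DenseRange fun φ : D => toL2 τ φ.1) {A : Lp ℝ 2 τ →ₗ.[ℝ] Lp ℝ 2 τ}
    (hA : IsSelfAdjoint A) (hApos : ∀ f : A.domain, 0 ≤ inner ℝ (f : Lp ℝ 2 τ) (A f))
    (hAdom : ∀ φ ∈ D, toL2 τ φ ∈ A.domain) :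
    (∀ F ∈ PolyCylinder D, MemLp F 2 π ∧ ∀ ω, MemLp (gradMP F ω) 2 τ) ∧
    ∃ (hdom : ∀ F ∈ PolyCylinder D, toL2 π F ∈ (hamiltonianMP D τ π A).domain)
      (hgrad : ∀ F ∈ PolyCylinder D, ∀ ω, toL2 τ (gradMP F ω) ∈ A.domain),
      ∀ (F₁ : MarkedConfig X M → ℝ) (hF₁ : F₁ ∈ PolyCylinder D)
        (F₂ : MarkedConfig X M → ℝ) (hF₂ : F₂ ∈ PolyCylinder D),
        Integrable (fun ω => inner ℝ (toL2 τ (gradMP F₁ ω))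
          (A ⟨toL2 τ (gradMP F₂ ω), hgrad F₂ hF₂ ω⟩)) π ∧
        inner ℝ (hamiltonianMP D τ π A ⟨toL2 π F₁, hdom F₁ hF₁⟩) (toL2 π F₂) =
          ∫ ω, inner ℝ (toL2 τ (gradMP F₁ ω))
            (A ⟨toL2 τ (gradMP F₂ ω), hgrad F₂ hF₂ ω⟩) ∂π := by
  obtain ⟨U, hchaos, hU⟩ := exists_chaosMap_eq hfin hnull hπ hD hdense
  let a : D → Lp ℝ 2 τ := fun φ => A ⟨toL2 τ φ.1, hAdom φ.1 φ.2⟩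
  have ha : ∀ φ : D, (toL2 τ φ.1, a φ) ∈ A.graph := fun φ => A.mem_graph ⟨_, hAdom φ.1 φ.2⟩
  -- `G q` is the value of dExp A at the pure power indexed by q.
  choose G hG hGinner using fun q : ℕ × D => exists_mem_graph_dExp τ hA hApos q.1 (ha q.2)
  have hQ : ∀ q : ℕ × D, MemLp (fun ω => charlierQ τ ω q.1 fun _ => q.2.1) 2 π := fun q =>
    (hD.isExpBounded_charlierQ fun _ => q.2.2).memLp_two hfin hπ
  have hsum : ∀ c : ℕ × D →₀ ℝ, toL2 π (charlierSum τ c)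
      = U (∑ q ∈ c.support, c q • fockPow τ q.1 (toL2 τ q.2.1)) := fun c => by
    simp only [map_sum, map_smul, hU _ _ (Subtype.coe_prop _)]
    exact toL2_sum_smul c.support c hQ
  have hgraph : ∀ c : ℕ × D →₀ ℝ, (toL2 π (charlierSum τ c), U (∑ q ∈ c.support, c q • G q))
      ∈ (hamiltonianMP D τ π A).graph := fun c => by
    have h := (dExp τ A).graph.sum_mem (t := c.support) fun q _ =>
      (dExp τ A).graph.smul_mem (c q) (hG q)
    have h' := mem_graph_imageOperator U h
    rw [hamiltonianMP, hchaos, hsum]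
    simpa [Prod.fst_sum, Prod.snd_sum] using h'
  have hdom : ∀ F ∈ PolyCylinder D, toL2 π F ∈ (hamiltonianMP D τ π A).domain := by
    intro F hF
    obtain ⟨c, rfl⟩ := exists_eq_charlierSum hD hF
    exact LinearPMap.mem_domain_of_mem_graph (hgraph c)
  have hgrad : ∀ F ∈ PolyCylinder D, ∀ ω, toL2 τ (gradMP F ω) ∈ A.domain := by
    intro F hF ω
    obtain ⟨c, rfl⟩ := exists_eq_charlierSum hD hF
    exact LinearPMap.mem_domain_of_mem_graph (mem_graph_gradMP_charlierSum hD hnull ha c ω)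
  refine ⟨fun F hF => ?_, hdom, hgrad, fun F₁ hF₁ F₂ hF₂ => ?_⟩
  · obtain ⟨c, rfl⟩ := exists_eq_charlierSum hD hF
    exact ⟨(isExpBounded_charlierSum hD c).memLp_two hfin hπ,
      memLp_gradMP_charlierSum hD hnull c⟩
  obtain ⟨c, rfl⟩ := exists_eq_charlierSum hD hF₁
  obtain ⟨e, rfl⟩ := exists_eq_charlierSum hD hF₂
  have hprod : ∀ q q' : ℕ × D, Integrable (fun ω =>
      charlierQ τ ω (q.1 - 1) (fun _ => q.2.1) * charlierQ τ ω (q'.1 - 1) (fun _ => q'.2.1)) π :=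
    fun q q' => ((hD.isExpBounded_charlierQ fun _ => q.2.2).mul
      (hD.isExpBounded_charlierQ fun _ => q'.2.2)).integrable hfin hπ
  have hinner : ∀ ω, inner ℝ (toL2 τ (gradMP (charlierSum τ c) ω))
      (A ⟨toL2 τ (gradMP (charlierSum τ e) ω), hgrad _ hF₂ ω⟩)
      = ∑ q ∈ c.support, ∑ q' ∈ e.support,
        (c q * e q' * (q.1 * q'.1) * inner ℝ (toL2 τ q.2.1) (a q'.2)) *
          (charlierQ τ ω (q.1 - 1) (fun _ => q.2.1) *
            charlierQ τ ω (q'.1 - 1) (fun _ => q'.2.1)) := fun ω => by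
    rw [LinearPMap.apply_eq_of_mem_graph (mem_graph_gradMP_charlierSum hD hnull ha e ω),
      toL2_gradMP_charlierSum hD hnull, sum_inner]
    refine Finset.sum_congr rfl fun q _ => ?_
    rw [inner_sum]
    refine Finset.sum_congr rfl fun q' _ => ?_
    rw [real_inner_smul_left, real_inner_smul_right, gradCoeff, gradCoeff]
    ring
  simp only [hinner]
  refine ⟨integrable_finsetSum _ fun q _ => integrable_finsetSum _ fun q' _ =>
    (hprod q q').const_mul _, ?_⟩
  rw [integral_finsetSum _ fun q _ => integrable_finsetSum _ fun q' _ =>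
    (hprod q q').const_mul _, LinearPMap.apply_eq_of_mem_graph (hgraph c), hsum, U.inner_map_map,
    sum_inner]
  refine Finset.sum_congr rfl fun q _ => ?_
  rw [integral_finsetSum _ fun q' _ => (hprod q q').const_mul _, inner_sum]
  refine Finset.sum_congr rfl fun q' _ => ?_
  have hsymm : inner ℝ (a q.2) (toL2 τ q'.2.1) = inner ℝ (toL2 τ q.2.1) (a q'.2) :=
    hA.inner_graph (ha q.2) (ha q'.2)
  rw [real_inner_smul_left, real_inner_smul_right, hGinner, integral_const_mul,
    integral_charlierQ_mul hfin hnull hπ hD q.2.2 q'.2.2, hsymm,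
    inner_toL2 (hD.memLp_two q.2.2) (hD.memLp_two q'.2.2)]
  -- Degree 0 is separated because of the truncated n - 1: indices 0 and 1 would both be lowered to
  -- 0, but the coefficients n and m make those terms vanish.
  rcases Nat.eq_zero_or_pos q.1 with h0 | h0
  · simp [h0]
  rcases Nat.eq_zero_or_pos q'.1 with h1 | h1
  · rw [if_neg (by omega)]
    simp [h1]
  by_cases h : q.1 = q'.1
  -- Here the two sides carry n! n and n² (n-1)!, which coincide.
  · rw [if_pos h, if_pos (by rw [h]), ← h]
    obtain ⟨n, hn⟩ := Nat.exists_eq_succ_of_ne_zero h0.ne'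
    rw [hn, Nat.factorial_succ, Nat.succ_sub_one]
    push_cast
    ring
  · rw [if_neg h, if_neg (by omega)]
    ring

end Formula

/-! ### Test functions on manifolds -/

section Manifolds

variable {d k : ℕ} {X M : Type*}
  [TopologicalSpace X] [T2Space X] [SecondCountableTopology X]
  [ChartedSpace (EuclideanSpace ℝ (Fin d)) X] [MeasurableSpace X] [BorelSpace X]
  [TopologicalSpace M] [T2Space M] [SecondCountableTopology M]
  [ChartedSpace (EuclideanSpace ℝ (Fin k)) M] [MeasurableSpace M] [BorelSpace M]
  {τ : Measure (X × M)}

theorem isTestClass_testFun [IsLocallyFiniteMeasure τ] : IsTestClass τ (TestFun d k X M) where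
  zero_mem := ⟨contMDiff_const, HasCompactSupport.zero⟩
  add_mem _ hf _ hg := ⟨hf.1.add hg.1, hf.2.add hg.2⟩
  mul_mem _ hf _ hg := ⟨hf.1.mul hg.1, hf.2.mul_right⟩
  hasCompactSupport _ hf := hf.2
  continuous _ hf := hf.1.continuous
  integrable _ hf := hf.1.continuous.integrable_of_hasCompactSupport hf.2

theorem denseRange_toL2_testFun [IsManifold (𝓡 d) ((⊤ : ℕ∞) : WithTop ℕ∞) X]
    [IsManifold (𝓡 k) ((⊤ : ℕ∞) : WithTop ℕ∞) M] [IsLocallyFiniteMeasure τ] :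
    DenseRange fun φ : TestFun d k X M => toL2 τ φ.1 := by
  have := ChartedSpace.locallyCompactSpace (EuclideanSpace ℝ (Fin d)) X
  have := ChartedSpace.locallyCompactSpace (EuclideanSpace ℝ (Fin k)) M
  have hD : IsTestClass τ (TestFun d k X M) := isTestClass_testFun
  have hL := fun φ : TestFun d k X M => hD.memLp_two φ.2
  let S : Submodule ℝ (Lp ℝ 2 τ) :=
    { carrier := range fun φ : TestFun d k X M => toL2 τ φ.1
      zero_mem' := ⟨⟨0, hD.zero_mem⟩, by
        change toL2 τ (0 : X × M → ℝ) = 0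
        rw [toL2_of_memLp MemLp.zero]
        exact MemLp.toLp_zero _⟩
      add_mem' := by
        rintro _ _ ⟨φ, rfl⟩ ⟨ψ, rfl⟩
        refine ⟨⟨φ.1 + ψ.1, hD.add_mem _ φ.2 _ ψ.2⟩, ?_⟩
        simp only [toL2_of_memLp (hL φ), toL2_of_memLp (hL ψ), toL2_of_memLp ((hL φ).add (hL ψ))]
        exact MemLp.toLp_add (hL φ) (hL ψ)
      smul_mem' := by
        rintro r _ ⟨φ, rfl⟩
        refine ⟨⟨fun z => r * φ.1 z, contMDiff_const.mul φ.2.1, φ.2.2.mul_left⟩, ?_⟩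
        simp only [toL2_of_memLp (hL φ), toL2_of_memLp ((hL φ).const_mul r)]
        exact MemLp.toLp_const_smul r (hL φ) }
  have htop : S.topologicalClosure = ⊤ := by
    rw [Submodule.topologicalClosure_eq_top_iff, Submodule.eq_bot_iff]
    intro f hf
    -- The fundamental lemma of the calculus of variations: a locally integrable function whose
    -- integral against every smooth compactly supported function is 0 vanishes almost everywhere.
    have h0 : ∀ᵐ z ∂τ, f z = 0 := by
      refine ae_eq_zero_of_integral_contMDiff_smul_eq_zero ((𝓡 d).prod (𝓡 k))
        ((Lp.memLp f).locallyIntegrable one_le_two) fun g hg hgc => ?_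
      have h := (Submodule.mem_orthogonal _ _).1 hf _ ⟨⟨g, hg, hgc⟩, rfl⟩
      rw [← toL2_coeFn f, inner_toL2 (hL ⟨g, hg, hgc⟩) (Lp.memLp f)] at h
      exact h
    exact Lp.eq_zero_iff_ae_eq_zero.2 h0
  exact Submodule.dense_iff_topologicalClosure_eq_top.2 htop

end Manifolds

/-! ### Finiteness properties of the Lévy measure -/

section FiniteOnStrips

variable {X M : Type*} [TopologicalSpace X] [T2Space X] [LocallyCompactSpace X]
  [MeasurableSpace X] [BorelSpace X] [MeasurableSpace M]
  {τ : Measure (X × M)}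

theorem sigmaFinite_of_finite_strips [SecondCountableTopology X]
    (hfin : ∀ L : Set X, IsBc L → τ (L ×ˢ univ) < ∞) :
    SigmaFinite τ := by
  refine ⟨⟨⟨fun n => compactCovering X n ×ˢ univ, fun _ => trivial, fun n => hfin _ ?_, ?_⟩⟩⟩
  · have hc := isCompact_compactCovering X n
    exact ⟨hc.measurableSet, hc.isClosed.closure_eq.symm ▸ hc⟩
  · rw [← iUnion_prod_const, iUnion_compactCovering, univ_prod_univ]

theorem isLocallyFiniteMeasure_of_finite_strips [TopologicalSpace M]
    (hfin : ∀ L : Set X, IsBc L → τ (L ×ˢ univ) < ∞) : IsLocallyFiniteMeasure τ := by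
  refine ⟨fun z => ?_⟩
  obtain ⟨K, hK, hzK⟩ := exists_compact_mem_nhds z.1
  exact ⟨K ×ˢ univ, prod_mem_nhds hzK univ_mem,
    hfin K ⟨hK.measurableSet, hK.isClosed.closure_eq.symm ▸ hK⟩⟩

end FiniteOnStrips

/-- The only fibre that meets the strip over x is the one at x itself, and σ does not charge x. -/
theorem compProd_preimage_fst_singleton {X M : Type*} [MeasurableSpace X]
    [MeasurableSingletonClass X] [MeasurableSpace M] (σ : Measure X) [SFinite σ]
    [NullSingletonClass σ] (p : Kernel X M) [IsSFiniteKernel p] (x : X) :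
    (σ.compProd p) (Prod.fst ⁻¹' {x}) = 0 := by
  rw [Measure.compProd_apply (measurable_fst (measurableSet_singleton x))]
  refine lintegral_eq_zero_of_ae_eq_zero ?_
  filter_upwards [Measure.ae_ne σ x] with y hy
  have : Prod.mk y ⁻¹' (Prod.fst ⁻¹' {x}) = (∅ : Set M) := by
    ext m
    simpa using hy
  rw [this, measure_empty, Pi.zero_apply]

theorem theorem6p1
    {d k : ℕ} {X M : Type*}
    [TopologicalSpace X] [T2Space X] [SecondCountableTopology X]
    [ChartedSpace (EuclideanSpace ℝ (Fin d)) X]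
    [IsManifold (𝓡 d) ((⊤ : ℕ∞) : WithTop ℕ∞) X]
    [MeasurableSpace X] [BorelSpace X]
    [TopologicalSpace M] [T2Space M] [SecondCountableTopology M]
    [ChartedSpace (EuclideanSpace ℝ (Fin k)) M]
    [IsManifold (𝓡 k) ((⊤ : ℕ∞) : WithTop ℕ∞) M]
    [MeasurableSpace M] [BorelSpace M]
    (σ : Measure X) [IsLocallyFiniteMeasure σ] [NullSingletonClass σ]
    (p : Kernel X M) [IsSFiniteKernel p]
    (τ : Measure (X × M)) (hτ : τ = σ.compProd p)
    (hfin : ∀ L : Set X, IsBc L → τ (L ×ˢ univ) < ∞)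
    (π : Measure (MarkedConfig X M)) (hπ : IsMarkedPoisson τ π)
    (A : Lp ℝ 2 τ →ₗ.[ℝ] Lp ℝ 2 τ) (hA : IsSelfAdjoint A)
    (hApos : ∀ f : A.domain, 0 ≤ inner ℝ (f : Lp ℝ 2 τ) (A f))
    (hAdom : ∀ φ ∈ TestFun d k X M, toL2 τ φ ∈ A.domain) :
    -- the functions below define elements of `L²`, so that `toL2` is their class
    (∀ F ∈ PolyCylinder (TestFun d k X M), MemLp F 2 π ∧ ∀ ω, MemLp (gradMP F ω) 2 τ) ∧
    -- both sides of the formula are meaningful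
    ∃ (hdom : ∀ F ∈ PolyCylinder (TestFun d k X M),
        toL2 π F ∈ (hamiltonianMP (TestFun d k X M) τ π A).domain)
      (hgrad : ∀ F ∈ PolyCylinder (TestFun d k X M), ∀ ω,
        toL2 τ (gradMP F ω) ∈ A.domain),
      ∀ (F₁ : MarkedConfig X M → ℝ) (hF₁ : F₁ ∈ PolyCylinder (TestFun d k X M))
        (F₂ : MarkedConfig X M → ℝ) (hF₂ : F₂ ∈ PolyCylinder (TestFun d k X M)),
        Integrable (fun ω => inner ℝ (toL2 τ (gradMP F₁ ω))
          (A ⟨toL2 τ (gradMP F₂ ω), hgrad F₂ hF₂ ω⟩)) π ∧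
        inner ℝ (hamiltonianMP (TestFun d k X M) τ π A ⟨toL2 π F₁, hdom F₁ hF₁⟩) (toL2 π F₂) =
          ∫ ω, inner ℝ (toL2 τ (gradMP F₁ ω))
            (A ⟨toL2 τ (gradMP F₂ ω), hgrad F₂ hF₂ ω⟩) ∂π := by
  have := ChartedSpace.locallyCompactSpace (EuclideanSpace ℝ (Fin d)) X
  have := sigmaFinite_of_finite_strips hfin
  have := isLocallyFiniteMeasure_of_finite_strips hfin
  exact inner_hamiltonianMP hfin
    (fun x => hτ ▸ compProd_preimage_fst_singleton σ p x) hπ isTestClass_testFun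
    denseRange_toL2_testFun hA hApos hAdom

end
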